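/- Let $n\ge 2$, let $\mu$ be the volume measure on $S^{n-1}\subset\mathbb R^n$, and let $\mathcal H_d\subset C(S^{n-1})$ be the space of restrictions to $S^{n-1}$ of homogeneous harmonic polynomials of degree $d$ on $\mathbb R^n$. For a continuous $f:S^{n-1}\to\mathbb R$ let $f_d\in\mathcal H_d$ be its $d$-th harmonic component, i.e. its orthogonal projection to $\mathcal H_d$ in $L^2(S^{n-1},\mu)$. Let $C_d^{(\alpha)}$ be the Gegenbauer polynomials and $$Z_d(t)=\frac{\dim \mathcal H_d}{\mu(S^{n-1})\,C_d^{(\alpha)}(1)}\,C_d^{(\alpha)}(t),\qquad \alpha=\tfrac{n-2}{2},$$ where for $n=2$ the quotient $C_d^{(\alpha)}(t)/C_d^{(\alpha)}(1)$ is read as its limit for $\alpha\to0$, the Chebyshev polynomial $T_d(t)$. A quadrature rule $(X,W)$ is a finite set $X\subset S^{n-1}$ with weights $W:X\to\mathbb R_{>0}$; it is exact in degree $D$ if $\sum_{z\in X}W(z)p(z)=\int_{S^{n-1}} p\,d\mu$ for every polynomial $p$ of degree at most $D$. Algorithm 1 has as input integers $d,m>0$ and a continuous function $f$ on $S^{n-1}$,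 given as a black box for evaluation. It computes a quadrature rule $(X,W)$ exact in degrees $d+m$ and $2d$, and returns the polynomial $$\widetilde f_d(x)=\sum_{z\in X}W(z)\,f(z)\,Z_d(\langle x,z\rangle),$$ given by the list of the nodes $z$, the weights $W(z)$, the numbers $W(z)f(z)$ and the coefficients of $Z_d$. Running time is the number of steps of a program with counters (natural numbers, with addition, subtraction and comparison) and arrays of real numbers, with exact $+,-,\times,\div,\sqrt{\ }$, the constant $\pi$ and counted loops; each operation and each evaluation of $f$ is one step. **Theorem.** For every $n\ge2$ there are a constant $C>0$, a program and integers $K,a\ge 0$, depending only on $n$, such that: 1. For all $d,m>0$ there is a quadrature rule exact in degrees $d+m$ and $2d$ such that, for every continuous $f$, the program with inputs $f,d,m$ carries out Algorithm 1 with this rule in at most $K(d+m)^a$ steps. 2. Let $d,m>0$, let $\varepsilon>0$, $\kappa\ge0$, and let $f$ be $\kappa$-Lipschitz for the geodesic distance on $S^{n-1}$. If $m\ge C\kappa\sqrt{\dim\mathcal H_d}/\varepsilon$, then for every quadrature rule exact in degrees $d+m$ and $2d$, $\widetilde f_d$ is a polynomial of degree at most $d$ and $\|\widetilde f_d-f_d\|_\infty<\varepsilon$.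 3. For all $d>0$, $\varepsilon>0$, $\kappa\ge0$ and continuous $f$, the program with $m=\max\bigl(1,\lceil C\kappa\sqrt{\dim\mathcal H_d}/\varepsilon\rceil\bigr)$ takes at most $K\bigl((1+\kappa/\varepsilon)\,d\bigr)^a$ steps. In particular the time is polynomial in $d$ for fixed $n,\kappa,\varepsilon$. -/

import Mathlib

open MeasureTheory

noncomputable section

namespace SphereApprox

/-! ### The sphere, its volume measure and spherical harmonics -/

/-- The unit sphere `S^{n-1}` in `ℝⁿ`. -/
abbrev Sph (n : ℕ) : Type := Metric.sphere (0 : EuclideanSpace ℝ (Fin n)) 1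

/-- The (unnormalised) volume measure `μ` on `S^{n-1}`. -/
def sphMeasure (n : ℕ) : Measure (Sph n) :=
  (volume : Measure (EuclideanSpace ℝ (Fin n))).toSphere

/-- Restriction of a polynomial in `n` variables to the sphere. -/
def restrict (n : ℕ) : MvPolynomial (Fin n) ℝ →ₐ[ℝ] C(Sph n, ℝ) :=
  MvPolynomial.aeval fun i => (⟨fun x => x.1 i, by fun_prop⟩ : C(Sph n, ℝ))

theorem restrict_apply (n : ℕ) (p : MvPolynomial (Fin n) ℝ) (x : Sph n) :
    restrict n p x = MvPolynomial.eval (fun i => x.1 i) p := by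
  induction p using MvPolynomial.induction_on with
  | C a => simp [restrict]
  | add p q hp hq => simp [hp, hq]
  | mul_X p i hp =>
    rw [map_mul, ContinuousMap.mul_apply, hp, map_mul]
    simp [restrict]

/-- The Laplacian `∑ᵢ ∂²/∂xᵢ²` on polynomials. -/
def laplacian (n : ℕ) : MvPolynomial (Fin n) ℝ →ₗ[ℝ] MvPolynomial (Fin n) ℝ :=
  ∑ i : Fin n, ((MvPolynomial.pderiv i).toLinearMap ∘ₗ (MvPolynomial.pderiv i).toLinearMap)

/-- `H_d`: restrictions to the sphere of the homogeneous harmonic polynomials of degree `d`. -/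
def sphericalHarmonics (n d : ℕ) : Submodule ℝ C(Sph n, ℝ) :=
  (MvPolynomial.homogeneousSubmodule (Fin n) ℝ d ⊓ LinearMap.ker (laplacian n)).map
    (restrict n).toLinearMap

/-- `dim H_d`. -/
def dimHarm (n d : ℕ) : ℕ := Module.finrank ℝ (sphericalHarmonics n d)

instance instFiniteDimensionalHarm (n d : ℕ) :
    FiniteDimensional ℝ (sphericalHarmonics n d) := by
  have h1 : MvPolynomial.homogeneousSubmodule (Fin n) ℝ d ≤
      MvPolynomial.restrictTotalDegree (Fin n) ℝ d := by
    intro p hp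
    rw [MvPolynomial.mem_restrictTotalDegree]
    exact MvPolynomial.IsHomogeneous.totalDegree_le hp
  have h2 : FiniteDimensional ℝ (MvPolynomial.restrictTotalDegree (Fin n) ℝ d) := by
    infer_instance
  have h3 : FiniteDimensional ℝ
      (MvPolynomial.homogeneousSubmodule (Fin n) ℝ d ⊓ LinearMap.ker (laplacian n) :
        Submodule ℝ (MvPolynomial (Fin n) ℝ)) :=
    Submodule.finiteDimensional_of_le (inf_le_left.trans h1)
  unfold sphericalHarmonics
  infer_instance

instance instFiniteSphMeasure (n : ℕ) : IsFiniteMeasure (sphMeasure n) := by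
  unfold sphMeasure; infer_instance

instance instOpenPosSphMeasure (n : ℕ) : (sphMeasure n).IsOpenPosMeasure := by
  unfold sphMeasure; infer_instance

/-- The orthogonal projection of a continuous `f` to `H_d` with respect to the inner product
`∫ g h dμ` of `L²(S^{n-1}, μ)` exists and is unique. -/
theorem existsUnique_harmonicComponent (n d : ℕ) (f : C(Sph n, ℝ)) :
    ∃! g : C(Sph n, ℝ), g ∈ sphericalHarmonics n d ∧
      ∀ h ∈ sphericalHarmonics n d, ∫ x, (f x - g x) * h x ∂(sphMeasure n) = 0 := by
  let L := (ContinuousMap.toLp (E := ℝ) 2 (sphMeasure n) ℝ).toLinearMap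
  let K := (sphericalHarmonics n d).map L
  have key : ∀ a b : C(Sph n, ℝ), inner ℝ (L a) (L b) = ∫ x, a x * b x ∂(sphMeasure n) := by
    intro a b
    have := ContinuousMap.inner_toLp (𝕜 := ℝ) (sphMeasure n) a b
    simpa [L, mul_comm] using this
  have hinj : Function.Injective L := ContinuousMap.toLp_injective (sphMeasure n)
  obtain ⟨g, hg, hgL⟩ := (Submodule.mem_map).1 (K.starProjection_apply_mem (L f))
  refine ⟨g, ⟨hg, fun h hh => ?_⟩, ?_⟩
  · have := Submodule.starProjection_inner_eq_zero (K := K) (L f) (L h)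
      (Submodule.mem_map_of_mem hh)
    rw [← hgL, ← map_sub, key] at this
    simpa using this
  · rintro g' ⟨hg', ho⟩
    apply hinj
    rw [hgL]
    refine (Submodule.eq_starProjection_of_mem_of_inner_eq_zero
      (Submodule.mem_map_of_mem hg') ?_).symm
    intro w hw
    obtain ⟨h, hh, rfl⟩ := (Submodule.mem_map).1 hw
    rw [← map_sub, key]
    simpa using ho h hh

/-- The `d`-th harmonic component `f_d` of `f`: the `H_d`-part of `f` in the orthogonal
decomposition of `L²(S^{n-1}, μ)` into the spaces `H_j`. -/
def harmonicComponent (n d : ℕ) (f : C(Sph n, ℝ)) : C(Sph n, ℝ) :=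
  (existsUnique_harmonicComponent n d f).choose

/-- `κ` is a Lipschitz constant of `f` for the geodesic distance `arccos ⟨x, y⟩` of the sphere. -/
def IsGeodesicLipschitz {n : ℕ} (κ : ℝ) (f : C(Sph n, ℝ)) : Prop :=
  ∀ x y : Sph n, |f x - f y| ≤ κ * InnerProductGeometry.angle x.1 y.1

/-! ### Zonal polynomials -/

/-- Gegenbauer polynomials `C_j^{(α)}`. -/
def gegenbauer (α : ℝ) : ℕ → Polynomial ℝ
  | 0 => 1
  | 1 => Polynomial.C (2 * α) * Polynomial.X
  | j + 2 =>
    Polynomial.C (1 / ((j : ℝ) + 2)) *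
      (Polynomial.C (2 * ((j : ℝ) + 2 + α - 1)) * Polynomial.X * gegenbauer α (j + 1)
        - Polynomial.C ((j : ℝ) + 2 + 2 * α - 2) * gegenbauer α j)

/-- The quotient `C_d^{(α)}(t) / C_d^{(α)}(1)` with `α = (n-2)/2`. For `n = 2` it is `0/0` when
`d ≥ 1`, and is read as its limit for `α → 0`, the Chebyshev polynomial `T_d`. -/
def gegenbauerQuot (n d : ℕ) : Polynomial ℝ :=
  if n = 2 then Polynomial.Chebyshev.T ℝ d
  else Polynomial.C (1 / (gegenbauer (((n : ℝ) - 2) / 2) d).eval 1) *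
    gegenbauer (((n : ℝ) - 2) / 2) d

/-- The zonal polynomial
`Z_d(t) = dim(H_d) / (μ(S^{n-1}) C_d^{(α)}(1)) * C_d^{(α)}(t)`, `α = (n-2)/2`. -/
def zonal (n d : ℕ) : Polynomial ℝ :=
  Polynomial.C ((dimHarm n d : ℝ) / (sphMeasure n).real Set.univ) * gegenbauerQuot n d

/-! ### Quadrature rules and the approximation of the harmonic component -/

/-- A quadrature rule `(X, W_X)` on the sphere: finitely many nodes with positive weights
(the weight function matters only at the nodes). -/
structure QuadratureRule (n : ℕ) where
  nodes : Finset (Sph n)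
  weight : Sph n → ℝ
  weight_pos : ∀ z ∈ nodes, 0 < weight z

/-- The rule integrates every polynomial of degree at most `D` exactly. -/
def QuadratureRule.IsExact {n : ℕ} (Q : QuadratureRule n) (D : ℕ) : Prop :=
  ∀ p : MvPolynomial (Fin n) ℝ, p.totalDegree ≤ D →
    ∑ z ∈ Q.nodes, Q.weight z * restrict n p z = ∫ x, restrict n p x ∂(sphMeasure n)

/-- The linear form `⟨x, z⟩` in the variables `x`. -/
def linForm {n : ℕ} (z : Sph n) : MvPolynomial (Fin n) ℝ :=
  ∑ j : Fin n, MvPolynomial.C (z.1 j) * MvPolynomial.X j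

/-- The polynomial `∑_{z ∈ X} W_X(z) f(z) Z_d(⟨x, z⟩)` in the variables `x`. -/
def harmonicApprox {n : ℕ} (Q : QuadratureRule n) (d : ℕ) (f : C(Sph n, ℝ)) :
    MvPolynomial (Fin n) ℝ :=
  ∑ z ∈ Q.nodes, MvPolynomial.C (Q.weight z * f z) * Polynomial.aeval (linForm z) (zonal n d)

/-! ### Programs over the real numbers, with black-box access to `f`

The machine has registers for natural numbers (used for counting and as addresses) and, for each
`A : ℕ`, an infinite array of real numbers. A program consists of finitely many instructions. It is
uniform: the only data it can contain are names of registers and arrays and fixed natural numbers,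
and the only real numbers it can start from are natural numbers and `π`. On natural numbers there is
only addition and subtraction; on real numbers there are exact field operations and square roots
(with the conventions `x / 0 = 0`, and `√x = 0` for `x < 0`). All loops are counted loops. -/

/-- A real array cell: the name of an array and the register which holds the index. -/
structure Cell where
  array : ℕ
  index : ℕ

/-- Field operations. -/
inductive FieldOp
  | add | sub | mul | div

def FieldOp.apply : FieldOp → ℝ → ℝ → ℝ
  | .add, x, y => x + y
  | .sub, x, y => x - y
  | .mul, x, y => x * y
  | .div, x, y => x / y

/-- Programs. -/
inductive Prog
  /-- register `r` becomes `c` -/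
  | natConst (r c : ℕ)
  /-- register `r` becomes the sum of registers `a` and `b` -/
  | natAdd (r a b : ℕ)
  /-- register `r` becomes the truncated difference of registers `a` and `b` -/
  | natSub (r a b : ℕ)
  /-- the cell becomes the value of register `r`, as a real number -/
  | realOfNat (t : Cell) (r : ℕ)
  /-- the cell becomes `π` -/
  | realPi (t : Cell)
  /-- the cell becomes `u` op `v` -/
  | realOp (o : FieldOp) (t u v : Cell)
  /-- the cell becomes `√u` -/
  | realSqrt (t u : Cell)
  /-- the cell becomes the value of the black box at the point whose `n` coordinates are
  stored from the cell `u` on -/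
  | query (t u : Cell)
  /-- sequential composition -/
  | seq (P R : Prog)
  /-- `P` if register `a` is at most register `b`, else `R` -/
  | ifLE (a b : ℕ) (P R : Prog)
  /-- repeat `P` as many times as register `r` says on entry -/
  | loop (r : ℕ) (P : Prog)

/-- A memory state: the registers, the arrays, and the number of steps made so far. -/
structure State where
  reg : ℕ → ℕ
  arr : ℕ → ℕ → ℝ
  time : ℕ

namespace State

/-- The address of a cell. -/
def addr (s : State) (c : Cell) : ℕ := s.reg c.index

/-- The content of a cell. -/
def get (s : State) (c : Cell) : ℝ := s.arr c.array (s.addr c)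

/-- One step passes. -/
def tick (s : State) : State := { s with time := s.time + 1 }

def setReg (s : State) (r v : ℕ) : State := { s with reg := Function.update s.reg r v }

def setCell (s : State) (c : Cell) (v : ℝ) : State :=
  { s with arr := Function.update s.arr c.array (Function.update (s.arr c.array) (s.addr c) v) }

/-- The point of `ℝⁿ` whose coordinates are stored from the cell `c` on. -/
def point (s : State) (n : ℕ) (c : Cell) : EuclideanSpace ℝ (Fin n) :=
  WithLp.toLp 2 fun j : Fin n => s.arr c.array (s.addr c + j)

end State

open Classical in
/-- The answer of the black box for `f` at a point of `ℝⁿ` (`0` off the sphere). -/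
def blackBox {n : ℕ} (f : C(Sph n, ℝ)) (v : EuclideanSpace ℝ (Fin n)) : ℝ :=
  if h : v ∈ Metric.sphere (0 : EuclideanSpace ℝ (Fin n)) 1 then f ⟨v, h⟩ else 0

/-- Execution of a program. Each elementary instruction, in particular each black-box evaluation,
takes one step; so does each test and the set-up of each loop. -/
def Prog.exec {n : ℕ} (f : C(Sph n, ℝ)) : Prog → State → State
  | .natConst r c, s => s.tick.setReg r c
  | .natAdd r a b, s => s.tick.setReg r (s.reg a + s.reg b)
  | .natSub r a b, s => s.tick.setReg r (s.reg a - s.reg b)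
  | .realOfNat t r, s => s.tick.setCell t (s.reg r : ℝ)
  | .realPi t, s => s.tick.setCell t Real.pi
  | .realOp o t u v, s => s.tick.setCell t (o.apply (s.get u) (s.get v))
  | .realSqrt t u, s => s.tick.setCell t (Real.sqrt (s.get u))
  | .query t u, s => s.tick.setCell t (blackBox f (s.point n u))
  | .seq P R, s => R.exec f (P.exec f s)
  | .ifLE a b P R, s => if s.reg a ≤ s.reg b then P.exec f s.tick else R.exec f s.tick
  | .loop r P, s => (P.exec f)^[s.reg r] s.tick

/-- The initial state: register `0` holds `d`, register `1` holds `m`, all else is zero. -/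
def initState (d m : ℕ) : State where
  reg := fun r => if r = 0 then d else if r = 1 then m else 0
  arr := fun _ _ => 0
  time := 0

/-- The final state for the inputs `f`, `d`, `m`. -/
def Prog.final {n : ℕ} (P : Prog) (f : C(Sph n, ℝ)) (d m : ℕ) : State :=
  P.exec f (initState d m)

/-- The running time for the inputs `f`, `d`, `m`. -/
def Prog.runTime {n : ℕ} (P : Prog) (f : C(Sph n, ℝ)) (d m : ℕ) : ℕ := (P.final f d m).time

/-- The state holds the rule `Q` and the polynomial `∑_{z ∈ X} W_X(z) f(z) Z_d(⟨x, z⟩)`: register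
`0` holds the number of nodes; array `0` lists the coordinates of the nodes, array `1` the weights
`W_X(z)`, array `2` the numbers `W_X(z) f(z)`, and array `3` the coefficients of `Z_d`. -/
def State.Holds {n : ℕ} (s : State) (Q : QuadratureRule n) (d : ℕ) (f : C(Sph n, ℝ)) : Prop :=
  ∃ z : Fin (s.reg 0) ≃ Q.nodes,
    (∀ (i : Fin (s.reg 0)) (j : Fin n), s.arr 0 (n * i + j) = (z i).1.1 j) ∧
    (∀ i : Fin (s.reg 0), s.arr 1 i = Q.weight (z i).1) ∧
    (∀ i : Fin (s.reg 0), s.arr 2 i = Q.weight (z i).1 * f (z i).1) ∧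
    (∀ k : ℕ, k ≤ d → s.arr 3 k = (zonal n d).coeff k)

end SphereApprox

end

open SphereApprox

/-! The kernel Z_d(⟨x, z⟩) reproduces H_d, so f_d(x) is the integral of f(z) Z_d(⟨x, z⟩), and the
algorithm replaces this integral by a quadrature sum. Let p be a polynomial of degree at most m with
|f - p| ≤ δ. The product of p and the kernel has degree at most d + m, hence is integrated exactly,
and only f - p contributes an error, once in the sum and once in the integral. Cauchy–Schwarz bounds
each contribution by δ √dim H_d: the squared kernel has degree at most 2d, so the discrete L² norm
of the kernel equals the continuous one. The total error is at most 2 δ √dim H_d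
(`abs_harmonicApprox_sub_le`).

A Jackson theorem, `exists_polynomial_approx`, gives δ = 6 (n + 1) κ / m. With P_j the Gegenbauer
polynomials normalised by P_j(1) = 1 and D_j = dim H_j / μ(S), put F = ∑_{j<k} (k - j) D_j P_j and
average f against F² / ∫ F². Summing the Christoffel–Darboux formula gives (1 - t) F = ∑ c_i (P_i -
P_{i+1}) with 0 ≤ c_i ≤ D_i. Orthogonality then yields ∫ (1 - t) F² = ∑ c_i ≤ ∑ D_j, whereas ∫ F² ≥
k² / (n + 1)² · ∑ D_j because D_j grows only polynomially. So the mean square of the angle under the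
kernel is O(1/k²).

The harmonic analysis rests on the explicit moments of the sphere. The functional equation of Γ
turns into an integration by parts rule (`sphIntegral_pderiv`); it yields the orthogonality of a
harmonic polynomial to all lower degrees and the value of its integral against ⟨·, z⟩^d, hence the
reproducing property. The trace of the kernel is the dimension (`dimHarm_eq`).

The rule is a product rule in the coordinates (cos θ, y sin θ), with y in the sphere of one
dimension less. The angular measure sin^b θ dθ is discretised at the N Chebyshev angles. An even
power of the sine is a polynomial in cos θ; a remaining single sine is replaced by a truncated
Fourier series, which has the right integrals against polynomials of low degree and is still
positive (`integral_mul_sinePoly`, `eval_sinePoly_cos_pos`). Since N is a power of two, the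
half-angle formula gives cos(π / 2N) by square roots, and three-term recursions give everything
else.

Correctness of the program is proved by loop invariants (`exec_loop_invariant`). For the time, the
program is fixed for each n and each of its loops runs at most `loopBound n (d + m)` times, which is
polynomial in d + m. -/

noncomputable section
namespace SphereApprox

/-! ### Moments of the sphere -/

/-- The integral of the monomial with exponents `α` over the sphere in `ℝⁿ`. -/
def moment (n : ℕ) (α : Fin n → ℕ) : ℝ :=
  if ∀ i, Even (α i) then
    2 * (∏ i, Real.Gamma (((α i : ℝ) + 1) / 2)) / Real.Gamma (((n : ℝ) + ∑ i, (α i : ℝ)) / 2)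
  else 0

theorem integral_Ioi_pow_mul_exp_neg_sq (a : ℕ) :
    ∫ t in Set.Ioi (0 : ℝ), t ^ a * Real.exp (-t ^ 2) = 1 / 2 * Real.Gamma (((a : ℝ) + 1) / 2) := by
  have := integral_rpow_mul_exp_neg_rpow (p := 2) (q := a) (by norm_num)
    (by have : (0 : ℝ) ≤ a := a.cast_nonneg
        linarith)
  simpa using this

theorem integral_pow_mul_exp_neg_sq (a : ℕ) :
    ∫ t : ℝ, t ^ a * Real.exp (-t ^ 2) =
      if Even a then Real.Gamma (((a : ℝ) + 1) / 2) else 0 := by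
  split_ifs with h
  · have h1 := integral_comp_abs (f := fun t : ℝ => t ^ a * Real.exp (-t ^ 2))
    simp only [h.pow_abs, sq_abs] at h1
    rw [h1, integral_Ioi_pow_mul_exp_neg_sq]
    ring
  · have ho := Nat.not_even_iff_odd.1 h
    have h1 := integral_neg_eq_self (fun t : ℝ => t ^ a * Real.exp (-t ^ 2)) volume
    simp only [ho.neg_pow, even_two.neg_pow, neg_mul, integral_neg] at h1
    linarith

theorem integral_gaussian_monomial (n : ℕ) (α : Fin n → ℕ) :
    ∫ x : EuclideanSpace ℝ (Fin n), (∏ i, x i ^ α i) * Real.exp (-‖x‖ ^ 2) =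
      if ∀ i, Even (α i) then ∏ i, Real.Gamma (((α i : ℝ) + 1) / 2) else 0 := by
  have h1 := (EuclideanSpace.volume_preserving_symm_measurableEquiv_toLp (Fin n)).integral_comp'
    (fun y : Fin n → ℝ => ∏ i, (y i ^ α i * Real.exp (-y i ^ 2)))
  rw [integral_fintype_prod_volume_eq_prod (fun i (t : ℝ) => t ^ α i * Real.exp (-t ^ 2))] at h1
  simp only [integral_pow_mul_exp_neg_sq] at h1
  have h2 : ∀ x : EuclideanSpace ℝ (Fin n), (∏ i, x i ^ α i) * Real.exp (-‖x‖ ^ 2) =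
      ∏ i, (x i ^ α i * Real.exp (-x i ^ 2)) := by
    intro x
    rw [Finset.prod_mul_distrib, ← Real.exp_sum, EuclideanSpace.real_norm_sq_eq,
      Finset.sum_neg_distrib]
  simp only [h2]
  refine h1.trans ?_
  split_ifs with h
  · exact Finset.prod_congr rfl fun i _ => if_pos (h i)
  · push Not at h
    obtain ⟨i, hi⟩ := h
    exact Finset.prod_eq_zero (Finset.mem_univ i) (if_neg hi)

/-- Polar coordinates split the Gaussian integral into the spherical moment and the integral of
r^(n-1+|α|) exp(-r²). In Cartesian coordinates the same integral is a product of one-dimensional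
ones, so comparing the two gives the moment. -/
theorem integral_gaussian_eq_integral_sphere {n : ℕ} (hn : 0 < n) (α : Fin n → ℕ) :
    ∫ x : EuclideanSpace ℝ (Fin n), (∏ i, x i ^ α i) * Real.exp (-‖x‖ ^ 2) =
      (∫ x : Sph n, ∏ i, x.1 i ^ α i ∂(sphMeasure n)) *
        (1 / 2 * Real.Gamma (((n : ℝ) + ∑ i, (α i : ℝ)) / 2)) := by
  have : NeZero n := ⟨hn.ne'⟩
  let μ : Measure (EuclideanSpace ℝ (Fin n)) := volume
  have hdim : Module.finrank ℝ (EuclideanSpace ℝ (Fin n)) = n := by simp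
  calc ∫ x : EuclideanSpace ℝ (Fin n), (∏ i, x i ^ α i) * Real.exp (-‖x‖ ^ 2)
      = ∫ x : ({(0)}ᶜ : Set (EuclideanSpace ℝ (Fin n))),
          (∏ i, x.1 i ^ α i) * Real.exp (-‖x.1‖ ^ 2) ∂(μ.comap (↑)) := by
        rw [integral_subtype_comap (measurableSet_singleton _).compl
          (fun x : EuclideanSpace ℝ (Fin n) => (∏ i, x i ^ α i) * Real.exp (-‖x‖ ^ 2)),
          restrict_compl_singleton]
    _ = ∫ x, (∏ i, x.1.1 i ^ α i) * (x.2.1 ^ (∑ i, α i) * Real.exp (-x.2.1 ^ 2))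
          ∂μ.toSphere.prod
            (.volumeIoiPow (Module.finrank ℝ (EuclideanSpace ℝ (Fin n)) - 1)) := by
        rw [← μ.measurePreserving_homeomorphUnitSphereProd.integral_comp
          (Homeomorph.measurableEmbedding _)]
        refine integral_congr_ae (Filter.Eventually.of_forall fun x => ?_)
        have hx : ‖x.1‖ ≠ 0 := norm_ne_zero_iff.2 x.2
        have h0 : ∀ i, x.1 i ^ α i = (‖x.1‖⁻¹ * x.1 i) ^ α i * ‖x.1‖ ^ α i := by
          intro i
          rw [← mul_pow]
          congr 1
          field_simp
        simp only [homeomorphUnitSphereProd_apply_snd_coe, homeomorphUnitSphereProd_apply_fst_coe,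
          PiLp.smul_apply, smul_eq_mul]
        rw [← Finset.prod_pow_eq_pow_sum, ← mul_assoc, ← Finset.prod_mul_distrib]
        simp only [← h0]
    _ = (∫ x : Sph n, ∏ i, x.1 i ^ α i ∂(sphMeasure n)) *
          ∫ r : Set.Ioi (0 : ℝ), (r.1 ^ (∑ i, α i) * Real.exp (-r.1 ^ 2))
            ∂(.volumeIoiPow (Module.finrank ℝ (EuclideanSpace ℝ (Fin n)) - 1)) :=
        integral_prod_mul (fun x : Sph n => ∏ i, x.1 i ^ α i)
          (fun r : Set.Ioi (0 : ℝ) => r.1 ^ (∑ i, α i) * Real.exp (-r.1 ^ 2))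
    _ = _ := by
        congr 1
        rw [hdim]
        simp only [Measure.volumeIoiPow, ENNReal.ofReal]
        rw [integral_withDensity_eq_integral_smul (by fun_prop)]
        have h3 : ∀ r : Set.Ioi (0 : ℝ), (r.1 ^ (n - 1)).toNNReal •
            (r.1 ^ (∑ i, α i) * Real.exp (-r.1 ^ 2)) =
            r.1 ^ (n - 1 + ∑ i, α i) * Real.exp (-r.1 ^ 2) := by
          intro r
          rw [NNReal.smul_def, Real.coe_toNNReal _ (pow_nonneg (le_of_lt r.2) _), smul_eq_mul,
            pow_add, mul_assoc]
        simp only [h3]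
        rw [integral_subtype_comap measurableSet_Ioi
          (fun r : ℝ => r ^ (n - 1 + ∑ i, α i) * Real.exp (-r ^ 2)),
          integral_Ioi_pow_mul_exp_neg_sq]
        congr 3
        push_cast [Nat.cast_sub hn]
        ring

theorem integral_monomial_sphere {n : ℕ} (hn : 0 < n) (α : Fin n → ℕ) :
    ∫ x : Sph n, ∏ i, x.1 i ^ α i ∂(sphMeasure n) = moment n α := by
  have h := (integral_gaussian_eq_integral_sphere hn α).symm.trans
    (integral_gaussian_monomial n α)
  have hG : 0 < Real.Gamma (((n : ℝ) + ∑ i, (α i : ℝ)) / 2) := by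
    apply Real.Gamma_pos_of_pos
    have : (0 : ℝ) < n := by exact_mod_cast hn
    positivity
  rw [moment]
  split_ifs at h ⊢ with h0
  · rw [eq_div_iff hG.ne', ← h]; ring
  · have := hG.ne'
    simpa [this] using h

theorem restrict_monomial (n : ℕ) (α : Fin n →₀ ℕ) (c : ℝ) (x : Sph n) :
    restrict n (MvPolynomial.monomial α c) x = c * ∏ i, x.1 i ^ α i := by
  rw [restrict_apply, MvPolynomial.eval_monomial, Finsupp.prod_fintype _ _ (by simp)]

theorem integral_restrict_monomial {n : ℕ} (hn : 0 < n) (α : Fin n →₀ ℕ) (c : ℝ) :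
    ∫ x, restrict n (MvPolynomial.monomial α c) x ∂(sphMeasure n) = c * moment n α := by
  simp only [restrict_monomial, integral_const_mul, integral_monomial_sphere hn]

theorem integrable_sphere {n : ℕ} (f : C(Sph n, ℝ)) : Integrable f (sphMeasure n) :=
  f.continuous.integrable_of_hasCompactSupport (HasCompactSupport.of_compactSpace _)

/-- Integration over the sphere as a linear form on polynomials. -/
def sphIntegral (n : ℕ) : MvPolynomial (Fin n) ℝ →ₗ[ℝ] ℝ where
  toFun p := ∫ x, restrict n p x ∂(sphMeasure n)
  map_add' p q := by
    simp only [map_add, ContinuousMap.add_apply]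
    exact integral_add (integrable_sphere _) (integrable_sphere _)
  map_smul' c p := by
    simp only [map_smul, ContinuousMap.smul_apply, smul_eq_mul, RingHom.id_apply]
    exact integral_const_mul _ _

theorem sphIntegral_apply (n : ℕ) (p : MvPolynomial (Fin n) ℝ) :
    sphIntegral n p = ∫ x, restrict n p x ∂(sphMeasure n) := rfl

theorem sphIntegral_monomial {n : ℕ} (hn : 0 < n) (α : Fin n →₀ ℕ) (c : ℝ) :
    sphIntegral n (MvPolynomial.monomial α c) = c * moment n α :=
  integral_restrict_monomial hn α c

/-- The functional equation of Γ is used once in the i-th factor of the numerator and once in the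
denominator. Apart from parity, this is all that integration by parts needs to know about the
moments. -/
theorem moment_update_add_two {n : ℕ} (hn : 0 < n) (α : Fin n → ℕ) (i : Fin n) :
    ((n : ℝ) + ∑ j, (α j : ℝ)) * moment n (Function.update α i (α i + 2)) =
      (α i + 1) * moment n α := by
  have hpar : (∀ j, Even (Function.update α i (α i + 2) j)) ↔ ∀ j, Even (α j) := by
    refine forall_congr' fun j => ?_
    by_cases hj : j = i
    · subst hj; simp [Nat.even_add]
    · simp [hj]
  have hs : ∑ j, ((Function.update α i (α i + 2) j : ℕ) : ℝ) = ∑ j, (α j : ℝ) + 2 := by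
    have : ∀ j, ((Function.update α i (α i + 2) j : ℕ) : ℝ) =
        α j + if j = i then 2 else 0 := by
      intro j
      by_cases hj : j = i
      · subst hj; simp
      · simp [hj]
    simp [this, Finset.sum_add_distrib]
  have hp : ∏ j, Real.Gamma ((((Function.update α i (α i + 2) j : ℕ) : ℝ) + 1) / 2) =
      ((α i : ℝ) + 1) / 2 * ∏ j, Real.Gamma (((α j : ℝ) + 1) / 2) := by
    rw [← Finset.mul_prod_erase _ _ (Finset.mem_univ i),
      ← Finset.mul_prod_erase _ (fun j => Real.Gamma (((α j : ℝ) + 1) / 2)) (Finset.mem_univ i),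
      ← mul_assoc]
    congr 1
    · rw [← Real.Gamma_add_one (by positivity)]
      simp only [Function.update_self]
      congr 1
      push_cast
      ring
    · refine Finset.prod_congr rfl fun j hj => ?_
      rw [Function.update_of_ne (Finset.ne_of_mem_erase hj)]
  have hpos : (0 : ℝ) < (n : ℝ) + ∑ j, (α j : ℝ) := by
    have : (0 : ℝ) < n := by exact_mod_cast hn
    positivity
  rw [moment, moment, if_congr hpar rfl rfl]
  split_ifs with h
  · rw [hs, hp, ← add_assoc, add_div _ (2 : ℝ), div_self (two_ne_zero' ℝ),
      Real.Gamma_add_one (by positivity)]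
    have := (Real.Gamma_pos_of_pos (half_pos hpos)).ne'
    field_simp
  · simp

/-- Integration by parts on the sphere. -/
theorem sphIntegral_pderiv {n k : ℕ} (hn : 0 < n) {p : MvPolynomial (Fin n) ℝ}
    (hp : p.IsHomogeneous k) (i : Fin n) :
    sphIntegral n (MvPolynomial.pderiv i p) =
      ((n : ℝ) + k - 1) * sphIntegral n (MvPolynomial.X i * p) := by
  rw [p.as_sum, map_sum, map_sum, Finset.mul_sum, map_sum, Finset.mul_sum]
  refine Finset.sum_congr rfl fun α hα => ?_
  have hk : (∑ j, (α j : ℝ)) = k := by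
    have := hp (MvPolynomial.mem_support_iff.1 hα)
    rw [← this, Finsupp.weight_apply, Finsupp.sum_fintype _ _ (by simp)]
    simp
  rw [MvPolynomial.pderiv_monomial, sphIntegral_monomial hn, mul_comm (MvPolynomial.X i),
    MvPolynomial.X, MvPolynomial.monomial_mul, sphIntegral_monomial hn, mul_one]
  -- If x_i does not occur, the derivative vanishes and x_i times the monomial is odd in x_i.
  -- Otherwise one factor x_i is removed: with the exponent β that remains, the two sides involve
  -- the moments of β and of β with two more factors x_i.
  rcases Nat.eq_zero_or_pos (α i) with h0 | h0
  · have : moment n ⇑(α + Finsupp.single i 1 : Fin n →₀ ℕ) = 0 := by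
      rw [moment, if_neg]
      intro h
      have := h i
      simp [h0] at this
    rw [this, h0]
    simp
  · set β : Fin n →₀ ℕ := α - Finsupp.single i 1 with hβ
    have hαβ : α = β + Finsupp.single i 1 := by
      rw [hβ, tsub_add_cancel_of_le]
      simpa [Finsupp.single_le_iff] using Nat.one_le_of_lt h0
    have e1 : ⇑(α + Finsupp.single i 1 : Fin n →₀ ℕ) = Function.update β i (β i + 2) := by
      ext j
      by_cases hj : j = i
      · subst hj; simp [hαβ]
      · simp [hαβ, hj]
    have e2 : (α i : ℝ) = β i + 1 := by rw [hαβ]; simp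
    have e3 : (k : ℝ) = ∑ j, (β j : ℝ) + 1 := by
      rw [← hk, hαβ]
      simp [Finset.sum_add_distrib, Finsupp.single_apply]
    have := moment_update_add_two hn (⇑β) i
    rw [e1, e2, e3]
    linear_combination -(MvPolynomial.coeff α p) * this

theorem sphMeasure_pos {n : ℕ} (hn : 0 < n) : 0 < (sphMeasure n).real Set.univ := by
  have h := integral_monomial_sphere hn (fun _ => 0)
  simp only [pow_zero, Finset.prod_const_one, integral_const, smul_eq_mul, mul_one] at h
  rw [h, moment, if_pos (by simp)]
  have hn' : (0 : ℝ) < n := by exact_mod_cast hn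
  have : 0 < Real.Gamma (1 / 2 : ℝ) := Real.Gamma_pos_of_pos (by norm_num)
  have : 0 < Real.Gamma ((n : ℝ) / 2) := Real.Gamma_pos_of_pos (by positivity)
  simp only [CharP.cast_eq_zero, zero_add, Finset.prod_const, Finset.sum_const_zero, add_zero]
  positivity


/-! ### Harmonic polynomials and integration by parts -/

-- The commutator of two derivations is a derivation, so it suffices that it vanishes on the
-- variables.
open MvPolynomial in
theorem pderiv_comm {n : ℕ} (i j : Fin n) (p : MvPolynomial (Fin n) ℝ) :
    pderiv i (pderiv j p) = pderiv j (pderiv i p) := by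
  let D : Fin n → Derivation ℝ (MvPolynomial (Fin n) ℝ) (MvPolynomial (Fin n) ℝ) :=
    fun k => pderiv k
  have h : ⁅D i, D j⁆ = 0 := by
    apply MvPolynomial.derivation_ext
    intro k
    classical
    simp only [D, Derivation.commutator_apply, pderiv_X]
    have h0 : ∀ a b : Fin n, pderiv a ((Pi.single b 1 : Fin n → MvPolynomial (Fin n) ℝ) k) = 0 := by
      intro a b
      rw [Pi.single_apply]
      split_ifs <;> simp
    rw [h0, h0, sub_self, Derivation.zero_apply]
  have := congrArg (fun D => D p) h
  simpa [D, Derivation.commutator_apply, sub_eq_zero] using this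

theorem laplacian_apply (n : ℕ) (p : MvPolynomial (Fin n) ℝ) :
    laplacian n p = ∑ i, MvPolynomial.pderiv i (MvPolynomial.pderiv i p) := by
  simp [laplacian]

theorem laplacian_pderiv {n : ℕ} (i : Fin n) (p : MvPolynomial (Fin n) ℝ) :
    laplacian n (MvPolynomial.pderiv i p) = MvPolynomial.pderiv i (laplacian n p) := by
  simp only [laplacian_apply, map_sum]
  exact Finset.sum_congr rfl fun j _ => by rw [pderiv_comm j i, pderiv_comm j i]

theorem laplacian_mul {n : ℕ} (p q : MvPolynomial (Fin n) ℝ) :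
    laplacian n (p * q) = laplacian n p * q + p * laplacian n q +
      2 * ∑ i, MvPolynomial.pderiv i p * MvPolynomial.pderiv i q := by
  simp only [laplacian_apply, Finset.sum_mul, Finset.mul_sum, ← Finset.sum_add_distrib]
  refine Finset.sum_congr rfl fun i _ => ?_
  simp only [MvPolynomial.pderiv_mul, map_add]
  ring

/-- Integrate by parts with the products of ∂_i h and q and sum over i. The second derivatives of h
add up to its Laplacian, which is zero, and Euler's identity collapses ∑ x_i ∂_i h to (d + 1) h. -/
theorem sphIntegral_harmonic_mul {n d l : ℕ} (hn : 0 < n) {h q : MvPolynomial (Fin n) ℝ}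
    (hh : h.IsHomogeneous (d + 1)) (hq : q.IsHomogeneous l) (hharm : laplacian n h = 0) :
    ((d : ℝ) + 1) * ((n : ℝ) + d + l - 1) * sphIntegral n (h * q) =
      ∑ i, sphIntegral n (MvPolynomial.pderiv i h * MvPolynomial.pderiv i q) := by
  have h1 : ∀ i : Fin n, sphIntegral n (MvPolynomial.pderiv i (MvPolynomial.pderiv i h) * q) +
      sphIntegral n (MvPolynomial.pderiv i h * MvPolynomial.pderiv i q) =
      ((n : ℝ) + d + l - 1) * sphIntegral n (MvPolynomial.X i * MvPolynomial.pderiv i h * q) := by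
    intro i
    have := sphIntegral_pderiv hn ((hh.pderiv (i := i)).mul hq) i
    rw [MvPolynomial.pderiv_mul, map_add] at this
    rw [this, mul_assoc (MvPolynomial.X i)]
    congr 1
    push_cast [Nat.add_sub_cancel]
    ring
  have h2 : ∑ i, sphIntegral n (MvPolynomial.X i * MvPolynomial.pderiv i h * q) =
      ((d : ℝ) + 1) * sphIntegral n (h * q) := by
    rw [← map_sum, ← Finset.sum_mul, hh.sum_X_mul_pderiv, smul_mul_assoc, map_nsmul, nsmul_eq_mul]
    push_cast
    rfl
  have h3 : ∑ i, sphIntegral n (MvPolynomial.pderiv i (MvPolynomial.pderiv i h) * q) = 0 := by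
    rw [← map_sum, ← Finset.sum_mul, ← laplacian_apply, hharm, zero_mul, map_zero]
  have h4 := Finset.sum_congr rfl fun i (_ : i ∈ Finset.univ) => h1 i
  rw [Finset.sum_add_distrib, h3, zero_add, ← Finset.mul_sum, h2] at h4
  rw [h4]
  ring

/-- The preceding identity lowers both degrees by one, and partial derivatives of harmonic
polynomials are harmonic. The descent ends at a constant q, whose derivatives vanish while the
prefactor on the left does not. -/
theorem sphIntegral_harmonic_mul_eq_zero {n : ℕ} (hn : 2 ≤ n) {l : ℕ} :
    ∀ {d : ℕ} {h q : MvPolynomial (Fin n) ℝ}, l < d → h.IsHomogeneous d → q.IsHomogeneous l →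
      laplacian n h = 0 → sphIntegral n (h * q) = 0 := by
  have hn' : (2 : ℝ) ≤ n := by exact_mod_cast hn
  induction l with
  | zero =>
    intro d h q hd hh hq hharm
    obtain ⟨d, rfl⟩ : ∃ e, d = e + 1 := ⟨d - 1, by omega⟩
    have h1 := sphIntegral_harmonic_mul (by omega) hh hq hharm
    rw [← MvPolynomial.totalDegree_zero_iff_isHomogeneous,
      MvPolynomial.totalDegree_eq_zero_iff_eq_C] at hq
    have h2 : ∀ i, MvPolynomial.pderiv i q = 0 := fun i => by rw [hq, MvPolynomial.pderiv_C]
    simp only [h2, mul_zero, map_zero, Finset.sum_const_zero] at h1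
    have hd0 : (0 : ℝ) ≤ d := d.cast_nonneg
    refine (mul_eq_zero.1 h1).resolve_left (mul_ne_zero (by positivity) ?_)
    push_cast
    linarith
  | succ l ih =>
    intro d h q hd hh hq hharm
    obtain ⟨d, rfl⟩ : ∃ e, d = e + 1 := ⟨d - 1, by omega⟩
    have h1 := sphIntegral_harmonic_mul (by omega) hh hq hharm
    rw [Finset.sum_eq_zero fun i _ => ih (d := d) (by omega) hh.pderiv hq.pderiv
      (by rw [laplacian_pderiv, hharm, map_zero])] at h1
    have hd0 : (0 : ℝ) ≤ d := d.cast_nonneg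
    have hl0 : (0 : ℝ) ≤ l := l.cast_nonneg
    refine (mul_eq_zero.1 h1).resolve_left (mul_ne_zero (by positivity) ?_)
    push_cast
    linarith

theorem isHomogeneous_linForm {n : ℕ} (z : Sph n) : (linForm z).IsHomogeneous 1 :=
  MvPolynomial.IsHomogeneous.sum _ _ _ fun _ _ => MvPolynomial.isHomogeneous_C_mul_X _ _

theorem pderiv_linForm {n : ℕ} (z : Sph n) (i : Fin n) :
    MvPolynomial.pderiv i (linForm z) = MvPolynomial.C (z.1 i) := by
  classical
  simp only [linForm, map_sum, MvPolynomial.pderiv_C_mul, MvPolynomial.pderiv_X, Pi.single_apply]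
  simp

/-- The factor in `∫ h(y) ⟨y, z⟩ ^ d dμ(y) = c h(z)` for harmonic `h` of degree `d`. -/
def powFactor (n : ℕ) : ℕ → ℝ
  | 0 => (sphMeasure n).real Set.univ
  | d + 1 => ((d : ℝ) + 1) / ((n : ℝ) + 2 * d) * powFactor n d

/-- The gradient of the linear form is the constant vector z, so one use of the identity leaves z ·
∇h against a lower power of the form. By induction this is z · ∇h evaluated at z, which Euler's
identity turns back into a multiple of h(z). -/
theorem sphIntegral_harmonic_mul_linForm_pow {n : ℕ} (hn : 2 ≤ n) (z : Sph n) {d : ℕ} :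
    ∀ {h : MvPolynomial (Fin n) ℝ}, h.IsHomogeneous d → laplacian n h = 0 →
      sphIntegral n (h * linForm z ^ d) = powFactor n d * restrict n h z := by
  induction d with
  | zero =>
    intro h hh _
    rw [← MvPolynomial.totalDegree_zero_iff_isHomogeneous,
      MvPolynomial.totalDegree_eq_zero_iff_eq_C] at hh
    rw [pow_zero, mul_one, hh, sphIntegral_apply]
    simp [powFactor]
  | succ d ih =>
    intro h hh hharm
    have hq : (linForm z ^ (d + 1)).IsHomogeneous (d + 1) := by
      simpa using (isHomogeneous_linForm z).pow (d + 1)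
    have h1 := sphIntegral_harmonic_mul (by omega) hh hq hharm
    have h2 : ∀ i, sphIntegral n
        (MvPolynomial.pderiv i h * MvPolynomial.pderiv i (linForm z ^ (d + 1))) =
        ((d : ℝ) + 1) * powFactor n d * (z.1 i * restrict n (MvPolynomial.pderiv i h) z) := by
      intro i
      have h3 : MvPolynomial.pderiv i h * MvPolynomial.pderiv i (linForm z ^ (d + 1)) =
          (((d : ℝ) + 1) * z.1 i) • (MvPolynomial.pderiv i h * linForm z ^ d) := by
        rw [MvPolynomial.pderiv_pow, pderiv_linForm, MvPolynomial.smul_eq_C_mul]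
        simp only [Nat.add_sub_cancel, map_mul, map_add, map_one, map_natCast]
        push_cast
        ring
      rw [h3, map_smul, ih hh.pderiv (by rw [laplacian_pderiv, hharm, map_zero]), smul_eq_mul]
      ring
    have h4 : ∑ i, z.1 i * restrict n (MvPolynomial.pderiv i h) z =
        ((d : ℝ) + 1) * restrict n h z := by
      have := congrArg (MvPolynomial.eval fun i => z.1 i) hh.sum_X_mul_pderiv
      simp only [map_sum, map_mul, MvPolynomial.eval_X, map_nsmul] at this
      simp only [restrict_apply, this, nsmul_eq_mul]
      push_cast
      rfl
    rw [Finset.sum_congr rfl fun i _ => h2 i, ← Finset.mul_sum, h4] at h1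
    have hn' : (2 : ℝ) ≤ n := by exact_mod_cast hn
    have hd0 : (0 : ℝ) ≤ d := d.cast_nonneg
    have hd1 : (d : ℝ) + 1 ≠ 0 := by positivity
    have hne : (n : ℝ) + 2 * d ≠ 0 := by positivity
    push_cast at h1
    rw [powFactor]
    field_simp
    apply mul_left_cancel₀ hd1
    linear_combination h1

/-! ### Zonal polynomials -/

/-- The Gegenbauer polynomials of the sphere in `ℝⁿ`, normalised to have the value `1` at `1`. -/
def legendre (n : ℕ) : ℕ → Polynomial ℝ
  | 0 => 1
  | 1 => Polynomial.X
  | j + 2 => Polynomial.C (1 / ((j : ℝ) + n - 1)) *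
      (Polynomial.C (2 * (j : ℝ) + n) * Polynomial.X * legendre n (j + 1) -
        Polynomial.C ((j : ℝ) + 1) * legendre n j)

theorem legendre_denom_pos {n : ℕ} (hn : 2 ≤ n) (j : ℕ) : (0 : ℝ) < (j : ℝ) + n - 1 := by
  have hn' : (2 : ℝ) ≤ n := by exact_mod_cast hn
  have hj : (0 : ℝ) ≤ j := j.cast_nonneg
  linarith

theorem legendre_rec {n : ℕ} (hn : 2 ≤ n) (j : ℕ) (t : ℝ) :
    ((j : ℝ) + n - 1) * (legendre n (j + 2)).eval t =
      (2 * (j : ℝ) + n) * t * (legendre n (j + 1)).eval t - ((j : ℝ) + 1) * (legendre n j).eval t := by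
  have := (legendre_denom_pos hn j).ne'
  rw [legendre]
  simp only [Polynomial.eval_mul, Polynomial.eval_sub, Polynomial.eval_C, Polynomial.eval_X]
  field_simp

theorem legendre_eval_one {n : ℕ} (hn : 2 ≤ n) (j : ℕ) : (legendre n j).eval 1 = 1 := by
  induction j using Nat.twoStepInduction with
  | zero => simp [legendre]
  | one => simp [legendre]
  | more j h0 h1 =>
    have := legendre_rec hn j 1
    rw [h0, h1] at this
    apply mul_left_cancel₀ (legendre_denom_pos hn j).ne'
    rw [this]
    ring

theorem natDegree_legendre_le (n j : ℕ) : (legendre n j).natDegree ≤ j := by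
  induction j using Nat.twoStepInduction with
  | zero => simp [legendre]
  | one => simp [legendre]
  | more j h0 h1 =>
    rw [legendre]
    refine (Polynomial.natDegree_C_mul_le _ _).trans ?_
    refine (Polynomial.natDegree_sub_le _ _).trans (max_le ?_ ?_)
    · rw [mul_assoc]
      refine (Polynomial.natDegree_C_mul_le _ _).trans ?_
      refine Polynomial.natDegree_mul_le.trans ?_
      rw [Polynomial.natDegree_X]
      omega
    · exact (Polynomial.natDegree_C_mul_le _ _).trans (by omega)

/-- The two-term relation replaces the closed form of the value at 1. It is what converts the
Gegenbauer recursion into the normalised one, and positivity permits the division. -/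
theorem gegenbauer_eval_one_pos {α : ℝ} (hα : 0 < α) (j : ℕ) :
    0 < (gegenbauer α j).eval 1 ∧
      ((j : ℝ) + 1) * (gegenbauer α (j + 1)).eval 1 = ((j : ℝ) + 2 * α) * (gegenbauer α j).eval 1 := by
  induction j with
  | zero => simp [gegenbauer]
  | succ j ih =>
    obtain ⟨hpos, hrec⟩ := ih
    have hj : (0 : ℝ) ≤ j := j.cast_nonneg
    have hpos' : 0 < (gegenbauer α (j + 1)).eval 1 := by
      have : 0 < ((j : ℝ) + 1) * (gegenbauer α (j + 1)).eval 1 := by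
        rw [hrec]
        positivity
      exact pos_of_mul_pos_right this (by positivity)
    refine ⟨hpos', ?_⟩
    rw [gegenbauer]
    simp only [Polynomial.eval_mul, Polynomial.eval_sub, Polynomial.eval_C, Polynomial.eval_X]
    push_cast
    field_simp
    linear_combination ((j : ℝ) + 2) * hrec

/-- For n = 2 the normalised recursion is the Chebyshev recursion, because j + n - 1 = j + 1 and 2j
+ n = 2(j + 1). For n ≥ 3 the Gegenbauer recursion is divided by the values at 1. -/
theorem gegenbauerQuot_eq_legendre {n : ℕ} (hn : 2 ≤ n) (d : ℕ) :
    gegenbauerQuot n d = legendre n d := by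
  rw [gegenbauerQuot]
  split_ifs with h2
  · subst h2
    induction d using Nat.twoStepInduction with
    | zero => simp [legendre]
    | one => simp [legendre]
    | more j h0 h1 =>
      rw [legendre, ← h0, ← h1]
      have hj : (j : ℝ) + 1 ≠ 0 := by positivity
      push_cast
      rw [Polynomial.Chebyshev.T_add_two]
      apply Polynomial.funext
      intro t
      simp only [Polynomial.eval_mul, Polynomial.eval_sub, Polynomial.eval_C, Polynomial.eval_X]
      have : (j : ℝ) + 2 - 1 = j + 1 := by ring
      rw [this]
      field_simp
      simp
      ring
  · set α : ℝ := ((n : ℝ) - 2) / 2 with hα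
    have hn3 : (3 : ℝ) ≤ n := by exact_mod_cast (by omega : 3 ≤ n)
    have hαpos : 0 < α := by rw [hα]; linarith
    have hnα : (n : ℝ) = 2 * α + 2 := by rw [hα]; ring
    have key : ∀ d, gegenbauer α d =
        Polynomial.C ((gegenbauer α d).eval 1) * legendre n d := by
      intro d
      induction d using Nat.twoStepInduction with
      | zero => simp [legendre, gegenbauer]
      | one => simp [legendre, gegenbauer]
      | more j h0 h1 =>
        have e1 := (gegenbauer_eval_one_pos hαpos j).2
        have e2 := (gegenbauer_eval_one_pos hαpos (j + 1)).2
        have p1 := legendre_denom_pos hn j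
        apply Polynomial.funext
        intro t
        have r := legendre_rec hn j t
        have h0' := congrArg (Polynomial.eval t) h0
        have h1' := congrArg (Polynomial.eval t) h1
        have g2 : ((j : ℝ) + 2) * (gegenbauer α (j + 2)).eval t =
            2 * ((j : ℝ) + 2 + α - 1) * t * (gegenbauer α (j + 1)).eval t -
              ((j : ℝ) + 2 + 2 * α - 2) * (gegenbauer α j).eval t := by
          rw [gegenbauer]
          simp only [Polynomial.eval_mul, Polynomial.eval_sub, Polynomial.eval_C,
            Polynomial.eval_X]
          field_simp
        simp only [Polynomial.eval_mul, Polynomial.eval_C] at h0' h1' ⊢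
        rw [h0', h1'] at g2
        push_cast at e2
        have hj2 : (j : ℝ) + 2 ≠ 0 := by positivity
        apply mul_left_cancel₀ hj2
        rw [hnα] at r
        rw [g2]
        linear_combination -(gegenbauer α (j + 1)).eval 1 * r
          - (legendre n (j + 2)).eval t * e2 + (legendre n j).eval t * e1
    have hpos := (gegenbauer_eval_one_pos hαpos d).1.ne'
    have hkey := key d
    generalize (gegenbauer α d).eval 1 = c at hpos hkey
    rw [hkey, ← mul_assoc, ← Polynomial.C_mul, one_div, inv_mul_cancel₀ hpos, Polynomial.C_1,
      one_mul]

theorem zonal_eq {n : ℕ} (hn : 2 ≤ n) (d : ℕ) :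
    zonal n d =
      Polynomial.C ((dimHarm n d : ℝ) / (sphMeasure n).real Set.univ) * legendre n d := by
  rw [zonal, gegenbauerQuot_eq_legendre hn]

/-- The squared norm as a polynomial. -/
def normSq (n : ℕ) : MvPolynomial (Fin n) ℝ := ∑ i, MvPolynomial.X i ^ 2

theorem pderiv_normSq {n : ℕ} (i : Fin n) :
    MvPolynomial.pderiv i (normSq n) = 2 * MvPolynomial.X i := by
  classical
  simp only [normSq, map_sum, MvPolynomial.pderiv_pow, MvPolynomial.pderiv_X, Pi.single_apply]
  simp

theorem isHomogeneous_normSq (n : ℕ) : (normSq n).IsHomogeneous 2 :=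
  MvPolynomial.IsHomogeneous.sum _ _ _ fun _ _ => MvPolynomial.isHomogeneous_X_pow _ _

/-- The homogeneous harmonic polynomial in `x` which on the sphere equals the normalised Gegenbauer
polynomial of `⟨x, z⟩`. -/
def zonalHarmonic {n : ℕ} (z : Sph n) : ℕ → MvPolynomial (Fin n) ℝ
  | 0 => 1
  | 1 => linForm z
  | j + 2 => MvPolynomial.C (1 / ((j : ℝ) + n - 1)) *
      (MvPolynomial.C (2 * (j : ℝ) + n) * (linForm z * zonalHarmonic z (j + 1)) -
        MvPolynomial.C ((j : ℝ) + 1) * (normSq n * zonalHarmonic z j))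

theorem isHomogeneous_zonalHarmonic {n : ℕ} (z : Sph n) (j : ℕ) :
    (zonalHarmonic z j).IsHomogeneous j := by
  induction j using Nat.twoStepInduction with
  | zero => exact MvPolynomial.isHomogeneous_one _ _
  | one => exact isHomogeneous_linForm z
  | more j h0 h1 =>
    rw [zonalHarmonic]
    refine MvPolynomial.IsHomogeneous.C_mul (.sub (.C_mul ?_ _) (.C_mul ?_ _)) _
    · convert! (isHomogeneous_linForm z).mul h1 using 1
      omega
    · convert! (isHomogeneous_normSq n).mul h0 using 1
      omega

theorem sum_sq_sphere {n : ℕ} (z : Sph n) : ∑ i, z.1 i ^ 2 = 1 := by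
  rw [← EuclideanSpace.real_norm_sq_eq, mem_sphere_zero_iff_norm.1 z.2, one_pow]

theorem zonalHarmonic_rec {n : ℕ} (hn : 2 ≤ n) (z : Sph n) (j : ℕ) :
    MvPolynomial.C ((j : ℝ) + n - 1) * zonalHarmonic z (j + 2) =
      MvPolynomial.C (2 * (j : ℝ) + n) * (linForm z * zonalHarmonic z (j + 1)) -
        MvPolynomial.C ((j : ℝ) + 1) * (normSq n * zonalHarmonic z j) := by
  rw [zonalHarmonic, ← mul_assoc, ← MvPolynomial.C_mul, one_div,
    mul_inv_cancel₀ (legendre_denom_pos hn j).ne', MvPolynomial.C_1, one_mul]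

/-- The squared norm, which makes the recursion homogeneous, equals 1 on the sphere. -/
theorem restrict_zonalHarmonic {n : ℕ} (z : Sph n) (j : ℕ) :
    restrict n (zonalHarmonic z j) = restrict n (Polynomial.aeval (linForm z) (legendre n j)) := by
  have hns : restrict n (normSq n) = 1 := by
    ext x
    simpa [restrict_apply, normSq] using sum_sq_sphere x
  have hC : ∀ c : ℝ, restrict n (MvPolynomial.C c) = algebraMap ℝ _ c := fun c => by
    rw [← MvPolynomial.algebraMap_eq, AlgHom.commutes]
  induction j using Nat.twoStepInduction with
  | zero => simp [zonalHarmonic, legendre]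
  | one => simp [zonalHarmonic, legendre]
  | more j h0 h1 =>
    rw [zonalHarmonic, legendre]
    simp only [map_mul, map_sub, h0, h1, hns, Polynomial.aeval_C, Polynomial.aeval_X, hC,
      AlgHom.commutes]
    ring

/-- The derivative in the direction of `z`. -/
def dirDeriv {n : ℕ} (z : Sph n) (p : MvPolynomial (Fin n) ℝ) : MvPolynomial (Fin n) ℝ :=
  ∑ i, MvPolynomial.C (z.1 i) * MvPolynomial.pderiv i p

theorem dirDeriv_mul {n : ℕ} (z : Sph n) (p q : MvPolynomial (Fin n) ℝ) :
    dirDeriv z (p * q) = dirDeriv z p * q + p * dirDeriv z q := by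
  simp only [dirDeriv, Finset.sum_mul, Finset.mul_sum, ← Finset.sum_add_distrib]
  refine Finset.sum_congr rfl fun i _ => ?_
  rw [MvPolynomial.pderiv_mul]
  ring

theorem dirDeriv_C_mul {n : ℕ} (z : Sph n) (c : ℝ) (p : MvPolynomial (Fin n) ℝ) :
    dirDeriv z (MvPolynomial.C c * p) = MvPolynomial.C c * dirDeriv z p := by
  simp only [dirDeriv, Finset.mul_sum, MvPolynomial.pderiv_C_mul]
  exact Finset.sum_congr rfl fun i _ => by ring

theorem dirDeriv_sub {n : ℕ} (z : Sph n) (p q : MvPolynomial (Fin n) ℝ) :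
    dirDeriv z (p - q) = dirDeriv z p - dirDeriv z q := by
  simp only [dirDeriv, map_sub, mul_sub, Finset.sum_sub_distrib]

theorem dirDeriv_linForm {n : ℕ} (z : Sph n) : dirDeriv z (linForm z) = 1 := by
  rw [← MvPolynomial.C_1, ← sum_sq_sphere z, map_sum, dirDeriv]
  exact Finset.sum_congr rfl fun i _ => by rw [pderiv_linForm, ← MvPolynomial.C_mul, pow_two]

theorem dirDeriv_normSq {n : ℕ} (z : Sph n) : dirDeriv z (normSq n) = 2 * linForm z := by
  simp only [dirDeriv, pderiv_normSq, linForm, Finset.mul_sum]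
  exact Finset.sum_congr rfl fun i _ => by ring

/-- This derivative is the cross term of gradients in the Laplacian of the linear form times a zonal
harmonic. The induction differentiates the recursion, cleared of its denominator, and uses the two
preceding degrees. -/
theorem dirDeriv_zonalHarmonic {n : ℕ} (hn : 2 ≤ n) (z : Sph n) (j : ℕ) :
    dirDeriv z (zonalHarmonic z (j + 1)) = MvPolynomial.C ((j : ℝ) + 1) * zonalHarmonic z j := by
  induction j using Nat.strong_induction_on with
  | _ j ih =>
    rcases j with _ | j
    · simp [zonalHarmonic, dirDeriv_linForm]
    · have hne : (MvPolynomial.C ((j : ℝ) + n - 1) : MvPolynomial (Fin n) ℝ) ≠ 0 := by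
        rw [Ne, MvPolynomial.C_eq_zero]
        exact (legendre_denom_pos hn j).ne'
      apply mul_left_cancel₀ hne
      rw [← dirDeriv_C_mul, zonalHarmonic_rec hn, dirDeriv_sub, dirDeriv_C_mul, dirDeriv_C_mul,
        dirDeriv_mul, dirDeriv_mul, dirDeriv_linForm, dirDeriv_normSq, ih j (by omega)]
      rcases j with _ | j
      · have : dirDeriv z (zonalHarmonic z 0) = 0 := by simp [zonalHarmonic, dirDeriv]
        rw [this]
        simp only [zonalHarmonic, map_add, map_sub, map_mul, map_natCast, map_one, map_ofNat]
        push_cast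
        ring
      · have hr := zonalHarmonic_rec hn z j
        rw [ih j (by omega)]
        simp only [map_add, map_sub, map_mul, map_natCast, map_one, map_ofNat] at hr ⊢
        push_cast at hr ⊢
        linear_combination (-(j : MvPolynomial (Fin n) ℝ) - 2) * hr

/-- In the Laplacian of the recursion, the product with the linear form contributes 2(j + 1) times
the j-th zonal harmonic by the directional derivative, and the product with the squared norm
contributes 2n + 4j times it by Euler's identity. With the factors 2j + n and j + 1 the two cancel.
-/
theorem laplacian_zonalHarmonic {n : ℕ} (hn : 2 ≤ n) (z : Sph n) (j : ℕ) :
    laplacian n (zonalHarmonic z j) = 0 := by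
  have hL : laplacian n (linForm z) = 0 := by
    simp [laplacian_apply, pderiv_linForm]
  have hN : laplacian n (normSq n) = MvPolynomial.C (2 * (n : ℝ)) := by
    have : ∀ i : Fin n, MvPolynomial.pderiv i (2 * MvPolynomial.X i : MvPolynomial (Fin n) ℝ) =
        2 := by
      intro i
      have h2 : (2 : MvPolynomial (Fin n) ℝ) = MvPolynomial.C 2 := (map_ofNat _ 2).symm
      rw [h2, MvPolynomial.pderiv_C_mul, MvPolynomial.pderiv_X_self, mul_one]
    simp only [laplacian_apply, pderiv_normSq, this, Finset.sum_const, Finset.card_univ,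
      Fintype.card_fin, nsmul_eq_mul, map_mul, map_ofNat, map_natCast]
    ring
  have hC : ∀ (c : ℝ) (p : MvPolynomial (Fin n) ℝ),
      laplacian n (MvPolynomial.C c * p) = MvPolynomial.C c * laplacian n p := fun c p => by
    rw [← MvPolynomial.smul_eq_C_mul, map_smul, MvPolynomial.smul_eq_C_mul]
  induction j using Nat.twoStepInduction with
  | zero => simp [laplacian_apply, zonalHarmonic]
  | one => exact hL
  | more j h0 h1 =>
    have hne : (MvPolynomial.C ((j : ℝ) + n - 1) : MvPolynomial (Fin n) ℝ) ≠ 0 := by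
      rw [Ne, MvPolynomial.C_eq_zero]
      exact (legendre_denom_pos hn j).ne'
    apply mul_left_cancel₀ hne
    have hd := dirDeriv_zonalHarmonic hn z j
    have hE := (isHomogeneous_zonalHarmonic z j).sum_X_mul_pderiv
    have e1 : ∑ i, MvPolynomial.pderiv i (linForm z) *
        MvPolynomial.pderiv i (zonalHarmonic z (j + 1)) =
        MvPolynomial.C ((j : ℝ) + 1) * zonalHarmonic z j := by
      rw [← hd, dirDeriv]
      simp only [pderiv_linForm]
    have e2 : ∑ i, MvPolynomial.pderiv i (normSq n) *
        MvPolynomial.pderiv i (zonalHarmonic z j) = 2 * (j * zonalHarmonic z j) := by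
      rw [← nsmul_eq_mul, ← hE, Finset.mul_sum]
      exact Finset.sum_congr rfl fun i _ => by rw [pderiv_normSq]; ring
    rw [← hC, zonalHarmonic_rec hn, map_sub, hC, hC, laplacian_mul, laplacian_mul, e1, e2, h0, h1,
      hL, hN]
    simp only [map_add, map_mul, map_natCast, map_one, map_ofNat]
    ring

/-! ### The reproducing kernel of H_d and the dimension formula. -/

theorem mem_sphericalHarmonics {n d : ℕ} {g : C(Sph n, ℝ)} :
    g ∈ sphericalHarmonics n d ↔
      ∃ p : MvPolynomial (Fin n) ℝ, p.IsHomogeneous d ∧ laplacian n p = 0 ∧ restrict n p = g := by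
  simp only [sphericalHarmonics, Submodule.mem_map, Submodule.mem_inf,
    MvPolynomial.mem_homogeneousSubmodule, LinearMap.mem_ker, and_assoc, AlgHom.toLinearMap_apply]

/-- The function `x ↦ P(⟨x, z⟩)` on the sphere. -/
def zonalFun {n : ℕ} (P : Polynomial ℝ) (z : Sph n) : C(Sph n, ℝ) :=
  restrict n (Polynomial.aeval (linForm z) P)

theorem zonalFun_apply {n : ℕ} (P : Polynomial ℝ) (z x : Sph n) :
    zonalFun P z x = P.eval (∑ j, z.1 j * x.1 j) := by
  have : restrict n (linForm z) x = ∑ j, z.1 j * x.1 j := by simp [restrict_apply, linForm]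
  rw [zonalFun, ← Polynomial.aeval_algHom_apply, ← this]
  induction P using Polynomial.induction_on' with
  | add p q hp hq => simp [hp, hq]
  | monomial k a => simp [Polynomial.aeval_monomial]

theorem zonalFun_comm {n : ℕ} (P : Polynomial ℝ) (z x : Sph n) :
    zonalFun P z x = zonalFun P x z := by
  simp only [zonalFun_apply, mul_comm]

theorem zonalFun_self {n : ℕ} (P : Polynomial ℝ) (z : Sph n) : zonalFun P z z = P.eval 1 := by
  have := sum_sq_sphere z
  simp only [pow_two] at this
  rw [zonalFun_apply, this]

theorem zonalFun_legendre_mem {n : ℕ} (hn : 2 ≤ n) (d : ℕ) (z : Sph n) :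
    zonalFun (legendre n d) z ∈ sphericalHarmonics n d :=
  mem_sphericalHarmonics.2 ⟨zonalHarmonic z d, isHomogeneous_zonalHarmonic z d,
    laplacian_zonalHarmonic hn z d, restrict_zonalHarmonic z d⟩

theorem integral_sphericalHarmonics_mul_eq_zero {n : ℕ} (hn : 2 ≤ n) {j d : ℕ} (hjd : j ≠ d)
    {g h : C(Sph n, ℝ)} (hg : g ∈ sphericalHarmonics n j) (hh : h ∈ sphericalHarmonics n d) :
    ∫ x, g x * h x ∂(sphMeasure n) = 0 := by
  obtain ⟨p, hp, hp0, rfl⟩ := mem_sphericalHarmonics.1 hg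
  obtain ⟨q, hq, hq0, rfl⟩ := mem_sphericalHarmonics.1 hh
  rcases lt_or_gt_of_ne hjd with h | h
  · have := sphIntegral_harmonic_mul_eq_zero hn h hq hp hq0
    rw [mul_comm, sphIntegral_apply] at this
    simpa using this
  · have := sphIntegral_harmonic_mul_eq_zero hn h hp hq hp0
    rw [sphIntegral_apply] at this
    simpa using this

/-- The quotient `dim H_d / μ(S^{n-1})`, by its recursion in `d`. -/
def dimDensity (n : ℕ) : ℕ → ℝ
  | 0 => 1 / (sphMeasure n).real Set.univ
  | 1 => n / (sphMeasure n).real Set.univ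
  | j + 2 => dimDensity n (j + 1) * (((2 * (j : ℝ) + 2 + n) * ((j : ℝ) + n - 1)) /
      ((2 * (j : ℝ) + n) * ((j : ℝ) + 2)))

/-- The recursion of `dimDensity` is the inverse of the product of the recursions of the leading
coefficient and of `powFactor`. This makes it the constant of the reproducing formula, before any
relation to the dimension is known. -/
theorem coeff_legendre_mul_powFactor {n : ℕ} (hn : 2 ≤ n) (d : ℕ) :
    (legendre n d).coeff d * powFactor n d * dimDensity n d = 1 := by
  have hμ := (sphMeasure_pos (n := n) (by omega)).ne'
  have hn0 : (n : ℝ) ≠ 0 := by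
    have : n ≠ 0 := by omega
    exact_mod_cast this
  induction d using Nat.twoStepInduction with
  | zero => simp [legendre, powFactor, dimDensity, hμ]
  | one => simp [legendre, powFactor, dimDensity]; field_simp
  | more j _ h1 =>
    have p1 := (legendre_denom_pos hn j).ne'
    have hc : (legendre n (j + 2)).coeff (j + 2) =
        (2 * (j : ℝ) + n) / ((j : ℝ) + n - 1) * (legendre n (j + 1)).coeff (j + 1) := by
      rw [legendre, mul_assoc (Polynomial.C (2 * (j : ℝ) + n)), Polynomial.coeff_C_mul,
        Polynomial.coeff_sub, Polynomial.coeff_C_mul,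
        Polynomial.coeff_X_mul, Polynomial.coeff_C_mul,
        Polynomial.coeff_eq_zero_of_natDegree_lt
          ((natDegree_legendre_le n j).trans_lt (by omega : j < j + 2))]
      ring
    rw [hc, powFactor, dimDensity]
    push_cast
    have h2 : 2 * (j : ℝ) + n ≠ 0 := by positivity
    have h3 : (n : ℝ) + 2 * (j + 1) ≠ 0 := by positivity
    have h4 : 2 * (j : ℝ) + 2 + n ≠ 0 := by positivity
    have h5 : (j : ℝ) + 2 ≠ 0 := by positivity
    generalize (legendre n (j + 1)).coeff (j + 1) = a at h1
    generalize powFactor n (j + 1) = p at h1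
    generalize dimDensity n (j + 1) = q at h1
    refine Eq.trans (b := a * p * q) ?_ h1
    field_simp
    ring

/-- Expanded in powers of ⟨x, z⟩, every term below the top one is orthogonal to h by degree, and the
top one is evaluated by `sphIntegral_harmonic_mul_linForm_pow`. -/
theorem integral_mul_zonalFun_legendre {n : ℕ} (hn : 2 ≤ n) {d : ℕ} {h : C(Sph n, ℝ)}
    (hh : h ∈ sphericalHarmonics n d) (z : Sph n) :
    dimDensity n d * ∫ x, h x * zonalFun (legendre n d) z x ∂(sphMeasure n) = h z := by
  obtain ⟨p, hp, hp0, rfl⟩ := mem_sphericalHarmonics.1 hh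
  have h1 : ∫ x, restrict n p x * zonalFun (legendre n d) z x ∂(sphMeasure n) =
      sphIntegral n (p * Polynomial.aeval (linForm z) (legendre n d)) := by
    rw [sphIntegral_apply]
    simp [zonalFun]
  rw [h1, Polynomial.aeval_eq_sum_range' (n := d + 1)
    (Nat.lt_succ_of_le (natDegree_legendre_le n d)), Finset.mul_sum, map_sum,
    Finset.sum_range_succ, Finset.sum_eq_zero, zero_add, mul_smul_comm, map_smul,
    sphIntegral_harmonic_mul_linForm_pow hn z hp hp0, smul_eq_mul]
  · linear_combination restrict n p z * coeff_legendre_mul_powFactor hn d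
  · intro l hl
    rw [mul_smul_comm, map_smul, sphIntegral_harmonic_mul_eq_zero hn (Finset.mem_range.1 hl) hp
      (by simpa using (isHomogeneous_linForm z).pow l) hp0, smul_zero]

/-- The trace of a reproducing kernel is the dimension: the squares of an orthonormal basis sum at
each point to the diagonal value of the kernel, and integrating that sum counts the basis. -/
theorem dimHarm_eq {n : ℕ} (hn : 2 ≤ n) (d : ℕ) :
    (dimHarm n d : ℝ) = dimDensity n d * (sphMeasure n).real Set.univ := by
  let L := (ContinuousMap.toLp (E := ℝ) 2 (sphMeasure n) ℝ).toLinearMap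
  let K := (sphericalHarmonics n d).map L
  have key : ∀ a b : C(Sph n, ℝ), inner ℝ (L a) (L b) = ∫ x, a x * b x ∂(sphMeasure n) := by
    intro a b
    have := ContinuousMap.inner_toLp (𝕜 := ℝ) (sphMeasure n) a b
    simpa [L, mul_comm] using this
  have hinj : Function.Injective L := ContinuousMap.toLp_injective (sphMeasure n)
  have hfin : Module.finrank ℝ K = dimHarm n d :=
    (LinearEquiv.finrank_eq (Submodule.equivMapOfInjective L hinj (sphericalHarmonics n d))).symm
  let b := stdOrthonormalBasis ℝ K
  choose Y hY hYL using fun i => (Submodule.mem_map).1 (b i).2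
  -- Parseval's identity for the kernel function g at z: its coordinates are the values Y_i(z), and
  -- its squared norm is g(z).
  have hsum : ∀ z : Sph n, ∑ i, Y i z ^ 2 = dimDensity n d := by
    intro z
    set g : C(Sph n, ℝ) := dimDensity n d • zonalFun (legendre n d) z with hg
    have hgm : g ∈ sphericalHarmonics n d :=
      Submodule.smul_mem _ _ (zonalFun_legendre_mem hn d z)
    have hrep : ∀ h ∈ sphericalHarmonics n d, inner ℝ (L h) (L g) = h z := by
      intro h hh
      rw [key, ← integral_mul_zonalFun_legendre hn hh z, ← integral_const_mul]
      refine integral_congr_ae (Filter.Eventually.of_forall fun x => ?_)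
      simp only [hg, ContinuousMap.smul_apply, smul_eq_mul]
      ring
    have h1 := b.sum_sq_norm_inner_right ⟨L g, Submodule.mem_map_of_mem hgm⟩
    have h2 : ∀ i, ‖inner ℝ (b i) (⟨L g, Submodule.mem_map_of_mem hgm⟩ : K)‖ ^ 2 =
        Y i z ^ 2 := by
      intro i
      rw [Submodule.coe_inner, ← hYL, hrep _ (hY i), Real.norm_eq_abs, sq_abs]
    rw [Finset.sum_congr rfl fun i _ => h2 i] at h1
    rw [h1, ← real_inner_self_eq_norm_sq, Submodule.coe_inner, hrep g hgm]
    simp [hg, zonalFun_self, legendre_eval_one hn]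
  have hnorm : ∀ i, ∫ z, Y i z ^ 2 ∂(sphMeasure n) = 1 := by
    intro i
    have := b.orthonormal.norm_eq_one i
    have h1 : inner ℝ (b i) (b i) = (1 : ℝ) := by rw [real_inner_self_eq_norm_sq, this, one_pow]
    rw [Submodule.coe_inner, ← hYL, key] at h1
    simpa only [pow_two] using h1
  have hint : ∫ z, ∑ i, Y i z ^ 2 ∂(sphMeasure n) = Module.finrank ℝ K := by
    have hi : ∀ i, Integrable (fun z => Y i z ^ 2) (sphMeasure n) := fun i =>
      integrable_sphere (Y i ^ 2)
    rw [integral_finsetSum _ fun i _ => hi i]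
    simp [hnorm]
  simp only [hsum, integral_const, smul_eq_mul] at hint
  rw [← hfin, ← hint, mul_comm]

theorem zonal_eq_dimDensity {n : ℕ} (hn : 2 ≤ n) (d : ℕ) :
    zonal n d = Polynomial.C (dimDensity n d) * legendre n d := by
  rw [zonal_eq hn, dimHarm_eq hn, mul_div_cancel_right₀ _ (sphMeasure_pos (by omega)).ne']

theorem dimDensity_pos {n : ℕ} (hn : 2 ≤ n) (d : ℕ) : 0 < dimDensity n d := by
  have hμ := sphMeasure_pos (n := n) (by omega)
  have hn0 : (0 : ℝ) < n := by exact_mod_cast (by omega : 0 < n)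
  induction d using Nat.twoStepInduction with
  | zero => simp [dimDensity, hμ]
  | one => simp only [dimDensity]; positivity
  | more j _ h1 =>
    have := legendre_denom_pos hn j
    rw [dimDensity]
    positivity


/-! ### The harmonic component and its discretisation -/

theorem integrable_sphere_mul {n : ℕ} (f g : C(Sph n, ℝ)) :
    Integrable (fun x => f x * g x) (sphMeasure n) :=
  integrable_sphere (f * g)

theorem totalDegree_aeval_linForm_le {n : ℕ} (z : Sph n) {P : Polynomial ℝ} {D : ℕ}
    (hP : P.natDegree ≤ D) : (Polynomial.aeval (linForm z) P).totalDegree ≤ D := by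
  rw [Polynomial.aeval_eq_sum_range' (n := D + 1) (by omega)]
  refine MvPolynomial.totalDegree_finsetSum_le fun l hl => ?_
  refine (MvPolynomial.totalDegree_smul_le _ _).trans ?_
  refine (MvPolynomial.totalDegree_pow _ _).trans ?_
  have h1 := (isHomogeneous_linForm z).totalDegree_le
  have h2 := Finset.mem_range.1 hl
  calc l * (linForm z).totalDegree ≤ l * 1 := Nat.mul_le_mul_left _ h1
    _ ≤ D := by omega

theorem natDegree_zonal_le {n : ℕ} (hn : 2 ≤ n) (d : ℕ) : (zonal n d).natDegree ≤ d := by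
  rw [zonal_eq_dimDensity hn]
  exact (Polynomial.natDegree_C_mul_le _ _).trans (natDegree_legendre_le n d)

theorem zonalFun_zonal {n : ℕ} (hn : 2 ≤ n) (d : ℕ) (z : Sph n) :
    zonalFun (zonal n d) z = dimDensity n d • zonalFun (legendre n d) z := by
  ext x
  simp [zonalFun_apply, zonal_eq_dimDensity hn]

theorem zonalFun_zonal_mem {n : ℕ} (hn : 2 ≤ n) (d : ℕ) (z : Sph n) :
    zonalFun (zonal n d) z ∈ sphericalHarmonics n d := by
  rw [zonalFun_zonal hn]
  exact Submodule.smul_mem _ _ (zonalFun_legendre_mem hn d z)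

theorem integral_mul_zonalFun_zonal {n : ℕ} (hn : 2 ≤ n) {d : ℕ} {h : C(Sph n, ℝ)}
    (hh : h ∈ sphericalHarmonics n d) (z : Sph n) :
    ∫ x, h x * zonalFun (zonal n d) z x ∂(sphMeasure n) = h z := by
  rw [← integral_mul_zonalFun_legendre hn hh z, ← integral_const_mul, zonalFun_zonal hn]
  refine integral_congr_ae (Filter.Eventually.of_forall fun x => ?_)
  simp only [ContinuousMap.smul_apply, smul_eq_mul]
  ring

theorem integral_zonalFun_zonal_sq {n : ℕ} (hn : 2 ≤ n) (d : ℕ) (z : Sph n) :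
    ∫ x, zonalFun (zonal n d) z x ^ 2 ∂(sphMeasure n) = dimDensity n d := by
  have := integral_mul_zonalFun_zonal hn (zonalFun_zonal_mem hn d z) z
  simp only [pow_two]
  rw [this, zonalFun_self, zonal_eq_dimDensity hn]
  simp [legendre_eval_one hn]

/-- The kernel at z lies in H_d, so f and its harmonic component have the same integral against it;
for the component that integral is its value at z. -/
theorem harmonicComponent_apply {n : ℕ} (hn : 2 ≤ n) (d : ℕ) (f : C(Sph n, ℝ)) (z : Sph n) :
    harmonicComponent n d f z = ∫ x, f x * zonalFun (zonal n d) z x ∂(sphMeasure n) := by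
  obtain ⟨hmem, horth⟩ := (existsUnique_harmonicComponent n d f).choose_spec.1
  change harmonicComponent n d f ∈ _ at hmem
  have h1 := horth _ (zonalFun_zonal_mem hn d z)
  change ∫ x, (f x - harmonicComponent n d f x) * zonalFun (zonal n d) z x ∂_ = 0 at h1
  rw [← integral_mul_zonalFun_zonal hn hmem z]
  simp only [sub_mul] at h1
  rw [integral_sub (integrable_sphere_mul _ _) (integrable_sphere_mul _ _)] at h1
  linarith

theorem restrict_harmonicApprox {n : ℕ} (Q : QuadratureRule n) (d : ℕ) (f : C(Sph n, ℝ))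
    (x : Sph n) : restrict n (harmonicApprox Q d f) x =
      ∑ z ∈ Q.nodes, Q.weight z * (f z * zonalFun (zonal n d) x z) := by
  simp only [harmonicApprox, map_sum, map_mul, ContinuousMap.coe_sum, Finset.sum_apply,
    ContinuousMap.mul_apply]
  refine Finset.sum_congr rfl fun z _ => ?_
  rw [← zonalFun_comm, zonalFun, restrict_apply _ (MvPolynomial.C _),
    restrict_apply _ (MvPolynomial.C _), MvPolynomial.eval_C, MvPolynomial.eval_C, mul_assoc]

theorem totalDegree_harmonicApprox_le {n : ℕ} (hn : 2 ≤ n) (Q : QuadratureRule n) (d : ℕ)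
    (f : C(Sph n, ℝ)) : (harmonicApprox Q d f).totalDegree ≤ d := by
  refine MvPolynomial.totalDegree_finsetSum_le fun z _ => ?_
  refine (MvPolynomial.totalDegree_mul _ _).trans ?_
  rw [MvPolynomial.totalDegree_C, zero_add]
  exact totalDegree_aeval_linForm_le z (natDegree_zonal_le hn d)

/-- Cauchy–Schwarz in the form of the arithmetic–geometric inequality. Being affine in Z², the bound
can be integrated or summed with positive weights alike. The optimal s is the quotient √(D/M) of
`half_mul_add_div_sqrt`, with D the integral of Z² and M the total mass. -/
theorem abs_mul_le_of_abs_le {g δ s Z : ℝ} (hg : |g| ≤ δ) (hs : 0 < s) :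
    |g * Z| ≤ δ / 2 * s + δ / (2 * s) * Z ^ 2 := by
  have h1 : |Z| ≤ s / 2 + Z ^ 2 / (2 * s) := by
    rw [← sub_nonneg]
    have : s / 2 + Z ^ 2 / (2 * s) - |Z| = (s - |Z|) ^ 2 / (2 * s) := by
      field_simp
      nlinarith [sq_abs Z]
    rw [this]
    positivity
  rw [abs_mul]
  calc |g| * |Z| ≤ δ * (s / 2 + Z ^ 2 / (2 * s)) :=
        mul_le_mul hg h1 (abs_nonneg _) ((abs_nonneg _).trans hg)
    _ = _ := by ring

theorem half_mul_add_div_sqrt {δ M D : ℝ} (hM : 0 < M) (hD : 0 < D) :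
    δ / 2 * √(D / M) * M + δ / (2 * √(D / M)) * D = δ * √(D * M) := by
  have h1 : √(D * M) = √(D / M) * M := by
    rw [show D * M = D / M * M ^ 2 by field_simp, Real.sqrt_mul (by positivity),
      Real.sqrt_sq hM.le]
  have hs : 0 < √(D / M) := Real.sqrt_pos.2 (by positivity)
  have h2 : √(D / M) ^ 2 = D / M := Real.sq_sqrt (by positivity)
  rw [h1]
  have h3 : D = √(D / M) ^ 2 * M := by rw [h2]; field_simp
  generalize √(D / M) = s at *
  rw [h3]
  field_simp
  ring

theorem abs_integral_mul_zonalFun_le {n : ℕ} (hn : 2 ≤ n) (d : ℕ) {g : C(Sph n, ℝ)} {δ : ℝ}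
    (hg : ∀ x, |g x| ≤ δ) (z : Sph n) :
    |∫ x, g x * zonalFun (zonal n d) z x ∂(sphMeasure n)| ≤ δ * √(dimHarm n d) := by
  have hM := sphMeasure_pos (n := n) (by omega)
  have hD := dimDensity_pos hn d
  have hs : 0 < √(dimDensity n d / (sphMeasure n).real Set.univ) :=
    Real.sqrt_pos.2 (by positivity)
  rw [dimHarm_eq hn, ← half_mul_add_div_sqrt hM hD]
  have hi : Integrable (fun x => zonalFun (zonal n d) z x ^ 2) (sphMeasure n) :=
    integrable_sphere (zonalFun (zonal n d) z ^ 2)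
  refine (abs_integral_le_integral_abs).trans ?_
  refine (integral_mono (integrable_sphere (g * zonalFun (zonal n d) z)).abs
    ((integrable_const _).add (hi.const_mul _)) fun x => abs_mul_le_of_abs_le (hg x) hs).trans ?_
  simp only [Pi.add_apply]
  rw [integral_add (integrable_const _) (hi.const_mul _)]
  simp only [integral_const_mul, integral_zonalFun_zonal_sq hn, integral_const, smul_eq_mul]
  exact le_of_eq (by ring)

/-- The discrete counterpart of the preceding bound. Exactness in degree 2d is used for the constant
1 and for the squared kernel, so mass and L² norm are those of μ. Positivity of the weights makes
the termwise bound summable. -/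
theorem abs_sum_mul_zonalFun_le {n : ℕ} (hn : 2 ≤ n) (d : ℕ) {Q : QuadratureRule n}
    (hQ : Q.IsExact (2 * d)) {g : Sph n → ℝ} {δ : ℝ} (hg : ∀ x, |g x| ≤ δ) (z : Sph n) :
    |∑ x ∈ Q.nodes, Q.weight x * (g x * zonalFun (zonal n d) z x)| ≤ δ * √(dimHarm n d) := by
  have hM := sphMeasure_pos (n := n) (by omega)
  have hD := dimDensity_pos hn d
  have hs : 0 < √(dimDensity n d / (sphMeasure n).real Set.univ) :=
    Real.sqrt_pos.2 (by positivity)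
  have h1 : ∑ x ∈ Q.nodes, Q.weight x = (sphMeasure n).real Set.univ := by
    have := hQ 1 (by simp)
    simpa using this
  have h2 : ∑ x ∈ Q.nodes, Q.weight x * zonalFun (zonal n d) z x ^ 2 = dimDensity n d := by
    have := hQ (Polynomial.aeval (linForm z) (zonal n d) ^ 2)
      ((MvPolynomial.totalDegree_pow _ _).trans (Nat.mul_le_mul_left _
        (totalDegree_aeval_linForm_le z (natDegree_zonal_le hn d))))
    rw [← integral_zonalFun_zonal_sq hn d z]
    simpa [zonalFun] using this
  rw [dimHarm_eq hn, ← half_mul_add_div_sqrt hM hD]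
  refine (Finset.abs_sum_le_sum_abs _ _).trans ?_
  calc ∑ x ∈ Q.nodes, |Q.weight x * (g x * zonalFun (zonal n d) z x)|
      ≤ ∑ x ∈ Q.nodes, Q.weight x *
        (δ / 2 * √(dimDensity n d / (sphMeasure n).real Set.univ) +
          δ / (2 * √(dimDensity n d / (sphMeasure n).real Set.univ)) *
            zonalFun (zonal n d) z x ^ 2) := by
        refine Finset.sum_le_sum fun x hx => ?_
        rw [abs_mul, abs_of_pos (Q.weight_pos x hx)]
        exact mul_le_mul_of_nonneg_left (abs_mul_le_of_abs_le (hg x) hs) (Q.weight_pos x hx).le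
    _ = _ := by
        simp only [mul_add, Finset.sum_add_distrib, ← Finset.sum_mul, h1]
        rw [← h2, Finset.mul_sum]
        congr 1
        · ring
        · exact Finset.sum_congr rfl fun x _ => by ring

/-- If `f` is uniformly `δ`-close to a polynomial of degree at most `m`, then its discretised
harmonic component is close to the harmonic component. -/
theorem abs_harmonicApprox_sub_le {n : ℕ} (hn : 2 ≤ n) {d m : ℕ} {Q : QuadratureRule n}
    (hQ1 : Q.IsExact (d + m)) (hQ2 : Q.IsExact (2 * d)) {f : C(Sph n, ℝ)} {δ : ℝ}
    {p : MvPolynomial (Fin n) ℝ} (hp : p.totalDegree ≤ m) (hfp : ∀ x, |f x - restrict n p x| ≤ δ)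
    (x : Sph n) :
    |restrict n (harmonicApprox Q d f) x - harmonicComponent n d f x| ≤
      2 * δ * √(dimHarm n d) := by
  -- The polynomial p contributes equally to the sum and to the integral, so only f - p remains on
  -- both sides.
  have h1 := hQ1 (p * Polynomial.aeval (linForm x) (zonal n d))
    ((MvPolynomial.totalDegree_mul _ _).trans (by
      have := totalDegree_aeval_linForm_le x (natDegree_zonal_le hn d)
      omega))
  simp only [map_mul, ContinuousMap.mul_apply] at h1
  change ∑ z ∈ Q.nodes, Q.weight z * (restrict n p z * zonalFun (zonal n d) x z) =
    ∫ z, restrict n p z * zonalFun (zonal n d) x z ∂(sphMeasure n) at h1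
  have h2 := abs_sum_mul_zonalFun_le hn d hQ2 (g := fun z => f z - restrict n p z) hfp x
  have h3 := abs_integral_mul_zonalFun_le hn d (g := f - restrict n p) (δ := δ)
    (by simpa using hfp) x
  rw [restrict_harmonicApprox, harmonicComponent_apply hn]
  simp only [sub_mul, mul_sub, Finset.sum_sub_distrib, ContinuousMap.sub_apply] at h2 h3
  rw [integral_sub (integrable_sphere_mul _ _) (integrable_sphere_mul _ _), ← h1] at h3
  rw [abs_le] at *
  constructor <;> linarith [h2.1, h2.2, h3.1, h3.2]

/-! ### The Christoffel–Darboux formula and a concentrated kernel -/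

/-- The coefficients in the Christoffel–Darboux formula. -/
def darbouxCoeff (n j : ℕ) : ℝ := dimDensity n (j + 1) * ((j : ℝ) + 1) / (2 * (j : ℝ) + n)

theorem darbouxCoeff_nonneg {n : ℕ} (hn : 2 ≤ n) (j : ℕ) : 0 ≤ darbouxCoeff n j := by
  have := dimDensity_pos hn (j + 1)
  rw [darbouxCoeff]
  positivity

theorem darbouxCoeff_zero {n : ℕ} (hn : 2 ≤ n) : darbouxCoeff n 0 = dimDensity n 0 := by
  have hn0 : (n : ℝ) ≠ 0 := by
    have : n ≠ 0 := by omega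
    exact_mod_cast this
  simp only [darbouxCoeff, dimDensity]
  have := (sphMeasure_pos (n := n) (by omega)).ne'
  push_cast
  field_simp
  ring

theorem darbouxCoeff_succ {n : ℕ} (hn : 2 ≤ n) (j : ℕ) :
    darbouxCoeff n (j + 1) = dimDensity n (j + 1) * ((j : ℝ) + n - 1) / (2 * (j : ℝ) + n) := by
  have hn0 : (0 : ℝ) < n := by exact_mod_cast (by omega : 0 < n)
  have h1 : 2 * (j : ℝ) + 2 + n ≠ 0 := by positivity
  have h2 : 2 * ((j : ℝ) + 1) + n ≠ 0 := by positivity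
  rw [darbouxCoeff, dimDensity]
  push_cast
  field_simp
  ring

theorem darbouxCoeff_add {n : ℕ} (hn : 2 ≤ n) (j : ℕ) :
    darbouxCoeff n j + darbouxCoeff n (j + 1) = dimDensity n (j + 1) := by
  have hn0 : (0 : ℝ) < n := by exact_mod_cast (by omega : 0 < n)
  rw [darbouxCoeff_succ hn, darbouxCoeff]
  field_simp
  ring

theorem darbouxCoeff_le {n : ℕ} (hn : 2 ≤ n) (j : ℕ) : darbouxCoeff n j ≤ dimDensity n j := by
  rcases j with _ | j
  · exact (darbouxCoeff_zero hn).le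
  · have := darbouxCoeff_add hn j
    have := darbouxCoeff_nonneg hn j
    linarith

/-- In terms of c_j = `darbouxCoeff n j` the three-term recursion reads t D_{k+1} P_{k+1} = c_{k+1}
P_{k+2} + c_k P_k. Since c_k + c_{k+1} = D_{k+1}, multiplication by 1 - t makes the sum telescope.
-/
theorem christoffel_darboux {n : ℕ} (hn : 2 ≤ n) (k : ℕ) (t : ℝ) :
    (1 - t) * ∑ j ∈ Finset.range (k + 1), dimDensity n j * (legendre n j).eval t =
      darbouxCoeff n k * ((legendre n k).eval t - (legendre n (k + 1)).eval t) := by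
  induction k with
  | zero =>
    simp [legendre, darbouxCoeff_zero hn]
    ring
  | succ k ih =>
    have hn0 : (0 : ℝ) < n := by exact_mod_cast (by omega : 0 < n)
    have hr := legendre_rec hn k t
    have h1 : dimDensity n (k + 1) * (t * (legendre n (k + 1)).eval t) =
        darbouxCoeff n (k + 1) * (legendre n (k + 2)).eval t +
          darbouxCoeff n k * (legendre n k).eval t := by
      rw [darbouxCoeff_succ hn, darbouxCoeff]
      field_simp
      linear_combination (-dimDensity n (k + 1)) * hr
    rw [Finset.sum_range_succ, mul_add, ih]
    linear_combination -h1 - (legendre n (k + 1)).eval t * darbouxCoeff_add hn k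

/-- The polynomial whose square is a multiple of the approximation kernel. -/
def fejerPoly (n k : ℕ) : Polynomial ℝ :=
  ∑ j ∈ Finset.range k, Polynomial.C (((k : ℝ) - j) * dimDensity n j) * legendre n j

theorem natDegree_fejerPoly_le (n k : ℕ) : (fejerPoly n k).natDegree ≤ k - 1 := by
  refine Polynomial.natDegree_sum_le_of_forall_le _ _ fun j hj => ?_
  have := Finset.mem_range.1 hj
  exact (Polynomial.natDegree_C_mul_le _ _).trans ((natDegree_legendre_le n j).trans (by omega))

theorem eval_fejerPoly (n k : ℕ) (t : ℝ) : (fejerPoly n k).eval t =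
    ∑ j ∈ Finset.range k, ((k : ℝ) - j) * dimDensity n j * (legendre n j).eval t := by
  simp [fejerPoly, Polynomial.eval_finsetSum]

/-- The weights k - j arise from adding up the first k partial sums of ∑ D_j P_j, and each of these
obeys the Christoffel–Darboux formula. -/
theorem one_sub_mul_fejerPoly {n : ℕ} (hn : 2 ≤ n) (k : ℕ) (t : ℝ) :
    (1 - t) * (fejerPoly n k).eval t = ∑ i ∈ Finset.range k,
      darbouxCoeff n i * ((legendre n i).eval t - (legendre n (i + 1)).eval t) := by
  induction k with
  | zero => simp [fejerPoly]
  | succ k ih =>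
    rw [Finset.sum_range_succ, ← ih, ← christoffel_darboux hn, ← mul_add]
    congr 1
    rw [eval_fejerPoly, eval_fejerPoly, Finset.sum_range_succ _ k, Finset.sum_range_succ _ k,
      ← add_assoc, ← Finset.sum_add_distrib]
    push_cast
    congr 1
    · exact Finset.sum_congr rfl fun j _ => by ring
    · ring

theorem integral_legendre_mul_legendre {n : ℕ} (hn : 2 ≤ n) (i j : ℕ) (z : Sph n) :
    dimDensity n j * ∫ x, zonalFun (legendre n i) z x * zonalFun (legendre n j) z x
      ∂(sphMeasure n) = if i = j then 1 else 0 := by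
  split_ifs with h
  · subst h
    rw [integral_mul_zonalFun_legendre hn (zonalFun_legendre_mem hn i z), zonalFun_self,
      legendre_eval_one hn]
  · rw [integral_sphericalHarmonics_mul_eq_zero hn h (zonalFun_legendre_mem hn i z)
      (zonalFun_legendre_mem hn j z), mul_zero]

/-- Orthogonality extracts the i-th coefficient. The case i = k, where that coefficient is absent
and k - i = 0, is needed because the telescoped formula contains P_{i+1}. -/
theorem integral_legendre_mul_fejerPoly {n : ℕ} (hn : 2 ≤ n) {i k : ℕ} (hik : i ≤ k)
    (z : Sph n) : ∫ x, zonalFun (legendre n i) z x * zonalFun (fejerPoly n k) z x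
      ∂(sphMeasure n) = (k : ℝ) - i := by
  have h1 : ∀ x, zonalFun (legendre n i) z x * zonalFun (fejerPoly n k) z x =
      ∑ j ∈ Finset.range k, ((k : ℝ) - j) * (dimDensity n j *
        (zonalFun (legendre n i) z x * zonalFun (legendre n j) z x)) := by
    intro x
    simp only [zonalFun_apply, eval_fejerPoly, Finset.mul_sum]
    exact Finset.sum_congr rfl fun j _ => by ring
  simp only [h1]
  rw [integral_finsetSum _ fun j _ => ((integrable_sphere_mul
    (zonalFun (legendre n i) z) (zonalFun (legendre n j) z)).const_mul _).const_mul _]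
  simp only [integral_const_mul, integral_legendre_mul_legendre hn, mul_ite, mul_one, mul_zero,
    Finset.sum_ite_eq, Finset.mem_range]
  split_ifs with h
  · rfl
  · have : i = k := by omega
    subst this
    simp

theorem integral_fejerPoly_sq {n : ℕ} (hn : 2 ≤ n) (k : ℕ) (z : Sph n) :
    ∫ x, zonalFun (fejerPoly n k) z x ^ 2 ∂(sphMeasure n) =
      ∑ j ∈ Finset.range k, ((k : ℝ) - j) ^ 2 * dimDensity n j := by
  have h1 : ∀ x, zonalFun (fejerPoly n k) z x ^ 2 =
      ∑ j ∈ Finset.range k, ((k : ℝ) - j) * dimDensity n j *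
        (zonalFun (legendre n j) z x * zonalFun (fejerPoly n k) z x) := by
    intro x
    rw [pow_two]
    nth_rewrite 1 [zonalFun_apply]
    rw [eval_fejerPoly, Finset.sum_mul]
    refine Finset.sum_congr rfl fun j _ => ?_
    rw [zonalFun_apply (legendre n j)]
    ring
  simp only [h1]
  rw [integral_finsetSum _ fun j _ => (integrable_sphere_mul
    (zonalFun (legendre n j) z) (zonalFun (fejerPoly n k) z)).const_mul _]
  refine Finset.sum_congr rfl fun j hj => ?_
  rw [integral_const_mul, integral_legendre_mul_fejerPoly hn (Finset.mem_range.1 hj).le]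
  ring

/-- After one factor absorbs 1 - t, each difference P_i - P_{i+1} integrates against the other
factor to (k - i) - (k - i - 1) = 1. Only the sum of the Darboux coefficients remains. -/
theorem integral_one_sub_mul_fejerPoly_sq_le {n : ℕ} (hn : 2 ≤ n) (k : ℕ) (z : Sph n) :
    ∫ x : Sph n, (1 - ∑ j, z.1 j * x.1 j) * zonalFun (fejerPoly n k) z x ^ 2 ∂(sphMeasure n) ≤
      ∑ j ∈ Finset.range k, dimDensity n j := by
  have h1 : ∀ x : Sph n, (1 - ∑ j, z.1 j * x.1 j) * zonalFun (fejerPoly n k) z x ^ 2 =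
      ∑ i ∈ Finset.range k, darbouxCoeff n i *
        (zonalFun (legendre n i) z x * zonalFun (fejerPoly n k) z x -
          zonalFun (legendre n (i + 1)) z x * zonalFun (fejerPoly n k) z x) := by
    intro x
    have := one_sub_mul_fejerPoly hn k (∑ j, z.1 j * x.1 j)
    simp only [← zonalFun_apply] at this
    rw [pow_two, ← mul_assoc, this, Finset.sum_mul]
    exact Finset.sum_congr rfl fun j _ => by ring
  have hi : ∀ i, Integrable (fun x => zonalFun (legendre n i) z x *
      zonalFun (fejerPoly n k) z x) (sphMeasure n) := fun i =>
    integrable_sphere_mul _ _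
  have hi' : ∀ i, Integrable (fun x => zonalFun (legendre n i) z x * zonalFun (fejerPoly n k) z x -
      zonalFun (legendre n (i + 1)) z x * zonalFun (fejerPoly n k) z x) (sphMeasure n) := fun i =>
    (hi i).sub (hi (i + 1))
  simp only [h1]
  rw [integral_finsetSum _ fun i _ => (hi' i).const_mul _]
  refine Finset.sum_le_sum fun i hik => ?_
  have hik' := Finset.mem_range.1 hik
  rw [integral_const_mul, integral_sub (hi _) (hi _), integral_legendre_mul_fejerPoly hn hik'.le,
    integral_legendre_mul_fejerPoly hn hik']
  push_cast
  calc _ = darbouxCoeff n i := by ring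
    _ ≤ _ := darbouxCoeff_le hn i

/-- A discrete form of polynomial growth: a sequence of this order has partial sums comparable to k
times its last term. The induction reduces to (k + 2 - n) D_{k+2} ≤ (k + 1) D_{k+1}, which follows
from the explicit ratio. -/
theorem mul_dimDensity_le {n : ℕ} (hn : 2 ≤ n) (k : ℕ) :
    (k : ℝ) * dimDensity n k ≤ n * ∑ j ∈ Finset.range (k + 1), dimDensity n j := by
  have hn2 : (2 : ℝ) ≤ n := by exact_mod_cast hn
  induction k with
  | zero =>
    have := dimDensity_pos hn 0
    simp only [CharP.cast_eq_zero, zero_mul, zero_add, Finset.sum_range_one]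
    positivity
  | succ k ih =>
    rw [Finset.sum_range_succ, mul_add]
    rcases k with _ | k
    · have h0 := dimDensity_pos hn 0
      have h1 := dimDensity_pos hn 1
      simp only [zero_add, Finset.sum_range_one, Nat.cast_one]
      nlinarith
    · refine le_trans ?_ (add_le_add_left ih _)
      have hD := dimDensity_pos hn (k + 1)
      have hp : 0 < (2 * (k : ℝ) + n) * (k + 2) := by positivity
      have h2 : dimDensity n (k + 1 + 1) * ((2 * (k : ℝ) + n) * (k + 2)) =
          dimDensity n (k + 1) * ((2 * (k : ℝ) + 2 + n) * (k + n - 1)) := by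
        rw [dimDensity]
        field_simp
      have h3 : ((k : ℝ) + 2 - n) * ((2 * (k : ℝ) + 2 + n) * (k + n - 1)) ≤
          (k + 1) * ((2 * (k : ℝ) + n) * (k + 2)) := by
        have hk : (0 : ℝ) ≤ k := k.cast_nonneg
        have e1 : ((k : ℝ) + 2 - n) * (k + n - 1) ≤ (k + 1) * k := by nlinarith
        have e2 : (k : ℝ) * (2 * k + 2 + n) ≤ (2 * k + n) * (k + 2) := by nlinarith
        calc _ = (((k : ℝ) + 2 - n) * (k + n - 1)) * (2 * k + 2 + n) := by ring
          _ ≤ ((k + 1) * k) * (2 * k + 2 + n) := by gcongr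
          _ = (k + 1) * (k * (2 * k + 2 + n)) := by ring
          _ ≤ _ := by gcongr
      have h4 : ((k : ℝ) + 2 - n) * dimDensity n (k + 1 + 1) ≤ (k + 1) * dimDensity n (k + 1) := by
        refine le_of_mul_le_mul_right ?_ hp
        calc _ = dimDensity n (k + 1) *
              (((k : ℝ) + 2 - n) * ((2 * (k : ℝ) + 2 + n) * (k + n - 1))) := by
              linear_combination ((k : ℝ) + 2 - n) * h2
          _ ≤ dimDensity n (k + 1) * ((k + 1) * ((2 * (k : ℝ) + n) * (k + 2))) := by gcongr
          _ = _ := by ring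
      push_cast at h4 ⊢
      linarith

/-- Raising k by one adds the new plain sum to the weighted sum. On the left the increment is that
sum plus k D_k, and `mul_dimDensity_le` bounds the second part by n times the same sum. -/
theorem mul_sum_dimDensity_le {n : ℕ} (hn : 2 ≤ n) (k : ℕ) :
    (k : ℝ) * ∑ j ∈ Finset.range k, dimDensity n j ≤
      (n + 1) * ∑ j ∈ Finset.range k, ((k : ℝ) - j) * dimDensity n j := by
  induction k with
  | zero => simp
  | succ k ih =>
    have h1 : ∑ j ∈ Finset.range (k + 1), (((k + 1 : ℕ) : ℝ) - j) * dimDensity n j =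
        ∑ j ∈ Finset.range k, ((k : ℝ) - j) * dimDensity n j +
          ∑ j ∈ Finset.range (k + 1), dimDensity n j := by
      rw [Finset.sum_range_succ, Finset.sum_range_succ _ k, ← add_assoc, ← Finset.sum_add_distrib]
      push_cast
      congr 1
      · exact Finset.sum_congr rfl fun j _ => by ring
      · ring
    have h2 := mul_dimDensity_le hn k
    rw [h1, Finset.sum_range_succ]
    rw [Finset.sum_range_succ] at h2
    push_cast
    nlinarith

/-- With A the sum weighted by k - j, Cauchy–Schwarz gives A² ≤ S B, and k S ≤ (n + 1) A is the
preceding lemma. Squaring and dividing by S gives the bound. -/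
theorem sq_mul_sum_dimDensity_le {n : ℕ} (hn : 2 ≤ n) {k : ℕ} (hk : 0 < k) :
    (k : ℝ) ^ 2 * ∑ j ∈ Finset.range k, dimDensity n j ≤
      (n + 1) ^ 2 * ∑ j ∈ Finset.range k, ((k : ℝ) - j) ^ 2 * dimDensity n j := by
  set S := ∑ j ∈ Finset.range k, dimDensity n j with hS
  set A := ∑ j ∈ Finset.range k, ((k : ℝ) - j) * dimDensity n j
  set B := ∑ j ∈ Finset.range k, ((k : ℝ) - j) ^ 2 * dimDensity n j
  have hSpos : 0 < S := Finset.sum_pos (fun j _ => dimDensity_pos hn j) ⟨0, by simpa using hk⟩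
  have hcs : A ^ 2 ≤ S * B := by
    have := Finset.sum_mul_sq_le_sq_mul_sq (Finset.range k) (fun j => √(dimDensity n j))
      (fun j => ((k : ℝ) - j) * √(dimDensity n j))
    have e : ∀ j, √(dimDensity n j) * √(dimDensity n j) = dimDensity n j := fun j =>
      Real.mul_self_sqrt (dimDensity_pos hn j).le
    refine (le_of_eq ?_).trans (this.trans (le_of_eq ?_))
    · congr 1
      refine Finset.sum_congr rfl fun j _ => ?_
      linear_combination -((k : ℝ) - j) * e j
    · congr 1
      · exact Finset.sum_congr rfl fun j _ => by rw [pow_two, e]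
      · refine Finset.sum_congr rfl fun j _ => ?_
        linear_combination ((k : ℝ) - j) ^ 2 * e j
  have h1 : (k : ℝ) * S ≤ (n + 1) * A := mul_sum_dimDensity_le hn k
  have h2 : ((k : ℝ) * S) ^ 2 ≤ ((n + 1) * A) ^ 2 := by gcongr
  refine le_of_mul_le_mul_right ?_ hSpos
  nlinarith [mul_le_mul_of_nonneg_left hcs (by positivity : (0 : ℝ) ≤ ((n : ℝ) + 1) ^ 2)]

/-! ### Polynomial approximation of Lipschitz functions -/

/-- One factor ⟨x, z⟩ is expanded into coordinates; x_j leaves the integral and z_j is absorbed into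
f. This is why the induction has to quantify over all f. -/
theorem exists_polynomial_integral_pow {n : ℕ} (l : ℕ) : ∀ f : C(Sph n, ℝ),
    ∃ p : MvPolynomial (Fin n) ℝ, p.totalDegree ≤ l ∧ ∀ x : Sph n,
      restrict n p x = ∫ z : Sph n, f z * (∑ j, x.1 j * z.1 j) ^ l ∂(sphMeasure n) := by
  induction l with
  | zero =>
    intro f
    refine ⟨MvPolynomial.C (∫ z, f z ∂(sphMeasure n)), by simp, fun x => ?_⟩
    rw [restrict_apply, MvPolynomial.eval_C]
    simp
  | succ l ih =>
    intro f
    let c : Fin n → C(Sph n, ℝ) := fun j => restrict n (MvPolynomial.X j)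
    have hc : ∀ j z, c j z = z.1 j := fun j z => by simp [c, restrict_apply]
    choose p hp hpx using fun j => ih (f * c j)
    refine ⟨∑ j, MvPolynomial.X j * p j, ?_, fun x => ?_⟩
    · refine MvPolynomial.totalDegree_finsetSum_le fun j _ => ?_
      refine (MvPolynomial.totalDegree_mul _ _).trans ?_
      rw [MvPolynomial.totalDegree_X]
      have := hp j
      omega
    · have h1 : ∀ z : Sph n, f z * (∑ j, x.1 j * z.1 j) ^ (l + 1) =
          ∑ j, x.1 j * ((f * c j) z * (∑ j, x.1 j * z.1 j) ^ l) := by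
        intro z
        rw [pow_succ, Finset.mul_sum, Finset.mul_sum]
        refine Finset.sum_congr rfl fun j _ => ?_
        rw [ContinuousMap.mul_apply, hc]
        ring
      simp only [h1]
      rw [integral_finsetSum]
      · rw [map_sum, ContinuousMap.sum_apply]
        refine Finset.sum_congr rfl fun j _ => ?_
        rw [integral_const_mul, ← hpx, map_mul, ContinuousMap.mul_apply]
        congr 1
        exact hc j x
      · intro j _
        have := integrable_sphere (f * c j * zonalFun (Polynomial.X ^ l) x)
        refine Integrable.const_mul (this.congr (Filter.Eventually.of_forall fun z => ?_)) _
        simp [zonalFun_apply]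

theorem exists_polynomial_integral_zonalFun {n D : ℕ} {P : Polynomial ℝ} (hP : P.natDegree ≤ D)
    (f : C(Sph n, ℝ)) :
    ∃ p : MvPolynomial (Fin n) ℝ, p.totalDegree ≤ D ∧ ∀ x : Sph n,
      restrict n p x = ∫ z : Sph n, f z * zonalFun P x z ∂(sphMeasure n) := by
  choose p hp hpx using fun l => exists_polynomial_integral_pow (n := n) l f
  refine ⟨∑ l ∈ Finset.range (D + 1), P.coeff l • p l, ?_, fun x => ?_⟩
  · refine MvPolynomial.totalDegree_finsetSum_le fun l hl => ?_
    refine (MvPolynomial.totalDegree_smul_le _ _).trans ((hp l).trans ?_)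
    have := Finset.mem_range.1 hl
    omega
  · have h1 : ∀ z : Sph n, f z * zonalFun P x z =
        ∑ l ∈ Finset.range (D + 1), P.coeff l * (f z * (∑ j, x.1 j * z.1 j) ^ l) := by
      intro z
      rw [zonalFun_apply, Polynomial.eval_eq_sum_range' (n := D + 1) (by omega), Finset.mul_sum]
      exact Finset.sum_congr rfl fun l _ => by ring
    simp only [h1]
    rw [integral_finsetSum]
    · rw [map_sum, ContinuousMap.sum_apply]
      refine Finset.sum_congr rfl fun l _ => ?_
      rw [integral_const_mul, ← hpx, map_smul, ContinuousMap.smul_apply, smul_eq_mul]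
    · intro l _
      have := integrable_sphere (f * zonalFun (Polynomial.X ^ l) x)
      refine Integrable.const_mul (this.congr (Filter.Eventually.of_forall fun z => ?_)) _
      simp [zonalFun_apply]

/-- From 1 - cos θ ≥ 2 θ² / π² on [-π, π] and π² ≤ 10. -/
theorem sq_angle_le {n : ℕ} (x z : Sph n) :
    InnerProductGeometry.angle x.1 z.1 ^ 2 ≤ 5 * (1 - ∑ j, x.1 j * z.1 j) := by
  have h1 : Real.cos (InnerProductGeometry.angle x.1 z.1) = ∑ j, x.1 j * z.1 j := by
    rw [InnerProductGeometry.cos_angle, mem_sphere_zero_iff_norm.1 x.2,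
      mem_sphere_zero_iff_norm.1 z.2, mul_one, div_one, PiLp.inner_apply]
    exact Finset.sum_congr rfl fun j _ => by simp [mul_comm]
  set θ := InnerProductGeometry.angle x.1 z.1
  have h2 : |θ| ≤ Real.pi := by
    rw [abs_of_nonneg (InnerProductGeometry.angle_nonneg _ _)]
    exact InnerProductGeometry.angle_le_pi _ _
  have h3 := Real.cos_le_one_sub_mul_cos_sq h2
  rw [← h1]
  have hpi : Real.pi ^ 2 ≤ 10 := by nlinarith [Real.pi_lt_d2, Real.pi_pos]
  have h4 : 2 / Real.pi ^ 2 * θ ^ 2 ≤ 1 - Real.cos θ := by linarith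
  have hpp : 0 < Real.pi ^ 2 := by positivity
  have h5 : 2 * θ ^ 2 ≤ (1 - Real.cos θ) * Real.pi ^ 2 := by
    rw [div_mul_eq_mul_div, div_le_iff₀ hpp] at h4
    exact h4
  have h6 := Real.cos_le_one θ
  nlinarith

/-- A Lipschitz function on the sphere is approximated by polynomials of degree at most `m` with
error of order `1 / m`. -/
theorem exists_polynomial_approx {n : ℕ} (hn : 2 ≤ n) {m : ℕ} (hm : 0 < m) {f : C(Sph n, ℝ)}
    {κ : ℝ} (hκ : 0 ≤ κ) (hf : IsGeodesicLipschitz κ f) :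
    ∃ p : MvPolynomial (Fin n) ℝ, p.totalDegree ≤ m ∧
      ∀ x, |f x - restrict n p x| ≤ 6 * ((n : ℝ) + 1) * κ / m := by
  -- The squared kernel has degree at most 2(k - 1) ≤ m, while m ≤ 2k converts the rate 1/k into
  -- 1/m.
  set k := m / 2 + 1 with hk
  set B := ∑ j ∈ Finset.range k, ((k : ℝ) - j) ^ 2 * dimDensity n j with hB
  set S := ∑ j ∈ Finset.range k, dimDensity n j with hS
  have hSpos : 0 < S := Finset.sum_pos (fun j _ => dimDensity_pos hn j) ⟨0, by simp [hk]⟩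
  have hSB : (k : ℝ) ^ 2 * S ≤ (n + 1) ^ 2 * B := sq_mul_sum_dimDensity_le hn (by omega)
  have hkpos : (0 : ℝ) < k := by positivity
  have hBpos : 0 < B := by
    have : 0 < ((n : ℝ) + 1) ^ 2 * B := lt_of_lt_of_le (by positivity) hSB
    exact pos_of_mul_pos_right this (by positivity)
  set P : Polynomial ℝ := Polynomial.C (1 / B) * fejerPoly n k ^ 2 with hPdef
  have hPdeg : P.natDegree ≤ m := by
    refine (Polynomial.natDegree_C_mul_le _ _).trans (Polynomial.natDegree_pow_le.trans ?_)
    have := natDegree_fejerPoly_le n k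
    omega
  obtain ⟨p, hp, hpx⟩ := exists_polynomial_integral_zonalFun hPdeg f
  refine ⟨p, hp, fun x => ?_⟩
  have hPx : ∀ z, zonalFun P x z = 1 / B * zonalFun (fejerPoly n k) x z ^ 2 := by
    intro z
    simp [zonalFun_apply, hPdef]
  have hPnn : ∀ z, 0 ≤ zonalFun P x z := fun z => by
    rw [hPx]
    positivity
  have hint1 : ∫ z, zonalFun P x z ∂(sphMeasure n) = 1 := by
    simp only [hPx]
    rw [integral_const_mul, integral_fejerPoly_sq hn, ← hB]
    field_simp
  have hint2 : ∫ z : Sph n, (1 - ∑ j, x.1 j * z.1 j) * zonalFun P x z ∂(sphMeasure n) ≤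
      (n + 1) ^ 2 / k ^ 2 := by
    have e : ∀ z : Sph n, (1 - ∑ j, x.1 j * z.1 j) * zonalFun P x z =
        1 / B * ((1 - ∑ j, x.1 j * z.1 j) * zonalFun (fejerPoly n k) x z ^ 2) := fun z => by
      rw [hPx]
      ring
    simp only [e]
    rw [integral_const_mul]
    calc _ ≤ 1 / B * S := by
          gcongr
          exact integral_one_sub_mul_fejerPoly_sq_le hn k x
      _ ≤ _ := by
          rw [one_div_mul_eq_div, div_le_div_iff₀ hBpos (by positivity)]
          linarith
  -- The final bound is κ (c/2 + 5/(2c) · (n + 1)²/k²), minimal at c = √5 (n + 1)/k. The factor 3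
  -- replaces √5 by an integer and leaves 7/9 of κ c.
  set c : ℝ := 3 * (n + 1) / k with hc
  have hcpos : 0 < c := by positivity
  have hi0 := integrable_sphere (zonalFun P x)
  have hi1 : Integrable (fun z : Sph n => (1 - ∑ j, x.1 j * z.1 j) * zonalFun P x z)
      (sphMeasure n) := by
    refine (integrable_sphere (zonalFun ((1 - Polynomial.X) * P) x)).congr
      (Filter.Eventually.of_forall fun z => ?_)
    simp [zonalFun_apply]
  have hpt : ∀ z : Sph n, |(f x - f z) * zonalFun P x z| ≤
      κ * (c / 2) * zonalFun P x z +
        κ * (5 / (2 * c)) * ((1 - ∑ j, x.1 j * z.1 j) * zonalFun P x z) := by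
    intro z
    rw [abs_mul, abs_of_nonneg (hPnn z)]
    have h1 := hf x z
    have h2 := sq_angle_le x z
    set θ := InnerProductGeometry.angle x.1 z.1
    -- Linearising the angle in θ² lets the mean of 1 - cos θ be used directly.
    have h3 : θ ≤ c / 2 + θ ^ 2 / (2 * c) := by
      rw [← sub_nonneg]
      have : c / 2 + θ ^ 2 / (2 * c) - θ = (c - θ) ^ 2 / (2 * c) := by
        field_simp
        ring
      rw [this]
      positivity
    have h4 : θ ^ 2 / (2 * c) ≤ 5 / (2 * c) * (1 - ∑ j, x.1 j * z.1 j) := by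
      rw [div_mul_eq_mul_div]
      gcongr
    calc |f x - f z| * zonalFun P x z ≤
          (κ * (c / 2 + 5 / (2 * c) * (1 - ∑ j, x.1 j * z.1 j))) * zonalFun P x z := by
          refine mul_le_mul_of_nonneg_right (h1.trans ?_) (hPnn z)
          exact mul_le_mul_of_nonneg_left (by linarith) hκ
      _ = _ := by ring
  have hdiff : f x - restrict n p x = ∫ z, (f x - f z) * zonalFun P x z ∂(sphMeasure n) := by
    simp only [sub_mul]
    rw [integral_sub (hi0.const_mul _) (integrable_sphere_mul _ _),
      integral_const_mul, hint1, hpx, mul_one]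
  have hid : Integrable (fun z => (f x - f z) * zonalFun P x z) (sphMeasure n) :=
    integrable_sphere ((ContinuousMap.const _ (f x) - f) * zonalFun P x)
  rw [hdiff]
  calc |∫ z, (f x - f z) * zonalFun P x z ∂(sphMeasure n)|
      ≤ ∫ z, |(f x - f z) * zonalFun P x z| ∂(sphMeasure n) := abs_integral_le_integral_abs
    _ ≤ ∫ z : Sph n, (κ * (c / 2) * zonalFun P x z + κ * (5 / (2 * c)) *
          ((1 - ∑ j, x.1 j * z.1 j) * zonalFun P x z)) ∂(sphMeasure n) :=
        integral_mono hid.abs ((hi0.const_mul _).add (hi1.const_mul _)) hpt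
    _ = κ * (c / 2) + κ * (5 / (2 * c)) *
          ∫ z : Sph n, (1 - ∑ j, x.1 j * z.1 j) * zonalFun P x z ∂(sphMeasure n) := by
        rw [integral_add (hi0.const_mul _) (hi1.const_mul _), integral_const_mul,
          integral_const_mul, hint1, mul_one]
    _ ≤ κ * (c / 2) + κ * (5 / (2 * c)) * ((n + 1) ^ 2 / k ^ 2) := by gcongr
    _ ≤ κ * c := by
        have : ((n : ℝ) + 1) ^ 2 / k ^ 2 = c ^ 2 / 9 := by
          rw [hc]
          field_simp
          norm_num
        rw [this]
        have e : κ * (c / 2) + κ * (5 / (2 * c)) * (c ^ 2 / 9) = κ * c * (7 / 9) := by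
          field_simp
          ring
        rw [e]
        nlinarith [mul_nonneg hκ hcpos.le]
    _ ≤ 6 * ((n : ℝ) + 1) * κ / m := by
        have hmk : (m : ℝ) ≤ 2 * k := by exact_mod_cast (by omega : m ≤ 2 * k)
        have hm0 : (0 : ℝ) < m := by exact_mod_cast hm
        rw [hc, mul_div_assoc', div_le_div_iff₀ hkpos hm0]
        nlinarith [mul_nonneg hκ (by positivity : (0 : ℝ) ≤ (n : ℝ) + 1)]

theorem norm_harmonicApprox_sub_lt {n : ℕ} (hn : 2 ≤ n) {d m : ℕ} (hm : 0 < m)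
    {Q : QuadratureRule n} (hQ1 : Q.IsExact (d + m)) (hQ2 : Q.IsExact (2 * d)) {f : C(Sph n, ℝ)}
    {κ ε : ℝ} (hκ : 0 ≤ κ) (hε : 0 < ε) (hf : IsGeodesicLipschitz κ f)
    (h : 24 * ((n : ℝ) + 1) * κ * √(dimHarm n d) / ε ≤ m) :
    ‖restrict n (harmonicApprox Q d f) - harmonicComponent n d f‖ < ε := by
  obtain ⟨p, hp, hfp⟩ := exists_polynomial_approx hn hm hκ hf
  refine (ContinuousMap.norm_lt_iff _ hε).2 fun x => ?_
  rw [ContinuousMap.sub_apply, Real.norm_eq_abs]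
  refine (abs_harmonicApprox_sub_le hn hQ1 hQ2 hp hfp x).trans_lt ?_
  have hm0 : (0 : ℝ) < m := by exact_mod_cast hm
  rw [div_le_iff₀ hε] at h
  -- The constant 24 is twice what ε needs. The slack gives the strict inequality, also for κ = 0.
  have : 2 * (6 * ((n : ℝ) + 1) * κ / m) * √(dimHarm n d) ≤ ε / 2 := by
    rw [show 2 * (6 * ((n : ℝ) + 1) * κ / m) * √(dimHarm n d) =
      12 * ((n : ℝ) + 1) * κ * √(dimHarm n d) / m by ring, div_le_iff₀ hm0]
    linarith
  linarith

/-- The dimension of the space of harmonics grows polynomially. -/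
theorem dimHarm_le {n : ℕ} (hn : 2 ≤ n) (d : ℕ) :
    (dimHarm n (d + 1) : ℝ) ≤ n * ((d : ℝ) + 1) ^ n := by
  have hM := sphMeasure_pos (n := n) (by omega)
  have hn2 : (2 : ℝ) ≤ n := by exact_mod_cast hn
  rw [dimHarm_eq hn]
  induction d with
  | zero =>
    simp only [dimDensity]
    field_simp
    simp
  | succ d ih =>
    have h1 : dimDensity n (d + 1 + 1) = dimDensity n (d + 1) *
        (((2 * (d : ℝ) + 2 + n) * ((d : ℝ) + n - 1)) / ((2 * (d : ℝ) + n) * ((d : ℝ) + 2))) := by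
      rw [dimDensity]
    have hp := legendre_denom_pos hn d
    -- The ratio of consecutive dimensions is compared with the ratio of n-th powers, by Bernoulli's
    -- inequality (1 + 1/(d + 1))^n ≥ 1 + n/(d + 1).
    have h2 : ((2 * (d : ℝ) + 2 + n) * ((d : ℝ) + n - 1)) / ((2 * (d : ℝ) + n) * ((d : ℝ) + 2)) ≤
        (((d : ℝ) + 2) / (d + 1)) ^ n := by
      have hb : ((d : ℝ) + 1 + n) / (d + 1) ≤ (((d : ℝ) + 2) / (d + 1)) ^ n := by
        have := one_add_mul_le_pow (a := 1 / ((d : ℝ) + 1))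
          (by have : (0 : ℝ) ≤ 1 / ((d : ℝ) + 1) := by positivity
              linarith) n
        convert! this using 1
        · field_simp
        · congr 1
          field_simp
          ring
      refine le_trans ?_ hb
      rw [div_le_div_iff₀ (by positivity) (by positivity)]
      have hd : (0 : ℝ) ≤ d := d.cast_nonneg
      have e1 : (2 * (d : ℝ) + 2 + n) * (d + 1) ≤ (2 * d + n) * (d + 2) := by nlinarith
      calc _ = ((d : ℝ) + n - 1) * ((2 * (d : ℝ) + 2 + n) * (d + 1)) := by ring
        _ ≤ (d + 1 + n) * ((2 * d + n) * (d + 2)) := by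
            refine mul_le_mul (by linarith) e1 (by positivity) (by positivity)
        _ = _ := by ring
    calc dimDensity n (d + 1 + 1) * (sphMeasure n).real Set.univ
        = (dimDensity n (d + 1) * (sphMeasure n).real Set.univ) *
          (((2 * (d : ℝ) + 2 + n) * ((d : ℝ) + n - 1)) /
            ((2 * (d : ℝ) + n) * ((d : ℝ) + 2))) := by rw [h1]; ring
      _ ≤ (n * ((d : ℝ) + 1) ^ n) * (((d : ℝ) + 2) / (d + 1)) ^ n := by
          refine mul_le_mul ih h2 (by positivity) (by positivity)
      _ = _ := by
          rw [div_pow]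
          field_simp
          push_cast
          ring


/-! ### Quadrature on the half circle -/

/-- The value of `∫ cos^a θ sin^b θ dθ` over `[0, π]`. -/
def betaValue (a b : ℕ) : ℝ :=
  if Even a then Real.Gamma (((a : ℝ) + 1) / 2) * Real.Gamma (((b : ℝ) + 1) / 2) /
    Real.Gamma (((a : ℝ) + b + 2) / 2) else 0

theorem integral_sin_pow_eq_betaValue (b : ℕ) :
    ∫ θ in (0 : ℝ)..Real.pi, Real.sin θ ^ b = betaValue 0 b := by
  rw [betaValue, if_pos Even.zero]
  induction b using Nat.twoStepInduction with
  | zero =>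
    norm_num [Real.Gamma_one_half_eq, Real.mul_self_sqrt Real.pi_pos.le]
  | one =>
    have h1 : Real.Gamma ((0 + 1 + 2 : ℝ) / 2) = 1 / 2 * Real.Gamma (1 / 2) := by
      rw [← Real.Gamma_add_one (by norm_num)]
      norm_num
    have h2 := (Real.Gamma_pos_of_pos (by norm_num : (0 : ℝ) < 1 / 2)).ne'
    simp only [CharP.cast_eq_zero, Nat.cast_one, h1]
    norm_num
    field_simp
  | more b h0 _ =>
    rw [integral_sin_pow, h0]
    have h1 : Real.Gamma (((b + 2 : ℕ) + 1 : ℝ) / 2) =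
        ((b : ℝ) + 1) / 2 * Real.Gamma (((b : ℝ) + 1) / 2) := by
      rw [← Real.Gamma_add_one (by positivity)]
      congr 1
      push_cast
      ring
    have h2 : Real.Gamma ((((0 : ℕ) : ℝ) + (b + 2 : ℕ) + 2) / 2) =
        ((b : ℝ) + 2) / 2 * Real.Gamma ((((0 : ℕ) : ℝ) + b + 2) / 2) := by
      have : ((((0 : ℕ) : ℝ) + b + 2) / 2) = ((b : ℝ) + 2) / 2 := by simp
      rw [this, ← Real.Gamma_add_one (by positivity)]
      congr 1
      push_cast
      ring
    rw [h1, h2]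
    have h3 : 0 < Real.Gamma ((((0 : ℕ) : ℝ) + b + 2) / 2) :=
      Real.Gamma_pos_of_pos (by positivity)
    simp only [Real.sin_zero, Real.sin_pi, zero_pow (Nat.succ_ne_zero b), zero_mul, sub_self,
      zero_div, zero_add]
    field_simp

/-- For even a, replacing cos² by 1 - sin² lowers a by two and raises b, so the induction runs over
all b at once. For odd a the integrand changes sign under θ ↦ π - θ. -/
theorem integral_cos_pow_mul_sin_pow (a b : ℕ) :
    ∫ θ in (0 : ℝ)..Real.pi, Real.cos θ ^ a * Real.sin θ ^ b = betaValue a b := by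
  rcases Nat.even_or_odd a with ha | ha
  · obtain ⟨s, rfl⟩ := ha.two_dvd
    induction s generalizing b with
    | zero => simpa using integral_sin_pow_eq_betaValue b
    | succ s ih =>
      have h1 : ∀ θ : ℝ, Real.cos θ ^ (2 * (s + 1)) * Real.sin θ ^ b =
          Real.cos θ ^ (2 * s) * Real.sin θ ^ b -
            Real.cos θ ^ (2 * s) * Real.sin θ ^ (b + 2) := by
        intro θ
        have := Real.cos_sq θ
        rw [show 2 * (s + 1) = 2 * s + 2 by ring, pow_add, pow_add, Real.cos_sq' θ]
        ring
      simp only [h1]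
      rw [intervalIntegral.integral_sub (by apply Continuous.intervalIntegrable; fun_prop)
        (by apply Continuous.intervalIntegrable; fun_prop), ih b (by simp), ih (b + 2) (by simp)]
      rw [betaValue, betaValue, betaValue, if_pos (by simp), if_pos (by simp), if_pos (by simp)]
      set x : ℝ := (((2 * s : ℕ) : ℝ) + 1) / 2 with hx
      set y : ℝ := ((b : ℝ) + 1) / 2 with hy
      have e1 : (((2 * s : ℕ) : ℝ) + b + 2) / 2 = x + y := by rw [hx, hy]; ring
      have e2 : (((b + 2 : ℕ) : ℝ) + 1) / 2 = y + 1 := by rw [hy]; push_cast; ring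
      have e3 : (((2 * s : ℕ) : ℝ) + (b + 2 : ℕ) + 2) / 2 = x + y + 1 := by
        rw [hx, hy]; push_cast; ring
      have e4 : (((2 * (s + 1) : ℕ) : ℝ) + 1) / 2 = x + 1 := by rw [hx]; push_cast; ring
      have e5 : (((2 * (s + 1) : ℕ) : ℝ) + b + 2) / 2 = x + y + 1 := by
        rw [hx, hy]; push_cast; ring
      have hxp : 0 < x := by rw [hx]; positivity
      have hyp : 0 < y := by rw [hy]; positivity
      rw [e1, e2, e3, e4, e5, Real.Gamma_add_one hxp.ne', Real.Gamma_add_one hyp.ne',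
        Real.Gamma_add_one (add_pos hxp hyp).ne']
      have := (Real.Gamma_pos_of_pos (add_pos hxp hyp)).ne'
      have := (add_pos hxp hyp).ne'
      field_simp
      ring
  · rw [betaValue, if_neg (Nat.not_even_iff_odd.2 ha)]
    have h1 := intervalIntegral.integral_comp_sub_left (a := 0) (b := Real.pi)
      (fun θ => Real.cos θ ^ a * Real.sin θ ^ b) Real.pi
    simp only [Real.cos_pi_sub, Real.sin_pi_sub, ha.neg_pow, neg_mul, sub_self, sub_zero,
      intervalIntegral.integral_neg] at h1
    linarith

/-- The `k`-th of `N` equidistant angles in `[0, π]`. -/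
def nodeAngle (N k : ℕ) : ℝ := (2 * (k : ℝ) + 1) / (2 * N) * Real.pi

theorem nodeAngle_pos {N k : ℕ} (hk : k < N) : 0 < nodeAngle N k := by
  have : (0 : ℝ) < N := by exact_mod_cast (by omega : 0 < N)
  have := Real.pi_pos
  rw [nodeAngle]
  positivity

theorem nodeAngle_lt_pi {N k : ℕ} (hk : k < N) : nodeAngle N k < Real.pi := by
  have h0 : (0 : ℝ) < N := by exact_mod_cast (by omega : 0 < N)
  have h1 : (k : ℝ) + 1 ≤ N := by exact_mod_cast hk
  have h2 : (2 * (k : ℝ) + 1) / (2 * N) < 1 := by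
    rw [div_lt_one (by positivity)]
    linarith
  calc nodeAngle N k < 1 * Real.pi := mul_lt_mul_of_pos_right h2 Real.pi_pos
    _ = _ := one_mul _

theorem cos_nodeAngle_injOn (N : ℕ) {k l : ℕ} (hk : k < N) (hl : l < N)
    (h : Real.cos (nodeAngle N k) = Real.cos (nodeAngle N l)) : k = l := by
  have h1 := Real.injOn_cos ⟨(nodeAngle_pos hk).le, (nodeAngle_lt_pi hk).le⟩
    ⟨(nodeAngle_pos hl).le, (nodeAngle_lt_pi hl).le⟩ h
  have h0 : (0 : ℝ) < N := by exact_mod_cast (by omega : 0 < N)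
  rw [nodeAngle, nodeAngle] at h1
  have h2 := mul_right_cancel₀ Real.pi_pos.ne' h1
  rw [div_left_inj' (by positivity)] at h2
  have : (k : ℝ) = l := by linarith
  exact_mod_cast this

-- Gauss–Chebyshev quadrature: the nodes are the zeros of T_N, whence exactness up to degree 2N - 1.
open Polynomial.Chebyshev in
theorem sum_nodeAngle {N : ℕ} {p : Polynomial ℝ} (hp : p.natDegree < 2 * N) :
    ∑ k ∈ Finset.range N, Real.pi / N * p.eval (Real.cos (nodeAngle N k)) =
      ∫ x, p.eval x ∂measureT := by
  have hN : N ≠ 0 := by omega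
  rw [integral_eq_sumZeroes hN, sumZeroes, Finset.mul_sum]
  · rfl
  · refine Polynomial.degree_le_natDegree.trans_lt ?_
    exact_mod_cast hp

/-- A partial Fourier sum of `(π / 2) sin θ`, as a polynomial in `cos θ`. -/
def sinePoly (J : ℕ) : Polynomial ℝ :=
  1 - ∑ j ∈ Finset.range J, Polynomial.C (2 / (4 * ((j : ℝ) + 1) ^ 2 - 1)) *
    Polynomial.Chebyshev.T ℝ (2 * (j + 1) : ℕ)

theorem natDegree_sinePoly_le (J : ℕ) : (sinePoly J).natDegree ≤ 2 * J := by
  refine (Polynomial.natDegree_sub_le _ _).trans (max_le (by simp) ?_)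
  refine Polynomial.natDegree_sum_le_of_forall_le _ _ fun j hj => ?_
  refine (Polynomial.natDegree_C_mul_le _ _).trans ?_
  have := Finset.mem_range.1 hj
  rw [Polynomial.Chebyshev.natDegree_T]
  simp only [Int.natAbs_natCast]
  omega

theorem eval_sinePoly_cos (J : ℕ) (θ : ℝ) : (sinePoly J).eval (Real.cos θ) =
    1 - ∑ j ∈ Finset.range J, 2 / (4 * ((j : ℝ) + 1) ^ 2 - 1) *
      Real.cos (2 * ((j : ℝ) + 1) * θ) := by
  simp only [sinePoly, Polynomial.eval_sub, Polynomial.eval_one, Polynomial.eval_finsetSum,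
    Polynomial.eval_mul, Polynomial.eval_C, Polynomial.Chebyshev.T_real_cos]
  push_cast
  rfl

theorem four_mul_sq_sub_one_pos (j : ℕ) : (0 : ℝ) < 4 * ((j : ℝ) + 1) ^ 2 - 1 := by
  have : (0 : ℝ) ≤ j := j.cast_nonneg
  nlinarith

/-- All cosines are at most 1, so the value is at least that at θ = 0, where 2/(4j² - 1) = 1/(2j -
1) - 1/(2j + 1) telescopes to 1/(2J + 1). This keeps the quadrature weights positive in spite of the
truncation. -/
theorem eval_sinePoly_cos_pos (J : ℕ) (θ : ℝ) : 0 < (sinePoly J).eval (Real.cos θ) := by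
  have h1 : ∀ J : ℕ, 1 - ∑ j ∈ Finset.range J, 2 / (4 * ((j : ℝ) + 1) ^ 2 - 1) =
      1 / (2 * (J : ℝ) + 1) := by
    intro J
    induction J with
    | zero => simp
    | succ J ih =>
      have h := (four_mul_sq_sub_one_pos J).ne'
      rw [Finset.sum_range_succ, ← sub_sub, ih]
      push_cast
      have e : 4 * ((J : ℝ) + 1) ^ 2 - 1 = (2 * J + 1) * (2 * (J + 1) + 1) := by ring
      rw [e]
      field_simp
      ring
  rw [eval_sinePoly_cos]
  have h2 : (0 : ℝ) < 1 / (2 * (J : ℝ) + 1) := by positivity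
  rw [← h1] at h2
  refine h2.trans_le (sub_le_sub_left (Finset.sum_le_sum fun j _ => ?_) _)
  have := four_mul_sq_sub_one_pos j
  calc _ ≤ 2 / (4 * ((j : ℝ) + 1) ^ 2 - 1) * 1 := by
        gcongr
        exact Real.cos_le_one _
    _ = _ := mul_one _

theorem integral_cos_mul_sin (l : ℕ) :
    ∫ θ in (0 : ℝ)..Real.pi, Real.cos (l * θ) * Real.sin θ =
      if Even l then 2 / (1 - (l : ℝ) ^ 2) else 0 := by
  have h1 : ∀ θ ∈ Set.uIcc 0 Real.pi, HasDerivAt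
      (fun θ => Real.cos θ * Real.cos (l * θ) + l * (Real.sin θ * Real.sin (l * θ)))
      (((l : ℝ) ^ 2 - 1) * (Real.cos (l * θ) * Real.sin θ)) θ := by
    intro θ _
    have hl : HasDerivAt (fun θ : ℝ => (l : ℝ) * θ) l θ := by
      simpa using (hasDerivAt_id θ).const_mul (l : ℝ)
    have := ((Real.hasDerivAt_cos θ).mul hl.cos).add
      (((Real.hasDerivAt_sin θ).mul hl.sin).const_mul (l : ℝ))
    refine this.congr_deriv ?_
    ring
  have h2 := intervalIntegral.integral_eq_sub_of_hasDerivAt h1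
    (by apply Continuous.intervalIntegrable; fun_prop)
  rw [intervalIntegral.integral_const_mul] at h2
  simp only [Real.cos_pi, Real.cos_nat_mul_pi, Real.sin_pi, Real.sin_zero, Real.cos_zero, mul_zero,
    zero_mul, add_zero] at h2
  split_ifs with h
  · rw [h.neg_one_pow] at h2
    have hne : (l : ℝ) ^ 2 - 1 ≠ 0 := by
      intro h0
      have h3 : l ^ 2 = 1 := by
        have : (l : ℝ) ^ 2 = 1 := by linarith
        exact_mod_cast this
      have : l = 1 := by simpa using h3
      subst this
      exact absurd h (by decide)
    have hne' : 1 - (l : ℝ) ^ 2 ≠ 0 := fun h0 => hne (by linarith)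
    rw [eq_div_iff hne']
    linarith
  · have ho := Nat.not_even_iff_odd.1 h
    -- The antiderivative carries the factor l² - 1 and says nothing for l = 1; there the integrand
    -- is cos θ sin θ.
    by_cases hl : l = 1
    · subst hl
      have := integral_cos_pow_mul_sin_pow 1 1
      rw [betaValue, if_neg (by decide)] at this
      simpa using this
    · rw [ho.neg_one_pow] at h2
      have hne : (l : ℝ) ^ 2 - 1 ≠ 0 := by
        intro h0
        have h3 : l ^ 2 = 1 := by
          have : (l : ℝ) ^ 2 = 1 := by linarith
          exact_mod_cast this
        exact hl (by simpa using h3)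
      refine (mul_eq_zero.1 (h2.trans ?_)).resolve_left hne
      norm_num

open Polynomial.Chebyshev in
theorem integral_T_measureT (k : ℤ) :
    ∫ x, (T ℝ k).eval x ∂measureT = if k = 0 then Real.pi else 0 := by
  split_ifs with h
  · rw [h, integral_eval_T_real_measureT_zero]
  · exact integral_eval_T_real_measureT_of_ne_zero h

-- Orthogonality of the Chebyshev polynomials picks out the term of frequency l. For l ≤ 2J the
-- truncation has not removed it, so the result is the true Fourier coefficient of the sine; for odd
-- l both sides vanish.
open Polynomial.Chebyshev in
theorem integral_T_mul_sinePoly {l J : ℕ} (hl : l ≤ 2 * J) :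
    2 / Real.pi * ∫ x, (T ℝ l * sinePoly J).eval x ∂measureT =
      ∫ θ in (0 : ℝ)..Real.pi, (T ℝ l).eval (Real.cos θ) * Real.sin θ := by
  have h0 : ∀ q : Polynomial ℝ, Integrable (fun x => q.eval x) measureT := fun q =>
    integrable_measureT (by fun_prop)
  have h1 : ∀ x, (T ℝ l * sinePoly J).eval x = (T ℝ l).eval x -
      ∑ j ∈ Finset.range J, 2 / (4 * ((j : ℝ) + 1) ^ 2 - 1) *
        ((T ℝ l).eval x * (T ℝ (2 * (j + 1) : ℕ)).eval x) := by
    intro x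
    simp only [sinePoly, Polynomial.eval_mul, Polynomial.eval_sub,
      Polynomial.eval_finsetSum, Polynomial.eval_C, mul_sub, mul_one, Finset.mul_sum]
    congr 1
    exact Finset.sum_congr rfl fun j _ => by ring
  have h2 : ∀ j : ℕ, Integrable (fun x => 2 / (4 * ((j : ℝ) + 1) ^ 2 - 1) *
        ((T ℝ l).eval x * (T ℝ (2 * (j + 1) : ℕ)).eval x)) measureT := fun j => by
    refine Integrable.const_mul ?_ _
    simpa only [Polynomial.eval_mul] using h0 (T ℝ l * T ℝ (2 * (j + 1) : ℕ))
  simp only [h1]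
  rw [integral_sub (h0 _) (integrable_finsetSum _ fun j _ => h2 j),
    integral_finsetSum _ fun j _ => h2 j]
  simp only [integral_const_mul, integral_eval_T_real_mul_eval_T_real_measureT,
    integral_T_measureT, T_real_cos]
  have h3 := integral_cos_mul_sin l
  push_cast at h3 ⊢
  rw [h3]
  have hpi := Real.pi_pos.ne'
  have h4 : ∀ j : ℕ, ((l : ℤ) + 2 * ((j : ℤ) + 1) = 0) ↔ False := fun j => by
    constructor
    · intro h
      omega
    · exact False.elim
  have h5 : ∀ j : ℕ, ((l : ℤ) - 2 * ((j : ℤ) + 1) = 0) ↔ l = 2 * (j + 1) := fun j => by omega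
  have h7 : (l : ℤ) = 0 ↔ l = 0 := Int.natCast_eq_zero
  simp only [h4, h5, h7, if_false, zero_add]
  rcases Nat.even_or_odd' l with ⟨s, rfl | rfl⟩
  · rcases s with _ | s
    · simp
    · have h6 : ∀ j : ℕ, (2 * (s + 1) = 2 * (j + 1)) ↔ s = j := fun j => by omega
      have hs : s < J := by omega
      simp only [h6, ite_div, zero_div, mul_ite, mul_zero, Finset.sum_ite_eq, Finset.mem_range,
        hs, if_true]
      have hne := (four_mul_sq_sub_one_pos s).ne'
      have hne' : 1 - (2 * ((s : ℝ) + 1)) ^ 2 ≠ 0 := by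
        intro h
        apply hne
        linarith
      rw [if_neg (by omega), if_pos (by simp)]
      push_cast
      have e : 1 - (2 * ((s : ℝ) + 1)) ^ 2 = -(4 * ((s : ℝ) + 1) ^ 2 - 1) := by ring
      rw [e]
      field_simp
      ring
  · rw [if_neg (by omega), if_neg (by simp)]
    rw [Finset.sum_eq_zero]
    · simp
    · intro j _
      rw [if_neg (by omega)]
      simp

-- By linearity from T_0, …, T_{2J}, which span the polynomials of degree at most 2J.
open Polynomial.Chebyshev in
theorem integral_mul_sinePoly {J : ℕ} {p : Polynomial ℝ} (hp : p.natDegree ≤ 2 * J) :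
    2 / Real.pi * ∫ x, (p * sinePoly J).eval x ∂measureT =
      ∫ θ in (0 : ℝ)..Real.pi, p.eval (Real.cos θ) * Real.sin θ := by
  have hmem : p ∈ Polynomial.degreeLT ℝ (2 * J + 1) := by
    rw [Polynomial.mem_degreeLT]
    refine Polynomial.degree_le_natDegree.trans_lt ?_
    exact_mod_cast Nat.lt_succ_of_le hp
  rw [← Polynomial.Sequence.span_degreeLT (chebyshevTsequence ℝ) (by simp),
    show Set.Iio (2 * J + 1) = Finset.range (2 * J + 1) by simp,
    Submodule.mem_span_image_finset_iff_exists_fun'] at hmem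
  obtain ⟨c, rfl⟩ := hmem
  have h0 : ∀ q : Polynomial ℝ, Integrable (fun x => q.eval x) measureT := fun q =>
    integrable_measureT (by fun_prop)
  have e1 : ∀ x, ((∑ i ∈ Finset.range (2 * J + 1), c i • chebyshevTsequence ℝ i) *
      sinePoly J).eval x =
      ∑ i ∈ Finset.range (2 * J + 1), c i * (T ℝ i * sinePoly J).eval x := by
    intro x
    simp only [Finset.sum_mul, Polynomial.eval_finsetSum, chebyshevTsequence, smul_mul_assoc,
      Polynomial.eval_smul, smul_eq_mul]
  have e2 : ∀ θ, (∑ i ∈ Finset.range (2 * J + 1), c i • chebyshevTsequence ℝ i).eval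
      (Real.cos θ) * Real.sin θ =
      ∑ i ∈ Finset.range (2 * J + 1), c i * ((T ℝ i).eval (Real.cos θ) * Real.sin θ) := by
    intro θ
    simp only [Polynomial.eval_finsetSum, chebyshevTsequence, Finset.sum_mul,
      Polynomial.eval_smul, smul_eq_mul, mul_assoc]
  simp only [e1, e2]
  rw [integral_finsetSum _ fun i _ => (h0 _).const_mul _,
    intervalIntegral.integral_finsetSum fun i _ => by
      apply Continuous.intervalIntegrable; fun_prop,
    Finset.mul_sum]
  refine Finset.sum_congr rfl fun i hi => ?_
  rw [integral_const_mul, intervalIntegral.integral_const_mul,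
    ← integral_T_mul_sinePoly (J := J) (by have := Finset.mem_range.1 hi; omega)]
  ring

/-- Quadrature weights at the equidistant angles for the measures `sin^b θ dθ` on `[0, π]`. -/
def angleWeight (N J : ℕ) : ℕ → ℕ → ℝ
  | 0, _ => Real.pi / N
  | 1, k => 2 / N * (sinePoly J).eval (Real.cos (nodeAngle N k))
  | b + 2, k => angleWeight N J b k * Real.sin (nodeAngle N k) * Real.sin (nodeAngle N k)

theorem angleWeight_pos {N J : ℕ} (b : ℕ) {k : ℕ} (hk : k < N) : 0 < angleWeight N J b k := by
  have h0 : (0 : ℝ) < N := by exact_mod_cast (by omega : 0 < N)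
  have hs := Real.sin_pos_of_pos_of_lt_pi (nodeAngle_pos hk) (nodeAngle_lt_pi hk)
  have hpi := Real.pi_pos
  induction b using Nat.twoStepInduction with
  | zero => simp only [angleWeight]; positivity
  | one =>
    simp only [angleWeight]
    have := eval_sinePoly_cos_pos J (nodeAngle N k)
    positivity
  | more b h0 _ => rw [angleWeight]; positivity

theorem angleWeight_two_mul_add (N J s r k : ℕ) : angleWeight N J (2 * s + r) k =
    angleWeight N J r k * (1 - Real.cos (nodeAngle N k) ^ 2) ^ s := by
  induction s with
  | zero => simp
  | succ s ih =>
    rw [show 2 * (s + 1) + r = (2 * s + r) + 2 by ring, angleWeight, ih,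
      pow_succ _ s, ← Real.sin_sq]
    ring

/-- The weights for one power of the sine also serve when the integrand itself contains an even
power. In the product rule such powers come from the coordinates y sin θ. -/
theorem angleWeight_add_even (N J M b k : ℕ) (hb : Even b) : angleWeight N J (M + b) k =
    angleWeight N J M k * Real.sin (nodeAngle N k) ^ b := by
  obtain ⟨s, rfl⟩ := hb.two_dvd
  rw [add_comm, angleWeight_two_mul_add, pow_mul, Real.sin_sq]

theorem natDegree_X_pow_mul_le (a s : ℕ) :
    (Polynomial.X ^ a * (1 - Polynomial.X ^ 2) ^ s : Polynomial ℝ).natDegree ≤ a + 2 * s := by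
  refine Polynomial.natDegree_mul_le.trans ?_
  refine add_le_add (by simp) ?_
  refine Polynomial.natDegree_pow_le.trans ?_
  rw [mul_comm]
  gcongr
  refine (Polynomial.natDegree_sub_le _ _).trans ?_
  simp

/-- For even b, sin^b θ is a polynomial in cos θ. For odd b the extra sine is represented by
`sinePoly J`, which raises the degree to at most 4J; this is still below 2N, the range of
Gauss–Chebyshev quadrature. -/
theorem sum_angleWeight {N J a b : ℕ} (hN : 2 * J < N) (hab : a + b ≤ 2 * J) :
    ∑ k ∈ Finset.range N, angleWeight N J b k * Real.cos (nodeAngle N k) ^ a =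
      betaValue a b := by
  rw [← integral_cos_pow_mul_sin_pow]
  set r := b % 2 with hr
  set s := b / 2 with hs
  have hb : b = 2 * s + r := by omega
  have hr2 : r = 0 ∨ r = 1 := by omega
  set p : Polynomial ℝ := Polynomial.X ^ a * (1 - Polynomial.X ^ 2) ^ s with hp
  have hpe : ∀ t : ℝ, p.eval t = t ^ a * (1 - t ^ 2) ^ s := fun t => by simp [hp]
  have hpd : p.natDegree ≤ a + 2 * s := natDegree_X_pow_mul_le a s
  rw [hb]
  rcases hr2 with h | h
  · rw [h] at hb ⊢
    have h1 := sum_nodeAngle (N := N) (p := p) (by omega)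
    rw [Polynomial.Chebyshev.integral_measureT_eq_integral_cos] at h1
    simp only [angleWeight_two_mul_add, angleWeight]
    convert! h1 using 1
    · exact Finset.sum_congr rfl fun k _ => by rw [hpe]; ring
    · congr 1
      ext θ
      rw [hpe, add_zero, pow_mul, Real.sin_sq]
  · rw [h] at hb ⊢
    have hd : (p * sinePoly J).natDegree < 2 * N := by
      have := Polynomial.natDegree_mul_le (p := p) (q := sinePoly J)
      have := natDegree_sinePoly_le J
      omega
    have h1 := sum_nodeAngle hd
    have h2 := integral_mul_sinePoly (J := J) (p := p) (by omega)
    rw [← h1, Finset.mul_sum] at h2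
    simp only [angleWeight_two_mul_add, angleWeight]
    convert! h2 using 1
    · refine Finset.sum_congr rfl fun k _ => ?_
      have := Real.pi_pos.ne'
      rw [Polynomial.eval_mul, hpe]
      field_simp
    · congr 1
      ext θ
      rw [hpe, pow_succ, pow_mul, Real.sin_sq]
      ring


/-! ### Product quadrature on the sphere -/

/-- The number of nodes of the product rule in dimension `L + 1`. -/
def nodeCount (N : ℕ) : ℕ → ℕ
  | 0 => 2
  | L + 1 => nodeCount N L * N

/-- The `j`-th coordinate of the `v`-th node of the product rule in dimension `L + 1`. -/
def nodeCoord (N : ℕ) : ℕ → ℕ → ℕ → ℝ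
  | 0, v, _ => if v = 0 then 1 else -1
  | _ + 1, v, 0 => Real.cos (nodeAngle N (v % N))
  | L + 1, v, j + 1 => nodeCoord N L (v / N) j * Real.sin (nodeAngle N (v % N))

/-- The weight of the `v`-th node of the product rule in dimension `L + 1`. -/
def nodeWeight (N J : ℕ) : ℕ → ℕ → ℝ
  | 0, _ => 1
  | L + 1, v => nodeWeight N J L (v / N) * angleWeight N J L (v % N)

theorem sum_range_mul_div_mod (M : ℕ) {N : ℕ} (hN : 0 < N) (g : ℕ → ℕ → ℝ) :
    ∑ v ∈ Finset.range (M * N), g (v / N) (v % N) =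
      ∑ u ∈ Finset.range M, ∑ k ∈ Finset.range N, g u k := by
  induction M with
  | zero => simp
  | succ M ih =>
    rw [Nat.succ_mul, Finset.sum_range_add, ih, Finset.sum_range_succ]
    congr 1
    refine Finset.sum_congr rfl fun k hk => ?_
    have hk' := Finset.mem_range.1 hk
    rw [mul_comm M N, Nat.mul_add_div hN, Nat.div_eq_of_lt hk', add_zero, Nat.mul_add_mod,
      Nat.mod_eq_of_lt hk']

/-- The coordinates (cos θ, y sin θ) at the level of moments: the Γ factor of the sine exponent L +
∑ β in `betaValue` is the denominator of the lower moment and cancels. -/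
theorem moment_cons (L a : ℕ) (β : Fin (L + 1) → ℕ) :
    moment (L + 2) (Fin.cons a β) = moment (L + 1) β * betaValue a (L + ∑ i, β i) := by
  rw [moment, moment, betaValue]
  by_cases ha : Even a
  · by_cases hb : ∀ i, Even (β i)
    · rw [if_pos (Fin.cases ha hb), if_pos hb, if_pos ha, Fin.prod_univ_succ, Fin.sum_univ_succ]
      simp only [Fin.cons_zero, Fin.cons_succ]
      have e1 : (((L + ∑ i, β i : ℕ) : ℝ) + 1) / 2 = (((L + 1 : ℕ) : ℝ) + ∑ i, (β i : ℝ)) / 2 := by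
        push_cast
        ring
      have e2 : ((a : ℝ) + ((L + ∑ i, β i : ℕ) : ℝ) + 2) / 2 =
          (((L + 2 : ℕ) : ℝ) + ((a : ℝ) + ∑ i, (β i : ℝ))) / 2 := by
        push_cast
        ring
      rw [e1, e2]
      have : 0 < Real.Gamma ((((L + 1 : ℕ) : ℝ) + ∑ i, (β i : ℝ)) / 2) :=
        Real.Gamma_pos_of_pos (by positivity)
      field_simp
    · rw [if_neg fun h => hb fun i => by simpa using h i.succ, if_neg hb, zero_mul]
  · rw [if_neg fun h => ha (by simpa using h 0), if_neg ha, mul_zero]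

/-- The sum over nodes factors into a lower-dimensional sum and an angular one, as the moment does
in `moment_cons`. The term L in the degree condition accounts for the powers of the sine in the
spherical measure; the induction starts at the two points ±1 with weight 1. -/
theorem sum_nodeWeight_mul_prod {N J : ℕ} (hN : 2 * J < N) (L : ℕ) :
    ∀ α : Fin (L + 1) → ℕ, ∑ i, α i + L ≤ 2 * J →
      ∑ v ∈ Finset.range (nodeCount N L),
        nodeWeight N J L v * ∏ j : Fin (L + 1), nodeCoord N L v j ^ α j = moment (L + 1) α := by
  induction L with
  | zero =>
    have hz : ∀ α : Fin 1 → ℕ, ∑ v ∈ Finset.range (nodeCount N 0),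
        nodeWeight N J 0 v * ∏ j : Fin 1, nodeCoord N 0 v j ^ α j = moment 1 α := by
      intro α
      simp only [nodeCount, Finset.sum_range_succ, Finset.sum_range_zero, nodeWeight, nodeCoord,
        moment, zero_add, Finset.univ_unique, Fin.default_eq_zero, Finset.prod_singleton,
        Finset.sum_singleton, Fin.forall_fin_one, one_mul, if_true, one_pow, one_ne_zero, if_false]
      split_ifs with h
      · have h1 : 0 < Real.Gamma (((α 0 : ℝ) + 1) / 2) := Real.Gamma_pos_of_pos (by positivity)
        rw [h.neg_one_pow]
        push_cast
        rw [add_comm (1 : ℝ) (α 0 : ℝ)]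
        field_simp
        norm_num
      · rw [(Nat.not_even_iff_odd.1 h).neg_one_pow]
        norm_num
    exact fun α _ => hz α
  | succ L ih =>
    intro α hα
    obtain ⟨a, β, rfl⟩ : ∃ a β, α = Fin.cons a β := ⟨α 0, Fin.tail α, (Fin.cons_self_tail α).symm⟩
    rw [Fin.sum_univ_succ] at hα
    simp only [Fin.cons_zero, Fin.cons_succ] at hα
    obtain ⟨g, hg⟩ : ∃ g : ℕ → ℕ → ℝ, g = fun u k =>
        (nodeWeight N J L u * ∏ j : Fin (L + 1), nodeCoord N L u j ^ β j) *
          (angleWeight N J L k * Real.sin (nodeAngle N k) ^ (∑ i, β i) *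
            Real.cos (nodeAngle N k) ^ a) := ⟨_, rfl⟩
    have h1 : ∀ v, nodeWeight N J (L + 1) v * ∏ j : Fin (L + 1 + 1),
        nodeCoord N (L + 1) v j ^ (Fin.cons a β : Fin (L + 1 + 1) → ℕ) j = g (v / N) (v % N) := by
      intro v
      rw [Fin.prod_univ_succ, hg]
      simp only [Fin.cons_zero, Fin.cons_succ, nodeWeight, Fin.val_zero, Fin.val_succ, nodeCoord,
        mul_pow, Finset.prod_mul_distrib, Finset.prod_pow_eq_pow_sum]
      ring
    rw [Finset.sum_congr rfl fun v _ => h1 v, nodeCount, sum_range_mul_div_mod _ (by omega),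
      moment_cons, hg]
    simp only [← Finset.mul_sum, ← Finset.sum_mul]
    rw [ih β (by omega)]
    -- With an odd exponent in β the inner moment is zero, so the angular sum, whose sine power may
    -- then be odd, need not be known.
    by_cases hb : ∀ i, Even (β i)
    · congr 1
      rw [← sum_angleWeight hN (by omega)]
      have hs : Even (∑ i, β i) := Finset.even_sum _ fun i _ => hb i
      exact Finset.sum_congr rfl fun k _ => by rw [angleWeight_add_even _ _ _ _ _ hs]
    · rw [moment, if_neg hb, zero_mul, zero_mul]

theorem sum_nodeCoord_sq (N : ℕ) (L v : ℕ) : ∑ j : Fin (L + 1), nodeCoord N L v j ^ 2 = 1 := by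
  induction L generalizing v with
  | zero =>
    simp only [nodeCoord]
    split_ifs <;> norm_num
  | succ L ih =>
    rw [Fin.sum_univ_succ]
    simp only [Fin.val_zero, Fin.val_succ, nodeCoord, mul_pow, ← Finset.sum_mul, ih, one_mul]
    exact Real.cos_sq_add_sin_sq _

/-- The first coordinate determines the angle, since cos is injective on [0, π]. All angles are
interior, so the sine is nonzero and can be cancelled from the other coordinates. -/
theorem nodeCoord_injOn {N : ℕ} (L : ℕ) {v w : ℕ} (hv : v < nodeCount N L)
    (hw : w < nodeCount N L) (h : ∀ j ≤ L, nodeCoord N L v j = nodeCoord N L w j) : v = w := by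
  induction L generalizing v w with
  | zero =>
    have h0 := h 0 le_rfl
    simp only [nodeCount] at hv hw
    simp only [nodeCoord] at h0
    by_cases hv0 : v = 0 <;> by_cases hw0 : w = 0 <;> simp only [hv0, hw0, if_true, if_false] at h0
    · omega
    · norm_num at h0
    · norm_num at h0
    · omega
  | succ L ih =>
    rw [nodeCount] at hv hw
    have hN : 0 < N := Nat.pos_of_ne_zero fun h0 => by simp [h0] at hv
    have h0 : v % N = w % N := cos_nodeAngle_injOn N (Nat.mod_lt _ hN) (Nat.mod_lt _ hN)
      (by simpa [nodeCoord] using h 0 (Nat.zero_le _))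
    have hs := (Real.sin_pos_of_pos_of_lt_pi (nodeAngle_pos (Nat.mod_lt w hN))
      (nodeAngle_lt_pi (Nat.mod_lt w hN))).ne'
    have h1 : v / N = w / N := by
      refine ih (Nat.div_lt_of_lt_mul (by rwa [mul_comm] at hv))
        (Nat.div_lt_of_lt_mul (by rwa [mul_comm] at hw)) fun j hj => ?_
      have := h (j + 1) (by omega)
      simp only [nodeCoord, h0] at this
      exact mul_right_cancel₀ hs this
    rw [← Nat.div_add_mod v N, ← Nat.div_add_mod w N, h0, h1]

theorem nodeWeight_pos {N J : ℕ} (hN : 0 < N) (L v : ℕ) : 0 < nodeWeight N J L v := by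
  induction L generalizing v with
  | zero => simp [nodeWeight]
  | succ L ih => exact mul_pos (ih _) (angleWeight_pos L (Nat.mod_lt _ hN))

/-- The quadrature rule with a given injective list of nodes and given weights. -/
def ruleOfList {n M : ℕ} (pt : Fin M → Sph n) (w : Fin M → ℝ) (hpt : Function.Injective pt)
    (hw : ∀ i, 0 < w i) : QuadratureRule n where
  nodes := Finset.univ.map ⟨pt, hpt⟩
  weight := Function.extend pt w 1
  weight_pos := by
    intro z hz
    obtain ⟨i, _, rfl⟩ := Finset.mem_map.1 hz
    rw [Function.Embedding.coeFn_mk, hpt.extend_apply]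
    exact hw i

theorem isExact_ruleOfList {n M : ℕ} (hn : 0 < n) {pt : Fin M → Sph n} {w : Fin M → ℝ}
    (hpt : Function.Injective pt) (hw : ∀ i, 0 < w i) {D : ℕ}
    (h : ∀ α : Fin n → ℕ, ∑ j, α j ≤ D →
      ∑ i, w i * ∏ j, (pt i).1 j ^ α j = moment n α) :
    (ruleOfList pt w hpt hw).IsExact D := by
  intro p hp
  have h1 : ∀ g : Sph n → ℝ, ∑ z ∈ (ruleOfList pt w hpt hw).nodes,
      (ruleOfList pt w hpt hw).weight z * g z = ∑ i, w i * g (pt i) := by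
    intro g
    simp only [ruleOfList, Finset.sum_map, Function.Embedding.coeFn_mk, hpt.extend_apply]
  rw [h1]
  change _ = sphIntegral n p
  rw [p.as_sum, map_sum, map_sum]
  simp only [ContinuousMap.coe_sum, Finset.sum_apply, Finset.mul_sum, restrict_monomial]
  rw [Finset.sum_comm]
  refine Finset.sum_congr rfl fun α hα => ?_
  rw [sphIntegral_monomial hn, ← h α, Finset.mul_sum]
  · exact Finset.sum_congr rfl fun i _ => by ring
  · have := MvPolynomial.le_totalDegree hα
    rw [Finsupp.sum_fintype _ _ (by simp)] at this
    omega

/-- The nodes of the product rule. -/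
def nodePoint (N L v : ℕ) : Sph (L + 1) :=
  ⟨WithLp.toLp 2 fun j => nodeCoord N L v j, by
    rw [mem_sphere_zero_iff_norm, ← sq_eq_sq₀ (norm_nonneg _) zero_le_one,
      EuclideanSpace.real_norm_sq_eq]
    simpa using sum_nodeCoord_sq N L v⟩

theorem nodePoint_apply (N L v : ℕ) (j : Fin (L + 1)) :
    (nodePoint N L v).1 j = nodeCoord N L v j := rfl

theorem nodePoint_injective (N L : ℕ) :
    Function.Injective fun v : Fin (nodeCount N L) => nodePoint N L v := by
  intro v w h
  refine Fin.ext (nodeCoord_injOn L v.2 w.2 fun j hj => ?_)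
  have := congrArg (fun z : Sph (L + 1) => z.1 ⟨j, by omega⟩) h
  simpa only [nodePoint_apply] using this

/-- The product quadrature rule. -/
def productRule {N : ℕ} (J : ℕ) (hN : 0 < N) (L : ℕ) : QuadratureRule (L + 1) :=
  ruleOfList (fun v : Fin (nodeCount N L) => nodePoint N L v) (fun v => nodeWeight N J L v)
    (nodePoint_injective N L) fun v => nodeWeight_pos hN L v

theorem isExact_productRule {N J L D : ℕ} (hN : 0 < N) (h : 2 * J < N) (hD : D + L ≤ 2 * J) :
    (productRule J hN L).IsExact D := by
  refine isExact_ruleOfList (Nat.succ_pos L) _ _ fun α hα => ?_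
  rw [← sum_nodeWeight_mul_prod h L α ((Nat.add_le_add_right hα L).trans hD), ← Fin.sum_univ_eq_sum_range
    fun v => nodeWeight N J L v * ∏ j : Fin (L + 1), nodeCoord N L v j ^ α j]
  rfl

theorem sum_nodeWeight {N J L : ℕ} (h : 2 * J < N) (hL : L ≤ 2 * J) :
    ∑ v ∈ Finset.range (nodeCount N L), nodeWeight N J L v =
      (sphMeasure (L + 1)).real Set.univ := by
  have h1 := sum_nodeWeight_mul_prod h L (fun _ => 0) (by simpa using hL)
  have h2 := integral_monomial_sphere (Nat.succ_pos L) (fun _ => 0)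
  rw [← h2] at h1
  simpa using h1

/-- A memory state that lists the nodes and weights of the product rule, the weighted values of `f`
and the coefficients of the zonal polynomial holds the rule. -/
theorem holds_productRule {N J L d : ℕ} (hN : 0 < N) {s : State} {f : C(Sph (L + 1), ℝ)}
    (h0 : s.reg 0 = nodeCount N L)
    (h1 : ∀ v < nodeCount N L, ∀ j ≤ L, s.arr 0 ((L + 1) * v + j) = nodeCoord N L v j)
    (h2 : ∀ v < nodeCount N L, s.arr 1 v = nodeWeight N J L v)
    (h3 : ∀ v < nodeCount N L, s.arr 2 v = nodeWeight N J L v * f (nodePoint N L v))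
    (h4 : ∀ k ≤ d, s.arr 3 k = (zonal (L + 1) d).coeff k) :
    s.Holds (productRule J hN L) d f := by
  have hinj := nodePoint_injective N L
  have hw : ∀ i : Fin (nodeCount N L), (productRule J hN L).weight (nodePoint N L i) =
      nodeWeight N J L i := fun i =>
    hinj.extend_apply (fun v : Fin (nodeCount N L) => nodeWeight N J L v) 1 i
  let g : Fin (nodeCount N L) → (productRule J hN L).nodes := fun i =>
    ⟨nodePoint N L i, Finset.mem_map.2 ⟨i, Finset.mem_univ _, rfl⟩⟩
  have hg : Function.Bijective g := by
    refine ⟨fun i j hij => hinj (congrArg (fun z => z.1) hij), fun z => ?_⟩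
    obtain ⟨i, _, hi⟩ := Finset.mem_map.1 z.2
    exact ⟨i, Subtype.ext hi⟩
  let e := (finCongr h0).trans (Equiv.ofBijective g hg)
  have he : ∀ i, (e i).1 = nodePoint N L i := fun i => rfl
  refine ⟨e, fun i j => ?_, fun i => ?_, fun i => ?_, h4⟩
  · rw [he, nodePoint_apply]
    exact h1 i (h0 ▸ i.2) j (Nat.lt_succ_iff.1 j.2)
  · rw [he, h2 i (h0 ▸ i.2)]
    exact (hw (finCongr h0 i)).symm
  · rw [he, h3 i (h0 ▸ i.2)]
    congr 1
    exact (hw (finCongr h0 i)).symm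


/-! ### Reasoning about programs -/

infixr:65 " ⨾ " => Prog.seq

section Semantics

variable {n : ℕ} (f : C(Sph n, ℝ)) (s : State)

@[simp] theorem State.tick_reg : s.tick.reg = s.reg := rfl

@[simp] theorem State.tick_arr : s.tick.arr = s.arr := rfl

@[simp] theorem State.tick_time : s.tick.time = s.time + 1 := rfl

@[simp] theorem State.setReg_reg (r v q : ℕ) :
    (s.setReg r v).reg q = if q = r then v else s.reg q := Function.update_apply _ _ _ _

@[simp] theorem State.setReg_arr (r v : ℕ) : (s.setReg r v).arr = s.arr := rfl

@[simp] theorem State.setCell_reg (c : Cell) (v : ℝ) : (s.setCell c v).reg = s.reg := rfl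

@[simp] theorem State.setCell_arr (c : Cell) (v : ℝ) (a k : ℕ) :
    (s.setCell c v).arr a k =
      if a = c.array ∧ k = s.reg c.index then v else s.arr a k := by
  by_cases h : a = c.array
  · subst h
    simp [setCell, addr, Function.update_apply]
  · simp [setCell, h]

@[simp] theorem exec_natConst (r c : ℕ) :
    (Prog.natConst r c).exec f s = s.tick.setReg r c := rfl

@[simp] theorem exec_natAdd (r a b : ℕ) :
    (Prog.natAdd r a b).exec f s = s.tick.setReg r (s.reg a + s.reg b) := rfl

@[simp] theorem exec_natSub (r a b : ℕ) :
    (Prog.natSub r a b).exec f s = s.tick.setReg r (s.reg a - s.reg b) := rfl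

@[simp] theorem exec_realOfNat (t : Cell) (r : ℕ) :
    (Prog.realOfNat t r).exec f s = s.tick.setCell t (s.reg r : ℝ) := rfl

@[simp] theorem exec_realPi (t : Cell) :
    (Prog.realPi t).exec f s = s.tick.setCell t Real.pi := rfl

@[simp] theorem exec_add (t u v : Cell) : (Prog.realOp .add t u v).exec f s =
    s.tick.setCell t (s.arr u.array (s.reg u.index) + s.arr v.array (s.reg v.index)) := rfl

@[simp] theorem exec_sub (t u v : Cell) : (Prog.realOp .sub t u v).exec f s =
    s.tick.setCell t (s.arr u.array (s.reg u.index) - s.arr v.array (s.reg v.index)) := rfl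

@[simp] theorem exec_mul (t u v : Cell) : (Prog.realOp .mul t u v).exec f s =
    s.tick.setCell t (s.arr u.array (s.reg u.index) * s.arr v.array (s.reg v.index)) := rfl

@[simp] theorem exec_div (t u v : Cell) : (Prog.realOp .div t u v).exec f s =
    s.tick.setCell t (s.arr u.array (s.reg u.index) / s.arr v.array (s.reg v.index)) := rfl

@[simp] theorem exec_realSqrt (t u : Cell) : (Prog.realSqrt t u).exec f s =
    s.tick.setCell t √(s.arr u.array (s.reg u.index)) := rfl

@[simp] theorem exec_query (t u : Cell) : (Prog.query t u).exec f s =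
    s.tick.setCell t (blackBox f (s.point n u)) := rfl

@[simp] theorem exec_seq (P R : Prog) : (P ⨾ R).exec f s = R.exec f (P.exec f s) := rfl

theorem exec_ifLE (a b : ℕ) (P R : Prog) : (Prog.ifLE a b P R).exec f s =
    if s.reg a ≤ s.reg b then P.exec f s.tick else R.exec f s.tick := rfl

theorem exec_loop (r : ℕ) (P : Prog) :
    (Prog.loop r P).exec f s = (P.exec f)^[s.reg r] s.tick := rfl

end Semantics

/-- The program contains an assignment to the register `q`. -/
def Prog.WritesReg (q : ℕ) : Prog → Prop
  | .natConst r _ => q = r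
  | .natAdd r _ _ => q = r
  | .natSub r _ _ => q = r
  | .seq P R => P.WritesReg q ∨ R.WritesReg q
  | .ifLE _ _ P R => P.WritesReg q ∨ R.WritesReg q
  | .loop _ P => P.WritesReg q
  | _ => False

/-- The program contains an assignment to a cell of the array `a`. -/
def Prog.WritesArr (a : ℕ) : Prog → Prop
  | .realOfNat t _ => a = t.array
  | .realPi t => a = t.array
  | .realOp _ t _ _ => a = t.array
  | .realSqrt t _ => a = t.array
  | .query t _ => a = t.array
  | .seq P R => P.WritesArr a ∨ R.WritesArr a
  | .ifLE _ _ P R => P.WritesArr a ∨ R.WritesArr a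
  | .loop _ P => P.WritesArr a
  | _ => False

/-- The program contains a loop controlled by the register `q`. -/
def Prog.LoopsOn (q : ℕ) : Prog → Prop
  | .seq P R => P.LoopsOn q ∨ R.LoopsOn q
  | .ifLE _ _ P R => P.LoopsOn q ∨ R.LoopsOn q
  | .loop r P => q = r ∨ P.LoopsOn q
  | _ => False

theorem iterate_induction {α : Type*} (g : α → α) (p : α → Prop) (hg : ∀ x, p x → p (g x))
    (k : ℕ) (x : α) (hx : p x) : p (g^[k] x) := by
  induction k with
  | zero => exact hx
  | succ k ih => rw [Function.iterate_succ_apply']; exact hg _ ih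

theorem exec_reg_of_not_writes {n : ℕ} (f : C(Sph n, ℝ)) {q : ℕ} {P : Prog}
    (h : ¬P.WritesReg q) (s : State) : (P.exec f s).reg q = s.reg q := by
  induction P generalizing s with
  | natConst r c =>
    rw [exec_natConst, State.setReg_reg, if_neg (show ¬q = r from h), State.tick_reg]
  | natAdd r a b =>
    rw [exec_natAdd, State.setReg_reg, if_neg (show ¬q = r from h), State.tick_reg]
  | natSub r a b =>
    rw [exec_natSub, State.setReg_reg, if_neg (show ¬q = r from h), State.tick_reg]
  | seq P R ihP ihR =>
    simp only [Prog.WritesReg, not_or] at h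
    rw [exec_seq, ihR h.2, ihP h.1]
  | ifLE a b P R ihP ihR =>
    simp only [Prog.WritesReg, not_or] at h
    rw [exec_ifLE]
    split_ifs
    · rw [ihP h.1, State.tick_reg]
    · rw [ihR h.2, State.tick_reg]
  | loop r P ih =>
    rw [exec_loop]
    exact iterate_induction _ (fun s' => s'.reg q = s.reg q)
      (fun s' hs' => (ih h s').trans hs') (s.reg r) s.tick rfl
  | _ => rfl

theorem setCell_arr_of_ne (s : State) {c : Cell} {a : ℕ} (h : a ≠ c.array) (v : ℝ) :
    (s.setCell c v).arr a = s.arr a := by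
  simp [State.setCell, h]

theorem exec_arr_of_not_writes {n : ℕ} (f : C(Sph n, ℝ)) {a : ℕ} {P : Prog}
    (h : ¬P.WritesArr a) (s : State) : (P.exec f s).arr a = s.arr a := by
  induction P generalizing s with
  | realOfNat t r => exact setCell_arr_of_ne _ h _
  | realPi t => exact setCell_arr_of_ne _ h _
  | realOp o t u v => exact setCell_arr_of_ne _ h _
  | realSqrt t u => exact setCell_arr_of_ne _ h _
  | query t u => exact setCell_arr_of_ne _ h _
  | seq P R ihP ihR =>
    simp only [Prog.WritesArr, not_or] at h
    rw [exec_seq, ihR h.2, ihP h.1]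
  | ifLE a b P R ihP ihR =>
    simp only [Prog.WritesArr, not_or] at h
    rw [exec_ifLE]
    split_ifs
    · rw [ihP h.1, State.tick_arr]
    · rw [ihR h.2, State.tick_arr]
  | loop r P ih =>
    rw [exec_loop]
    exact iterate_induction _ (fun s' => s'.arr a = s.arr a)
      (fun s' hs' => (ih h s').trans hs') (s.reg r) s.tick rfl
  | _ => rfl

/-- The states agree on all registers and arrays which the program does not assign to. -/
def Prog.Agrees (P : Prog) (s s' : State) : Prop :=
  (∀ q, ¬P.WritesReg q → s'.reg q = s.reg q) ∧ ∀ a, ¬P.WritesArr a → s'.arr a = s.arr a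

theorem exec_agrees {n : ℕ} (f : C(Sph n, ℝ)) (P : Prog) (s : State) :
    P.Agrees s (P.exec f s) :=
  ⟨fun _ h => exec_reg_of_not_writes f h s, fun _ h => exec_arr_of_not_writes f h s⟩

/-- The invariant rule for counted loops. -/
theorem exec_loop_invariant {n : ℕ} (f : C(Sph n, ℝ)) {r : ℕ} {P : Prog} {s : State}
    (I : ℕ → State → Prop) (h0 : I 0 s.tick)
    (hstep : ∀ i s', i < s.reg r → P.Agrees s s' → I i s' → I (i + 1) (P.exec f s')) :
    I (s.reg r) ((Prog.loop r P).exec f s) := by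
  rw [exec_loop]
  -- The frame condition is carried along with the invariant, so that each step may use the values
  -- that the loop body never changes.
  have key : ∀ k ≤ s.reg r,
      I k ((P.exec f)^[k] s.tick) ∧ P.Agrees s ((P.exec f)^[k] s.tick) := by
    intro k
    induction k with
    | zero => exact fun _ => ⟨h0, fun _ _ => rfl, fun _ _ => rfl⟩
    | succ k ih =>
      intro hk
      obtain ⟨hI, hA⟩ := ih (by omega)
      rw [Function.iterate_succ_apply']
      refine ⟨hstep k _ (by omega) hA hI, fun q hq => ?_, fun a ha => ?_⟩
      · rw [exec_reg_of_not_writes f hq, hA.1 q hq]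
      · rw [exec_arr_of_not_writes f ha, hA.2 a ha]
  exact (key _ le_rfl).1

/-- A bound for the number of steps of a program all of whose loops run at most `B` times. -/
def Prog.cost (B : ℕ) : Prog → ℕ
  | .seq P R => P.cost B + R.cost B
  | .ifLE _ _ P R => 1 + (P.cost B + R.cost B)
  | .loop _ P => 1 + B * P.cost B
  | _ => 1

/-- Registers that control loops and are never assigned keep their bound B throughout, including
inside nested loops. A program that computes its own loop lengths is cut into pieces of this kind by
`Prog.TimeLE.seq`. -/
theorem exec_time_le_of_subset {n : ℕ} (f : C(Sph n, ℝ)) {B : ℕ} (R : Set ℕ) {P : Prog}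
    (hL : ∀ q, P.LoopsOn q → q ∈ R) (hW : ∀ q ∈ R, ¬P.WritesReg q) {s : State}
    (hB : ∀ q ∈ R, s.reg q ≤ B) : (P.exec f s).time ≤ s.time + P.cost B := by
  induction P generalizing s with
  | seq P S ihP ihS =>
    rw [exec_seq, Prog.cost]
    have hP := ihP (fun q hq => hL q (Or.inl hq)) (fun q hq h => hW q hq (Or.inl h)) hB
    have hS := ihS (fun q hq => hL q (Or.inr hq)) (fun q hq h => hW q hq (Or.inr h))
      (s := P.exec f s) fun q hq => by
        rw [exec_reg_of_not_writes f fun h => hW q hq (Or.inl h)]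
        exact hB q hq
    omega
  | ifLE a b P S ihP ihS =>
    rw [exec_ifLE, Prog.cost]
    have hP := ihP (fun q hq => hL q (Or.inl hq)) (fun q hq h => hW q hq (Or.inl h))
      (s := s.tick) hB
    have hS := ihS (fun q hq => hL q (Or.inr hq)) (fun q hq h => hW q hq (Or.inr h))
      (s := s.tick) hB
    rw [State.tick_time] at hP hS
    split_ifs <;> omega
  | loop r P ih =>
    have hr : s.reg r ≤ B := hB r (hL r (Or.inl rfl))
    rw [exec_loop, Prog.cost]
    have key : ∀ k, ((P.exec f)^[k] s.tick).time ≤ s.time + 1 + k * P.cost B ∧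
        ∀ q ∈ R, ((P.exec f)^[k] s.tick).reg q = s.reg q := by
      intro k
      induction k with
      | zero => exact ⟨by simp, fun _ _ => rfl⟩
      | succ k ihk =>
        rw [Function.iterate_succ_apply']
        refine ⟨?_, fun q hq => ?_⟩
        · have := ih (fun q hq => hL q (Or.inr hq)) hW (s := (P.exec f)^[k] s.tick)
            fun q hq => by rw [ihk.2 q hq]; exact hB q hq
          have := ihk.1
          rw [Nat.succ_mul]
          omega
        · rw [exec_reg_of_not_writes f (P := P) (hW q hq), ihk.2 q hq]
    have h1 := (key (s.reg r)).1
    have h2 := Nat.mul_le_mul_right (P.cost B) hr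
    omega
  | _ => exact le_rfl

/-- The program takes at most `P.cost B` steps from the state `s`. -/
def Prog.TimeLE {n : ℕ} (f : C(Sph n, ℝ)) (B : ℕ) (P : Prog) (s : State) : Prop :=
  (P.exec f s).time ≤ s.time + P.cost B

theorem timeLE_of_loopsOn {n : ℕ} (f : C(Sph n, ℝ)) {B : ℕ} {P : Prog} {s : State}
    (h : ∀ q, P.LoopsOn q → ¬P.WritesReg q ∧ s.reg q ≤ B) : P.TimeLE f B s :=
  exec_time_le_of_subset f {q | P.LoopsOn q} (fun _ hq => hq) (fun q hq => (h q hq).1)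
    fun q hq => (h q hq).2

theorem Prog.TimeLE.seq {n : ℕ} {f : C(Sph n, ℝ)} {B : ℕ} {P R : Prog} {s : State}
    (hP : P.TimeLE f B s) (hR : R.TimeLE f B (P.exec f s)) : (P ⨾ R).TimeLE f B s := by
  unfold Prog.TimeLE at *
  rw [exec_seq, Prog.cost]
  omega

/-- Each nested loop contributes one factor B, so the exponent depends only on the program text. -/
theorem exists_cost_le (P : Prog) : ∃ c e : ℕ, ∀ B, 1 ≤ B → P.cost B ≤ c * B ^ e := by
  have hmono : ∀ {B c e e' : ℕ}, 1 ≤ B → e ≤ e' → c * B ^ e ≤ c * B ^ e' := fun hB he =>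
    Nat.mul_le_mul_left _ (Nat.pow_le_pow_right hB he)
  have hone : ∀ {B e : ℕ}, 1 ≤ B → 1 ≤ B ^ e := fun hB => Nat.one_le_pow _ _ hB
  induction P with
  | seq P R ihP ihR =>
    obtain ⟨c, e, h⟩ := ihP
    obtain ⟨c', e', h'⟩ := ihR
    refine ⟨c + c', max e e', fun B hB => ?_⟩
    rw [Prog.cost, add_mul]
    exact add_le_add ((h B hB).trans (hmono hB (le_max_left _ _)))
      ((h' B hB).trans (hmono hB (le_max_right _ _)))
  | ifLE a b P R ihP ihR =>
    obtain ⟨c, e, h⟩ := ihP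
    obtain ⟨c', e', h'⟩ := ihR
    refine ⟨1 + (c + c'), max e e', fun B hB => ?_⟩
    rw [Prog.cost, add_mul, add_mul, one_mul]
    exact add_le_add (hone hB) (add_le_add ((h B hB).trans (hmono hB (le_max_left _ _)))
      ((h' B hB).trans (hmono hB (le_max_right _ _))))
  | loop r P ih =>
    obtain ⟨c, e, h⟩ := ih
    refine ⟨1 + c, e + 1, fun B hB => ?_⟩
    rw [Prog.cost, add_mul, one_mul]
    refine add_le_add (hone hB) ?_
    calc B * P.cost B ≤ B * (c * B ^ e) := Nat.mul_le_mul_left _ (h B hB)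
      _ = c * B ^ (e + 1) := by ring
  | _ => exact ⟨1, 0, fun B _ => by simp [Prog.cost]⟩

/-- The first `M` entries of the array `a` are given by `g`. -/
def State.Lists (s : State) (a M : ℕ) (g : ℕ → ℝ) : Prop := ∀ i < M, s.arr a i = g i

theorem State.Lists.congr {s s' : State} {a M : ℕ} {g : ℕ → ℝ} (h : s.Lists a M g)
    (hs : s'.arr a = s.arr a) : s'.Lists a M g := fun i hi => by rw [hs]; exact h i hi

theorem State.Lists.snoc {s s' : State} {a M : ℕ} {g : ℕ → ℝ} (h : s.Lists a M g)
    (hs : ∀ i, s'.arr a i = if i = M then g M else s.arr a i) : s'.Lists a (M + 1) g := by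
  intro i hi
  rw [hs]
  split_ifs with h'
  · rw [h']
  · exact h i (by omega)

theorem State.lists_zero (s : State) (a : ℕ) (g : ℕ → ℝ) : s.Lists a 0 g := fun i hi => by omega


/-! ### The one-dimensional tables

Register `2` is zero throughout, so that the cell `⟨a, 2⟩` serves as a real variable. -/

/-- The constants which are kept during the whole computation: the registers `2`, …, `5`, `7` hold
`0`, `1`, `N`, `d`, `J`, and the variables `5`, `6` hold `1`, `2`. -/
structure Config (N d J : ℕ) (s : State) : Prop where
  zero : s.reg 2 = 0
  one : s.reg 3 = 1
  size : s.reg 4 = N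
  degree : s.reg 5 = d
  half : s.reg 7 = J
  unit : s.arr 5 0 = 1
  two : s.arr 6 0 = 2

/-- The program does not change the constants. -/
def Prog.Keeps (P : Prog) : Prop :=
  (∀ q ∈ [2, 3, 4, 5, 7], ¬P.WritesReg q) ∧ ∀ a ∈ [5, 6], ¬P.WritesArr a

theorem Config.of_agrees {N d J : ℕ} {s s' : State} {P : Prog} (h : Config N d J s)
    (hA : P.Agrees s s') (hK : P.Keeps) : Config N d J s' where
  zero := (hA.1 2 (hK.1 2 (by simp))).trans h.zero
  one := (hA.1 3 (hK.1 3 (by simp))).trans h.one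
  size := (hA.1 4 (hK.1 4 (by simp))).trans h.size
  degree := (hA.1 5 (hK.1 5 (by simp))).trans h.degree
  half := (hA.1 7 (hK.1 7 (by simp))).trans h.half
  unit := (congrFun (hA.2 5 (hK.2 5 (by simp))) 0).trans h.unit
  two := (congrFun (hA.2 6 (hK.2 6 (by simp))) 0).trans h.two

/-- Initialization. -/
def setup (n : ℕ) : Prog :=
  .natConst 3 1 ⨾ .natAdd 5 0 2 ⨾ .natConst 14 n ⨾ .natAdd 7 0 1 ⨾ .natAdd 7 7 14 ⨾
  .natAdd 6 7 7 ⨾ .natConst 4 1 ⨾ .realOfNat ⟨5, 2⟩ 3 ⨾ .realOp .add ⟨6, 2⟩ ⟨5, 2⟩ ⟨5, 2⟩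

theorem exec_setup {n : ℕ} (f : C(Sph n, ℝ)) (d m : ℕ) :
    Config 1 d (d + m + n) ((setup n).exec f (initState d m)) ∧
      ((setup n).exec f (initState d m)).reg 6 = d + m + n + (d + m + n) ∧
      ((setup n).exec f (initState d m)).arr 4 0 = 0 := by
  refine ⟨⟨?_, ?_, ?_, ?_, ?_, ?_, ?_⟩, ?_, ?_⟩ <;> simp [setup, initState]
  norm_num

/-- One step in the search for a power of two above `D`. -/
def doubleUpTo (D N : ℕ) : ℕ := if N ≤ D then N + N else N

/-- A power of two above `D`. -/
def tableSize (D : ℕ) : ℕ := (doubleUpTo D)^[D] 1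

/-- After i rounds the value exceeds i or already exceeds D, hence D rounds suffice. A doubling
happens only from a value at most D, so the result stays at most 2D. -/
theorem tableSize_spec {D : ℕ} (hD : 1 ≤ D) : D < tableSize D ∧ tableSize D ≤ 2 * D := by
  have key : ∀ i, (i < (doubleUpTo D)^[i] 1 ∨ D < (doubleUpTo D)^[i] 1) ∧
      (doubleUpTo D)^[i] 1 ≤ 2 * D := by
    intro i
    induction i with
    | zero => exact ⟨Or.inl (by simp), by simp only [Function.iterate_zero, id]; omega⟩
    | succ i ih =>
      rw [Function.iterate_succ_apply', doubleUpTo]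
      split_ifs <;> omega
  have := key D
  rw [tableSize]
  omega

/-- Computation of `N` and of `cos (π / (2 N))`. -/
def findSize : Prog :=
  .loop 6 (.ifLE 4 6
    (.natAdd 4 4 4 ⨾ .realOp .add ⟨4, 2⟩ ⟨4, 2⟩ ⟨5, 2⟩ ⨾ .realOp .div ⟨4, 2⟩ ⟨4, 2⟩ ⟨6, 2⟩ ⨾
      .realSqrt ⟨4, 2⟩ ⟨4, 2⟩)
    (.natConst 15 0))

/-- The start is cos(π/2) = 0 for N = 1. Each doubling of N halves the angle, and cos(x/2) = √((1 +
cos x)/2) is available to the machine. -/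
theorem exec_findSize {n : ℕ} (f : C(Sph n, ℝ)) {d J D : ℕ} {s : State} (h : Config 1 d J s)
    (hD : s.reg 6 = D) (h4 : s.arr 4 0 = 0) :
    Config (tableSize D) d J (findSize.exec f s) ∧
      (findSize.exec f s).arr 4 0 = Real.cos (Real.pi / (2 * tableSize D)) := by
  have key := exec_loop_invariant f (r := 6) (s := s)
    (P := .ifLE 4 6
    (.natAdd 4 4 4 ⨾ .realOp .add ⟨4, 2⟩ ⟨4, 2⟩ ⟨5, 2⟩ ⨾ .realOp .div ⟨4, 2⟩ ⟨4, 2⟩ ⟨6, 2⟩ ⨾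
      .realSqrt ⟨4, 2⟩ ⟨4, 2⟩)
    (.natConst 15 0)) (fun i s' => 1 ≤ s'.reg 4 ∧ s'.reg 4 = (doubleUpTo D)^[i] 1 ∧
      s'.arr 4 0 = Real.cos (Real.pi / (2 * (s'.reg 4 : ℕ)))) ?_ ?_
  · have hA := exec_agrees f findSize s
    rw [hD] at key
    refine ⟨⟨?_, ?_, key.2.1, ?_, ?_, ?_, ?_⟩, ?_⟩
    · exact (hA.1 2 (by simp [findSize, Prog.WritesReg])).trans h.zero
    · exact (hA.1 3 (by simp [findSize, Prog.WritesReg])).trans h.one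
    · exact (hA.1 5 (by simp [findSize, Prog.WritesReg])).trans h.degree
    · exact (hA.1 7 (by simp [findSize, Prog.WritesReg])).trans h.half
    · exact (congrFun (hA.2 5 (by simp [findSize, Prog.WritesArr])) 0).trans h.unit
    · exact (congrFun (hA.2 6 (by simp [findSize, Prog.WritesArr])) 0).trans h.two
    · rw [tableSize, ← key.2.1]
      exact key.2.2
  · have := h.size
    simp [this, h4]
  · rintro i s' hi hA ⟨h1, h2, h3⟩
    have z : s'.reg 2 = 0 := (hA.1 2 (by simp [Prog.WritesReg])).trans h.zero
    have e : s'.reg 6 = D := (hA.1 6 (by simp [Prog.WritesReg])).trans hD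
    have u : s'.arr 5 0 = 1 := (congrFun (hA.2 5 (by simp [Prog.WritesArr])) 0).trans h.unit
    have w : s'.arr 6 0 = 2 := (congrFun (hA.2 6 (by simp [Prog.WritesArr])) 0).trans h.two
    rw [exec_ifLE, Function.iterate_succ_apply', ← h2, doubleUpTo, e]
    split_ifs with hc
    · refine ⟨by simp; omega, by simp, ?_⟩
      have h0 : (1 : ℝ) ≤ s'.reg 4 := by exact_mod_cast h1
      have hpi := Real.pi_pos
      have hx : 0 ≤ Real.pi / (2 * (s'.reg 4 : ℕ)) := by positivity
      have hx' : Real.pi / (2 * (s'.reg 4 : ℕ)) ≤ Real.pi := div_le_self hpi.le (by linarith)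
      have := Real.cos_half (x := Real.pi / (2 * (s'.reg 4 : ℕ))) (by linarith) hx'
      simp [z, u, w, h3]
      rw [add_comm, ← Real.sqrt_div' _ zero_le_two, ← this]
      congr 1
      field_simp
      ring
    · simp [h1, h3]

/-- Tables of cosines and sines at the nodes of the Chebyshev rule. -/
structure Tables (N : ℕ) (s : State) : Prop where
  cos : s.Lists 10 N fun k => Real.cos (nodeAngle N k)
  sin : s.Lists 11 N fun k => Real.sin (nodeAngle N k)

theorem Tables.of_agrees {N : ℕ} {s s' : State} {P : Prog} (h : Tables N s)
    (hA : P.Agrees s s') (h10 : ¬P.WritesArr 10) (h11 : ¬P.WritesArr 11) : Tables N s' :=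
  ⟨h.cos.congr (hA.2 10 h10), h.sin.congr (hA.2 11 h11)⟩

/-- With φ = π/(2N), variable `7` becomes 2 cos 2φ. Variables `8` and `9` are the current and the
preceding cosine of the recursion; both start as cos φ, because the preceding angle is -φ. A
multiplication by variable `5`, which holds 1, is a copy. -/
def fillTablesInit : Prog :=
  .realOp .mul ⟨7, 2⟩ ⟨4, 2⟩ ⟨4, 2⟩ ⨾ .realOp .mul ⟨7, 2⟩ ⟨7, 2⟩ ⟨6, 2⟩ ⨾
  .realOp .sub ⟨7, 2⟩ ⟨7, 2⟩ ⟨5, 2⟩ ⨾ .realOp .mul ⟨7, 2⟩ ⟨7, 2⟩ ⟨6, 2⟩ ⨾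
  .realOp .mul ⟨8, 2⟩ ⟨4, 2⟩ ⟨5, 2⟩ ⨾ .realOp .mul ⟨9, 2⟩ ⟨4, 2⟩ ⟨5, 2⟩ ⨾ .natConst 8 0

def fillTablesStep : Prog :=
  .realOp .mul ⟨10, 8⟩ ⟨8, 2⟩ ⟨5, 2⟩ ⨾
  .realOp .mul ⟨12, 2⟩ ⟨8, 2⟩ ⟨8, 2⟩ ⨾ .realOp .sub ⟨12, 2⟩ ⟨5, 2⟩ ⟨12, 2⟩ ⨾
  .realSqrt ⟨11, 8⟩ ⟨12, 2⟩ ⨾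
  .realOp .mul ⟨12, 2⟩ ⟨7, 2⟩ ⟨8, 2⟩ ⨾ .realOp .sub ⟨12, 2⟩ ⟨12, 2⟩ ⟨9, 2⟩ ⨾
  .realOp .mul ⟨9, 2⟩ ⟨8, 2⟩ ⟨5, 2⟩ ⨾ .realOp .mul ⟨8, 2⟩ ⟨12, 2⟩ ⟨5, 2⟩ ⨾ .natAdd 8 8 3

/-- Computation of the tables of cosines and sines. -/
def fillTables : Prog := fillTablesInit ⨾ .loop 4 fillTablesStep

theorem cos_three_term (x y : ℝ) :
    2 * Real.cos y * Real.cos x - Real.cos (x - y) = Real.cos (x + y) := by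
  rw [Real.cos_add, Real.cos_sub]
  ring

theorem exec_fillTables {n : ℕ} (f : C(Sph n, ℝ)) {N d J : ℕ} {s : State} (h : Config N d J s)
    (h4 : s.arr 4 0 = Real.cos (Real.pi / (2 * N))) :
    Config N d J (fillTables.exec f s) ∧ Tables N (fillTables.exec f s) := by
  obtain ⟨φ, hφ⟩ : ∃ φ, φ = Real.pi / (2 * N) := ⟨_, rfl⟩
  rw [← hφ] at h4
  have hang : ∀ i : ℕ, (2 * i + 1) * φ = nodeAngle N i := fun i => by
    rw [hφ, nodeAngle]
    ring
  have hA := exec_agrees f fillTables s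
  refine ⟨h.of_agrees hA (by simp [Prog.Keeps, fillTables, fillTablesInit, fillTablesStep,
    Prog.WritesReg, Prog.WritesArr]), ?_⟩
  have h' : Config N d J (fillTablesInit.exec f s) := h.of_agrees (exec_agrees f _ s)
    (by simp [Prog.Keeps, fillTablesInit, Prog.WritesReg, Prog.WritesArr])
  have h7 : (fillTablesInit.exec f s).arr 7 0 = 2 * Real.cos (2 * φ) := by
    simp [fillTablesInit, h.zero, h.unit, h.two, h4]
    rw [Real.cos_two_mul]
    ring
  rw [fillTables, exec_seq]
  have key := exec_loop_invariant f (r := 4) (s := fillTablesInit.exec f s) (P := fillTablesStep)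
    (fun i s' => s'.reg 8 = i ∧ s'.arr 8 0 = Real.cos ((2 * i + 1) * φ) ∧
      s'.arr 9 0 = Real.cos ((2 * i + 1) * φ - 2 * φ) ∧
      s'.Lists 10 i (fun k => Real.cos (nodeAngle N k)) ∧
      s'.Lists 11 i (fun k => Real.sin (nodeAngle N k))) ?_ ?_
  · rw [h'.size] at key
    exact ⟨key.2.2.2.1, key.2.2.2.2⟩
  · refine ⟨by simp [fillTablesInit], ?_, ?_, State.lists_zero _ _ _, State.lists_zero _ _ _⟩
    · simp [fillTablesInit, h.zero, h.unit, h4]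
    · simp [fillTablesInit, h.zero, h.unit, h4]
      rw [← Real.cos_neg]
      congr 1
      ring
  · rintro i s' hi hA ⟨i1, i2, i3, i4, i5⟩
    rw [h'.size] at hi
    have hc := h'.of_agrees hA
      (by simp [Prog.Keeps, fillTablesStep, Prog.WritesReg, Prog.WritesArr])
    have e7 : s'.arr 7 0 = 2 * Real.cos (2 * φ) := by
      rw [hA.2 7 (by simp [fillTablesStep, Prog.WritesArr]), h7]
    have hs : √(1 - Real.cos ((2 * i + 1) * φ) * Real.cos ((2 * i + 1) * φ)) =
        Real.sin (nodeAngle N i) := by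
      rw [hang, ← sq, ← Real.sin_sq, Real.sqrt_sq]
      exact (Real.sin_pos_of_pos_of_lt_pi (nodeAngle_pos hi) (nodeAngle_lt_pi hi)).le
    refine ⟨by simp [fillTablesStep, i1, hc.one], ?_, ?_, i4.snoc fun q => ?_, i5.snoc fun q => ?_⟩
    · simp [fillTablesStep, hc.zero, hc.unit, i2, i3, e7]
      rw [cos_three_term]
      congr 1
      ring
    · simp [fillTablesStep, hc.zero, hc.unit, i2]
      congr 1
      ring
    · simp [fillTablesStep, hc.zero, hc.unit, i1, i2, hang]
    · simp [fillTablesStep, hc.zero, hc.unit, i1, i2, hs]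

/-- Variables `14` and `15` receive the factors π/N and 2/N of the two kinds of weights. -/
def baseWeightsInit : Prog :=
  .realPi ⟨12, 2⟩ ⨾ .realOfNat ⟨13, 2⟩ 4 ⨾ .realOp .div ⟨14, 2⟩ ⟨12, 2⟩ ⟨13, 2⟩ ⨾
  .realOp .div ⟨15, 2⟩ ⟨6, 2⟩ ⟨13, 2⟩ ⨾ .natConst 8 0

/-- At the current angle θ, variables `7`, `8`, `9` become 2 cos 2θ, cos 2θ and cos 0, which starts
the recursion in the even frequencies. Variable `12` accumulates `sinePoly`, and register `9` starts
at 1 because the terms are indexed by j + 1. -/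
def baseWeightsStepInit : Prog :=
  .realOp .mul ⟨20, 8⟩ ⟨14, 2⟩ ⟨5, 2⟩ ⨾
  .realOp .mul ⟨7, 2⟩ ⟨10, 8⟩ ⟨10, 8⟩ ⨾ .realOp .mul ⟨7, 2⟩ ⟨7, 2⟩ ⟨6, 2⟩ ⨾
  .realOp .sub ⟨8, 2⟩ ⟨7, 2⟩ ⟨5, 2⟩ ⨾ .realOp .mul ⟨7, 2⟩ ⟨8, 2⟩ ⟨6, 2⟩ ⨾
  .realOp .mul ⟨9, 2⟩ ⟨5, 2⟩ ⟨5, 2⟩ ⨾ .realOp .mul ⟨12, 2⟩ ⟨5, 2⟩ ⟨5, 2⟩ ⨾ .natConst 9 1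

def sinePolyStep : Prog :=
  .realOfNat ⟨16, 2⟩ 9 ⨾ .realOp .add ⟨16, 2⟩ ⟨16, 2⟩ ⟨16, 2⟩ ⨾
  .realOp .mul ⟨16, 2⟩ ⟨16, 2⟩ ⟨16, 2⟩ ⨾ .realOp .sub ⟨16, 2⟩ ⟨16, 2⟩ ⟨5, 2⟩ ⨾
  .realOp .div ⟨16, 2⟩ ⟨6, 2⟩ ⟨16, 2⟩ ⨾ .realOp .mul ⟨16, 2⟩ ⟨16, 2⟩ ⟨8, 2⟩ ⨾
  .realOp .sub ⟨12, 2⟩ ⟨12, 2⟩ ⟨16, 2⟩ ⨾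
  .realOp .mul ⟨16, 2⟩ ⟨7, 2⟩ ⟨8, 2⟩ ⨾ .realOp .sub ⟨16, 2⟩ ⟨16, 2⟩ ⟨9, 2⟩ ⨾
  .realOp .mul ⟨9, 2⟩ ⟨8, 2⟩ ⟨5, 2⟩ ⨾ .realOp .mul ⟨8, 2⟩ ⟨16, 2⟩ ⟨5, 2⟩ ⨾ .natAdd 9 9 3

def baseWeightsStep : Prog :=
  baseWeightsStepInit ⨾ .loop 7 sinePolyStep ⨾ .realOp .mul ⟨23, 8⟩ ⟨15, 2⟩ ⟨12, 2⟩ ⨾ .natAdd 8 8 3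

/-- Computation of the weights of the one-dimensional rules for `dθ` and `sin θ dθ`. -/
def baseWeights : Prog := baseWeightsInit ⨾ .loop 4 baseWeightsStep

theorem exec_sinePolyLoop {n : ℕ} (f : C(Sph n, ℝ)) {N d J : ℕ} {s : State} (h : Config N d J s)
    {θ : ℝ} (h7 : s.arr 7 0 = 2 * Real.cos (2 * θ)) (h8 : s.arr 8 0 = Real.cos (2 * θ))
    (h9 : s.arr 9 0 = 1) (h12 : s.arr 12 0 = 1) (hr : s.reg 9 = 1) :
    ((Prog.loop 7 sinePolyStep).exec f s).arr 12 0 = (sinePoly J).eval (Real.cos θ) := by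
  have key := exec_loop_invariant f (r := 7) (s := s) (P := sinePolyStep)
    (fun j s' => s'.reg 9 = j + 1 ∧ s'.arr 8 0 = Real.cos (2 * (j + 1) * θ) ∧
      s'.arr 9 0 = Real.cos (2 * (j + 1) * θ - 2 * θ) ∧
      s'.arr 12 0 = 1 - ∑ i ∈ Finset.range j,
        2 / (4 * ((i : ℝ) + 1) ^ 2 - 1) * Real.cos (2 * ((i : ℝ) + 1) * θ)) ?_ ?_
  · rw [h.half] at key
    rw [eval_sinePoly_cos, key.2.2.2]
  · simp [h8, h9, h12, hr]
  · rintro j s' hj hA ⟨i1, i2, i3, i4⟩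
    have hc := h.of_agrees hA (by simp [Prog.Keeps, sinePolyStep, Prog.WritesReg, Prog.WritesArr])
    have e7 : s'.arr 7 0 = 2 * Real.cos (2 * θ) := by
      rw [hA.2 7 (by simp [sinePolyStep, Prog.WritesArr]), h7]
    refine ⟨by simp [sinePolyStep, i1, hc.one], ?_, ?_, ?_⟩
    · simp [sinePolyStep, hc.zero, hc.unit, i2, i3, e7]
      rw [cos_three_term]
      congr 1
      ring
    · simp [sinePolyStep, hc.zero, hc.unit, i2]
      congr 1
      ring
    · simp [sinePolyStep, hc.zero, hc.unit, hc.two, i1, i2, i4]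
      rw [Finset.sum_range_succ, ← sub_sub]
      congr 3
      ring

theorem exec_baseWeights {n : ℕ} (f : C(Sph n, ℝ)) {N d J : ℕ} {s : State} (h : Config N d J s)
    (hT : Tables N s) :
    Config N d J (baseWeights.exec f s) ∧ Tables N (baseWeights.exec f s) ∧
      (baseWeights.exec f s).Lists 20 N (angleWeight N J 0) ∧
      (baseWeights.exec f s).Lists 23 N (angleWeight N J 1) := by
  have hA := exec_agrees f baseWeights s
  refine ⟨h.of_agrees hA (by simp [Prog.Keeps, baseWeights, baseWeightsInit, baseWeightsStep,
    baseWeightsStepInit, sinePolyStep, Prog.WritesReg, Prog.WritesArr]), hT.of_agrees hA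
    (by simp [baseWeights, baseWeightsInit, baseWeightsStep, baseWeightsStepInit, sinePolyStep,
      Prog.WritesArr])
    (by simp [baseWeights, baseWeightsInit, baseWeightsStep, baseWeightsStepInit, sinePolyStep,
      Prog.WritesArr]), ?_⟩
  have h' : Config N d J (baseWeightsInit.exec f s) := h.of_agrees (exec_agrees f _ s)
    (by simp [Prog.Keeps, baseWeightsInit, Prog.WritesReg, Prog.WritesArr])
  have hT' : Tables N (baseWeightsInit.exec f s) := hT.of_agrees (exec_agrees f _ s)
    (by simp [baseWeightsInit, Prog.WritesArr]) (by simp [baseWeightsInit, Prog.WritesArr])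
  have h14 : (baseWeightsInit.exec f s).arr 14 0 = Real.pi / N := by
    simp [baseWeightsInit, h.zero, h.size]
  have h15 : (baseWeightsInit.exec f s).arr 15 0 = 2 / N := by
    simp [baseWeightsInit, h.zero, h.size, h.two]
  rw [baseWeights, exec_seq]
  have key := exec_loop_invariant f (r := 4) (s := baseWeightsInit.exec f s) (P := baseWeightsStep)
    (fun i s' => s'.reg 8 = i ∧ s'.Lists 20 i (angleWeight N J 0) ∧
      s'.Lists 23 i (angleWeight N J 1)) ?_ ?_
  · rw [h'.size] at key
    exact key.2
  · exact ⟨by simp [baseWeightsInit], State.lists_zero _ _ _, State.lists_zero _ _ _⟩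
  · rintro i s₀ hi hA ⟨i1, i2, i3⟩
    rw [h'.size] at hi
    have hc := h'.of_agrees hA (by simp [Prog.Keeps, baseWeightsStep, baseWeightsStepInit,
      sinePolyStep, Prog.WritesReg, Prog.WritesArr])
    have hT0 := hT'.of_agrees hA
      (by simp [baseWeightsStep, baseWeightsStepInit, sinePolyStep, Prog.WritesArr])
      (by simp [baseWeightsStep, baseWeightsStepInit, sinePolyStep, Prog.WritesArr])
    have e14 : s₀.arr 14 0 = Real.pi / N := by
      rw [hA.2 14 (by simp [baseWeightsStep, baseWeightsStepInit, sinePolyStep, Prog.WritesArr]),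
        h14]
    have e15 : s₀.arr 15 0 = 2 / N := by
      rw [hA.2 15 (by simp [baseWeightsStep, baseWeightsStepInit, sinePolyStep, Prog.WritesArr]),
        h15]
    have e10 := hT0.cos i hi
    obtain ⟨s₁, hs₁⟩ : ∃ s₁, s₁ = baseWeightsStepInit.exec f s₀ := ⟨_, rfl⟩
    have hA₁ : baseWeightsStepInit.Agrees s₀ s₁ := hs₁ ▸ exec_agrees f _ _
    have hc₁ := hc.of_agrees hA₁ (by simp [Prog.Keeps, baseWeightsStepInit,
      Prog.WritesReg, Prog.WritesArr])
    obtain ⟨s₂, hs₂⟩ : ∃ s₂, s₂ = (Prog.loop 7 sinePolyStep).exec f s₁ := ⟨_, rfl⟩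
    have hA₂ : (Prog.loop 7 sinePolyStep).Agrees s₁ s₂ := hs₂ ▸ exec_agrees f _ _
    have hc₂ := hc₁.of_agrees hA₂ (by simp [Prog.Keeps, sinePolyStep,
      Prog.WritesReg, Prog.WritesArr])
    have r8 : s₂.reg 8 = i := by
      rw [hA₂.1 8 (by simp [sinePolyStep, Prog.WritesReg]),
        hA₁.1 8 (by simp [baseWeightsStepInit, Prog.WritesReg]), i1]
    have hv : s₂.arr 12 0 = (sinePoly J).eval (Real.cos (nodeAngle N i)) := by
      rw [hs₂]
      have e8 : s₁.arr 8 0 = Real.cos (2 * nodeAngle N i) := by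
        simp [hs₁, baseWeightsStepInit, hc.zero, hc.unit, hc.two, i1, e10]
        rw [Real.cos_two_mul]
        ring
      refine exec_sinePolyLoop f hc₁ ?_ e8 ?_ ?_ ?_
      · rw [← e8]
        simp [hs₁, baseWeightsStepInit, hc.zero, hc.unit, hc.two, i1, e10]
        ring
      · simp [hs₁, baseWeightsStepInit, hc.zero, hc.unit]
      · simp [hs₁, baseWeightsStepInit, hc.zero, hc.unit]
      · simp [hs₁, baseWeightsStepInit]
    have e15' : s₂.arr 15 0 = 2 / N := by
      rw [hA₂.2 15 (by simp [sinePolyStep, Prog.WritesArr]),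
        hA₁.2 15 (by simp [baseWeightsStepInit, Prog.WritesArr]), e15]
    have e20 : s₂.arr 20 = s₁.arr 20 := hA₂.2 20 (by simp [sinePolyStep, Prog.WritesArr])
    have e23 : s₂.arr 23 = s₀.arr 23 := by
      rw [hA₂.2 23 (by simp [sinePolyStep, Prog.WritesArr]),
        hA₁.2 23 (by simp [baseWeightsStepInit, Prog.WritesArr])]
    rw [baseWeightsStep, exec_seq, exec_seq, ← hs₁, ← hs₂]
    refine ⟨by simp [r8, hc₂.one], i2.snoc fun q => ?_, i3.snoc fun q => ?_⟩
    · simp [e20, hs₁, baseWeightsStepInit, i1, hc.zero, hc.unit, e14, angleWeight]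
    · simp [r8, hc₂.zero, e15', hv, e23, angleWeight]


/-! ### Computation of the product rule -/

/-- The coordinates of the nodes of the product rule, in one list. -/
def flatCoord (N L q : ℕ) : ℝ := nodeCoord N L (q / (L + 1)) (q % (L + 1))

theorem flatCoord_mul_add (N L v : ℕ) {j : ℕ} (hj : j ≤ L) :
    flatCoord N L ((L + 1) * v + j) = nodeCoord N L v j := by
  rw [flatCoord, Nat.mul_add_div (by omega), Nat.div_eq_of_lt (by omega), add_zero,
    Nat.mul_add_mod, Nat.mod_eq_of_lt (by omega)]

/-- The arrays `a` and `b` hold the nodes and weights of the product rule in dimension `L + 1`. -/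
structure HoldsLevel (N J L a b : ℕ) (s : State) : Prop where
  count : s.reg 10 = nodeCount N L
  coords : s.Lists a ((L + 1) * nodeCount N L) (flatCoord N L)
  weights : s.Lists b (nodeCount N L) (nodeWeight N J L)

/-- Registers `2` and `3` hold 0 and 1 and serve as the two addresses; the second node is 1 - 2 =
-1. -/
def levelZero : Prog :=
  .natConst 10 2 ⨾ .realOp .mul ⟨21, 2⟩ ⟨5, 2⟩ ⟨5, 2⟩ ⨾ .realOp .sub ⟨21, 3⟩ ⟨5, 2⟩ ⟨6, 2⟩ ⨾
  .realOp .mul ⟨22, 2⟩ ⟨5, 2⟩ ⟨5, 2⟩ ⨾ .realOp .mul ⟨22, 3⟩ ⟨5, 2⟩ ⟨5, 2⟩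

theorem exec_levelZero {n : ℕ} (f : C(Sph n, ℝ)) {N d J : ℕ} {s : State} (h : Config N d J s) :
    HoldsLevel N J 0 21 22 (levelZero.exec f s) := by
  refine ⟨by simp [levelZero, nodeCount], fun q hq => ?_, fun q hq => ?_⟩
  · simp only [nodeCount] at hq
    have : q = 0 ∨ q = 1 := by omega
    rcases this with rfl | rfl
    · simp [levelZero, h.zero, h.one, h.unit, flatCoord, nodeCoord]
    · simp [levelZero, h.zero, h.one, h.unit, h.two, flatCoord, nodeCoord]
      norm_num
  · simp only [nodeCount] at hq
    have : q = 0 ∨ q = 1 := by omega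
    rcases this with rfl | rfl <;> simp [levelZero, h.zero, h.one, h.unit, nodeWeight]

/-- Register use in the construction of a level: `8` counts the angles and `11` the old nodes, `12`
is the address of the first coordinate of the current old node, `13` and `15` are the write
positions for weights and coordinates, `16` holds L + 1, and `17` is the read position. -/
def copyCoord (a a' : ℕ) : Prog :=
  .realOp .mul ⟨a', 15⟩ ⟨a, 17⟩ ⟨11, 8⟩ ⨾ .natAdd 15 15 3 ⨾ .natAdd 17 17 3

def newNodeInit (a' : ℕ) : Prog :=
  .realOp .mul ⟨a', 15⟩ ⟨10, 8⟩ ⟨5, 2⟩ ⨾ .natAdd 15 15 3 ⨾ .natAdd 17 12 2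

def newNode (o a b a' b' : ℕ) : Prog :=
  newNodeInit a' ⨾ .loop 16 (copyCoord a a') ⨾
  .realOp .mul ⟨b', 13⟩ ⟨b, 11⟩ ⟨o, 8⟩ ⨾ .natAdd 13 13 3 ⨾ .natAdd 8 8 3

def newNodes (o a b a' b' : ℕ) : Prog :=
  .natConst 8 0 ⨾ .loop 4 (newNode o a b a' b') ⨾ .natAdd 11 11 3 ⨾ .natAdd 12 12 16

def nextLevelInit (L : ℕ) : Prog :=
  .natConst 16 (L + 1) ⨾ .natConst 11 0 ⨾ .natConst 12 0 ⨾ .natConst 13 0 ⨾ .natConst 15 0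

/-- Computation of the product rule in dimension `L + 2` from that in dimension `L + 1`. -/
def nextLevel (L o a b a' b' : ℕ) : Prog :=
  nextLevelInit L ⨾ .loop 10 (newNodes o a b a' b') ⨾ .natAdd 10 13 2

theorem flatCoord_succ_first (N L u : ℕ) {k : ℕ} (hk : k < N) :
    flatCoord N (L + 1) ((L + 2) * (u * N + k)) = Real.cos (nodeAngle N k) := by
  have := flatCoord_mul_add N (L + 1) (u * N + k) (Nat.zero_le _)
  rw [add_zero] at this
  rw [this, nodeCoord, Nat.mul_add_mod', Nat.mod_eq_of_lt hk]

theorem flatCoord_succ_next (N L u : ℕ) {k j : ℕ} (hk : k < N) (hj : j < L + 1) :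
    flatCoord N (L + 1) ((L + 2) * (u * N + k) + 1 + j) =
      flatCoord N L ((L + 1) * u + j) * Real.sin (nodeAngle N k) := by
  have := flatCoord_mul_add N (L + 1) (u * N + k) (j := j + 1) (by omega)
  rw [add_assoc, add_comm 1 j, this, nodeCoord, Nat.mul_add_mod', Nat.mod_eq_of_lt hk,
    mul_comm u N, Nat.mul_add_div (by omega), Nat.div_eq_of_lt hk, add_zero,
    flatCoord_mul_add _ _ _ (by omega)]

theorem nodeWeight_succ_mul_add (N J L u : ℕ) {k : ℕ} (hk : k < N) :
    nodeWeight N J (L + 1) (u * N + k) = nodeWeight N J L u * angleWeight N J L k := by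
  rw [nodeWeight, Nat.mul_add_mod', Nat.mod_eq_of_lt hk, mul_comm u N,
    Nat.mul_add_div (by omega), Nat.div_eq_of_lt hk, add_zero]

/-- The requirements on the arrays used in the construction of the next level. -/
structure Separate (o a b a' b' : ℕ) : Prop where
  oa : o ≠ a'
  ob : o ≠ b'
  aa : a ≠ a'
  ab : a ≠ b'
  ba : b ≠ a'
  bb : b ≠ b'
  dst : a' ≠ b'
  dst_a : a' ∉ [5, 6, 10, 11]
  dst_b : b' ∉ [5, 6, 10, 11]

/-- The data which are available during the construction of the next level. -/
structure LevelData (N d J L o a b : ℕ) (s : State) : Prop where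
  config : Config N d J s
  tables : Tables N s
  angles : s.Lists o N (angleWeight N J L)
  level : HoldsLevel N J L a b s

theorem LevelData.of_agrees {N d J L o a b : ℕ} {s s' : State} {P : Prog}
    (h : LevelData N d J L o a b s) (hA : P.Agrees s s') (hK : P.Keeps) (h10 : ¬P.WritesReg 10)
    (hw : ∀ x ∈ [10, 11, o, a, b], ¬P.WritesArr x) : LevelData N d J L o a b s' where
  config := h.config.of_agrees hA hK
  tables := h.tables.of_agrees hA (hw 10 (by simp)) (hw 11 (by simp))
  angles := h.angles.congr (hA.2 o (hw o (by simp)))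
  level := ⟨(hA.1 10 h10).trans h.level.count, h.level.coords.congr (hA.2 a (hw a (by simp))),
    h.level.weights.congr (hA.2 b (hw b (by simp)))⟩

/-- The first coordinate, the cosine, has already been written. The loop appends the L + 1 old
coordinates times the sine, which completes a block of length L + 2. -/
theorem exec_copyCoords {n : ℕ} (f : C(Sph n, ℝ)) {N d J L o a b a' b' u k : ℕ} {s : State}
    (hS : Separate o a b a' b') (h : LevelData N d J L o a b s) (hu : u < nodeCount N L)
    (hk : k < N) (r8 : s.reg 8 = k) (r15 : s.reg 15 = (L + 2) * (u * N + k) + 1)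
    (r16 : s.reg 16 = L + 1) (r17 : s.reg 17 = (L + 1) * u)
    (hl : s.Lists a' ((L + 2) * (u * N + k) + 1) (flatCoord N (L + 1))) :
    ((Prog.loop 16 (copyCoord a a')).exec f s).reg 15 = (L + 2) * (u * N + k + 1) ∧
      ((Prog.loop 16 (copyCoord a a')).exec f s).Lists a' ((L + 2) * (u * N + k + 1))
        (flatCoord N (L + 1)) := by
  obtain ⟨hoa, hob, haa, hab, hba, hbb, hd, hda, hdb⟩ := hS
  simp only [List.mem_cons, List.not_mem_nil, or_false, not_or] at hda hdb
  have key := exec_loop_invariant f (r := 16) (s := s) (P := copyCoord a a')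
    (fun j s' => s'.reg 15 = (L + 2) * (u * N + k) + 1 + j ∧ s'.reg 17 = (L + 1) * u + j ∧
      s'.Lists a' ((L + 2) * (u * N + k) + 1 + j) (flatCoord N (L + 1))) ?_ ?_
  · rw [r16] at key
    have e : (L + 2) * (u * N + k) + 1 + (L + 1) = (L + 2) * (u * N + k + 1) := by ring
    rw [e] at key
    exact ⟨key.1, key.2.2⟩
  · exact ⟨r15, r17, hl⟩
  · rintro j s' hj hA ⟨i1, i2, i3⟩
    rw [r16] at hj
    have h' := h.of_agrees hA
      (by simp [Prog.Keeps, copyCoord, Prog.WritesReg, Prog.WritesArr, eq_comm, hda])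
      (by simp [copyCoord, Prog.WritesReg])
      (by simp [copyCoord, Prog.WritesArr, Ne.symm hda.2.2.1, Ne.symm hda.2.2.2, hoa, haa, hba])
    have e8 : s'.reg 8 = k := by rw [hA.1 8 (by simp [copyCoord, Prog.WritesReg]), r8]
    refine ⟨by simp [copyCoord, i1, h'.config.one]; ring,
      by simp [copyCoord, i2, h'.config.one]; ring, i3.snoc fun q => ?_⟩
    have hlt : (L + 1) * u + j < (L + 1) * nodeCount N L := by
      have := Nat.mul_le_mul_left (L + 1) (Nat.succ_le_of_lt hu)
      rw [Nat.mul_succ] at this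
      omega
    simp only [copyCoord, exec_seq, exec_mul, exec_natAdd, State.setReg_arr, State.tick_arr,
      State.setCell_arr, true_and, State.tick_reg, i1, i2, e8, flatCoord_succ_next N L u hk hj,
      h'.level.coords _ hlt, h'.tables.sin _ hk]

theorem exec_newNode {n : ℕ} (f : C(Sph n, ℝ)) {N d J L o a b a' b' u k : ℕ} {s : State}
    (hS : Separate o a b a' b') (h : LevelData N d J L o a b s) (hu : u < nodeCount N L)
    (hk : k < N) (r8 : s.reg 8 = k) (r11 : s.reg 11 = u) (r12 : s.reg 12 = (L + 1) * u)
    (r13 : s.reg 13 = u * N + k) (r15 : s.reg 15 = (L + 2) * (u * N + k))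
    (r16 : s.reg 16 = L + 1)
    (hl : s.Lists a' ((L + 2) * (u * N + k)) (flatCoord N (L + 1)))
    (hl' : s.Lists b' (u * N + k) (nodeWeight N J (L + 1))) :
    ((newNode o a b a' b').exec f s).reg 8 = k + 1 ∧
      ((newNode o a b a' b').exec f s).reg 13 = u * N + k + 1 ∧
      ((newNode o a b a' b').exec f s).reg 15 = (L + 2) * (u * N + k + 1) ∧
      ((newNode o a b a' b').exec f s).Lists a' ((L + 2) * (u * N + k + 1))
        (flatCoord N (L + 1)) ∧
      ((newNode o a b a' b').exec f s).Lists b' (u * N + k + 1) (nodeWeight N J (L + 1)) := by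
  have hS' := hS
  obtain ⟨hoa, hob, haa, hab, hba, hbb, hd, hda, hdb⟩ := hS'
  simp only [List.mem_cons, List.not_mem_nil, or_false, not_or] at hda hdb
  obtain ⟨s₁, hs₁⟩ : ∃ s₁, s₁ = (newNodeInit a').exec f s := ⟨_, rfl⟩
  have hA₁ : (newNodeInit a').Agrees s s₁ := hs₁ ▸ exec_agrees f _ _
  have h₁ := h.of_agrees hA₁
    (by simp [Prog.Keeps, newNodeInit, Prog.WritesReg, Prog.WritesArr, eq_comm, hda])
    (by simp [newNodeInit, Prog.WritesReg])
    (by simp [newNodeInit, Prog.WritesArr, Ne.symm hda.2.2.1, Ne.symm hda.2.2.2, hoa, haa, hba])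
  have p := exec_copyCoords f hS h₁ hu hk
    (by rw [hA₁.1 8 (by simp [newNodeInit, Prog.WritesReg]), r8])
    (by simp [hs₁, newNodeInit, r15, h.config.one])
    (by rw [hA₁.1 16 (by simp [newNodeInit, Prog.WritesReg]), r16])
    (by simp [hs₁, newNodeInit, r12, h.config.zero])
    (hl.snoc fun q => by
      simp [hs₁, newNodeInit, r15, r8, h.config.zero, h.config.unit, h.tables.cos k hk,
        flatCoord_succ_first N L u hk])
  obtain ⟨s₂, hs₂⟩ : ∃ s₂, s₂ = (Prog.loop 16 (copyCoord a a')).exec f s₁ := ⟨_, rfl⟩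
  have hA₂ : (Prog.loop 16 (copyCoord a a')).Agrees s₁ s₂ := hs₂ ▸ exec_agrees f _ _
  have h₂ := h₁.of_agrees hA₂
    (by simp [Prog.Keeps, copyCoord, Prog.WritesReg, Prog.WritesArr, eq_comm, hda])
    (by simp [copyCoord, Prog.WritesReg])
    (by simp [copyCoord, Prog.WritesArr, Ne.symm hda.2.2.1, Ne.symm hda.2.2.2, hoa, haa, hba])
  rw [← hs₂] at p
  have hr : ∀ q ∈ [8, 11, 13], s₂.reg q = s.reg q := fun q hq => by
    simp only [List.mem_cons, List.not_mem_nil, or_false] at hq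
    rw [hA₂.1 q (by rcases hq with rfl | rfl | rfl <;> simp [copyCoord, Prog.WritesReg]),
      hA₁.1 q (by rcases hq with rfl | rfl | rfl <;> simp [newNodeInit, Prog.WritesReg])]
  have e8 : s₂.reg 8 = k := (hr 8 (by simp)).trans r8
  have e11 : s₂.reg 11 = u := (hr 11 (by simp)).trans r11
  have e13 : s₂.reg 13 = u * N + k := (hr 13 (by simp)).trans r13
  have e' : s₂.arr b' = s.arr b' := by
    rw [hA₂.2 b' (by simp [copyCoord, Prog.WritesArr, Ne.symm hd]),
      hA₁.2 b' (by simp [newNodeInit, Prog.WritesArr, Ne.symm hd])]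
  rw [newNode, exec_seq, exec_seq, ← hs₁, ← hs₂]
  refine ⟨by simp [e8, h₂.config.one], by simp [e13, h₂.config.one], by simp [p.1],
    p.2.congr ?_, hl'.snoc fun q => ?_⟩
  · funext q
    simp [hd]
  · simp only [exec_seq, exec_mul, exec_natAdd, State.setReg_arr, State.tick_arr,
      State.setCell_arr, true_and, State.tick_reg, e13, e11, e8, h₂.level.weights u hu,
      h₂.angles k hk, nodeWeight_succ_mul_add N J L u hk, e']

theorem exec_newNodes {n : ℕ} (f : C(Sph n, ℝ)) {N d J L o a b a' b' u : ℕ} {s : State}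
    (hS : Separate o a b a' b') (h : LevelData N d J L o a b s) (hu : u < nodeCount N L)
    (r11 : s.reg 11 = u) (r12 : s.reg 12 = (L + 1) * u)
    (r13 : s.reg 13 = u * N) (r15 : s.reg 15 = (L + 2) * (u * N)) (r16 : s.reg 16 = L + 1)
    (hl : s.Lists a' ((L + 2) * (u * N)) (flatCoord N (L + 1)))
    (hl' : s.Lists b' (u * N) (nodeWeight N J (L + 1))) :
    ((newNodes o a b a' b').exec f s).reg 11 = u + 1 ∧
      ((newNodes o a b a' b').exec f s).reg 12 = (L + 1) * (u + 1) ∧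
      ((newNodes o a b a' b').exec f s).reg 13 = (u + 1) * N ∧
      ((newNodes o a b a' b').exec f s).reg 15 = (L + 2) * ((u + 1) * N) ∧
      ((newNodes o a b a' b').exec f s).Lists a' ((L + 2) * ((u + 1) * N))
        (flatCoord N (L + 1)) ∧
      ((newNodes o a b a' b').exec f s).Lists b' ((u + 1) * N) (nodeWeight N J (L + 1)) := by
  have hS' := hS
  obtain ⟨hoa, hob, haa, hab, hba, hbb, hd, hda, hdb⟩ := hS'
  simp only [List.mem_cons, List.not_mem_nil, or_false, not_or] at hda hdb
  obtain ⟨s₁, hs₁⟩ : ∃ s₁, s₁ = (Prog.natConst 8 0).exec f s := ⟨_, rfl⟩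
  have hA₁ : (Prog.natConst 8 0).Agrees s s₁ := hs₁ ▸ exec_agrees f _ _
  have h₁ := h.of_agrees hA₁ (by simp [Prog.Keeps, Prog.WritesReg, Prog.WritesArr])
    (by simp [Prog.WritesReg]) (by simp [Prog.WritesArr])
  have hr₁ : ∀ q, q ≠ 8 → s₁.reg q = s.reg q := fun q hq => hA₁.1 q hq
  have ha₁ : ∀ q, s₁.arr q = s.arr q := fun q => hA₁.2 q (by simp [Prog.WritesArr])
  have key := exec_loop_invariant f (r := 4) (s := s₁) (P := newNode o a b a' b')
    (fun k s' => s'.reg 8 = k ∧ s'.reg 13 = u * N + k ∧ s'.reg 15 = (L + 2) * (u * N + k) ∧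
      s'.Lists a' ((L + 2) * (u * N + k)) (flatCoord N (L + 1)) ∧
      s'.Lists b' (u * N + k) (nodeWeight N J (L + 1))) ?_ ?_
  · obtain ⟨s₂, hs₂⟩ : ∃ s₂, s₂ = (Prog.loop 4 (newNode o a b a' b')).exec f s₁ := ⟨_, rfl⟩
    have hA₂ : (Prog.loop 4 (newNode o a b a' b')).Agrees s₁ s₂ := hs₂ ▸ exec_agrees f _ _
    have hW : ∀ q ∈ [3, 11, 12, 16], ¬(Prog.loop 4 (newNode o a b a' b')).WritesReg q := by
      simp [newNode, newNodeInit, copyCoord, Prog.WritesReg]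
    rw [← hs₂, h₁.config.size, ← Nat.succ_mul] at key
    rw [newNodes, exec_seq, exec_seq, ← hs₁, ← hs₂]
    have e3 : s₂.reg 3 = 1 := by rw [hA₂.1 3 (hW 3 (by simp)), h₁.config.one]
    have e11 : s₂.reg 11 = u := by
      rw [hA₂.1 11 (hW 11 (by simp)), hr₁ 11 (by simp), r11]
    have e12 : s₂.reg 12 = (L + 1) * u := by
      rw [hA₂.1 12 (hW 12 (by simp)), hr₁ 12 (by simp), r12]
    have e16 : s₂.reg 16 = L + 1 := by
      rw [hA₂.1 16 (hW 16 (by simp)), hr₁ 16 (by simp), r16]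
    refine ⟨by simp [e3, e11], by simp [e12, e16]; ring, by simp [key.2.1],
      by simp [key.2.2.1], key.2.2.2.1.congr rfl, key.2.2.2.2.congr rfl⟩
  · refine ⟨by simp [hs₁], by simpa [hr₁] using r13, by simpa [hr₁] using r15, hl.congr (ha₁ _),
      hl'.congr (ha₁ _)⟩
  · rintro k s' hk hA ⟨i1, i2, i3, i4, i5⟩
    rw [h₁.config.size] at hk
    have hW : ∀ q ∈ [11, 12, 16], ¬(newNode o a b a' b').WritesReg q := by
      simp [newNode, newNodeInit, copyCoord, Prog.WritesReg]
    exact exec_newNode f hS (h₁.of_agrees hA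
      (by simp [Prog.Keeps, newNode, newNodeInit, copyCoord, Prog.WritesReg, Prog.WritesArr,
        eq_comm, hda, hdb])
      (by simp [newNode, newNodeInit, copyCoord, Prog.WritesReg])
      (by simp [newNode, newNodeInit, copyCoord, Prog.WritesArr, Ne.symm hda.2.2.1,
        Ne.symm hda.2.2.2, Ne.symm hdb.2.2.1, Ne.symm hdb.2.2.2, hoa, haa, hba, hob, hab, hbb]))
      hu hk i1
      (by rw [hA.1 11 (hW 11 (by simp)), hr₁ 11 (by simp), r11])
      (by rw [hA.1 12 (hW 12 (by simp)), hr₁ 12 (by simp), r12]) i2 i3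
      (by rw [hA.1 16 (hW 16 (by simp)), hr₁ 16 (by simp), r16]) i4 i5

/-- Three nested loops run over old nodes, angles and coordinates. The new node from the old node u
and the angle k has number u N + k, so output is written in order and an invariant only has to say
how much has been filled; `Separate` protects the sources. -/
theorem exec_nextLevel {n : ℕ} (f : C(Sph n, ℝ)) {N d J L o a b a' b' : ℕ} {s : State}
    (hS : Separate o a b a' b') (h : LevelData N d J L o a b s) :
    HoldsLevel N J (L + 1) a' b' ((nextLevel L o a b a' b').exec f s) := by
  have hS' := hS
  obtain ⟨hoa, hob, haa, hab, hba, hbb, hd, hda, hdb⟩ := hS'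
  simp only [List.mem_cons, List.not_mem_nil, or_false, not_or] at hda hdb
  obtain ⟨s₁, hs₁⟩ : ∃ s₁, s₁ = (nextLevelInit L).exec f s := ⟨_, rfl⟩
  have hA₁ : (nextLevelInit L).Agrees s s₁ := hs₁ ▸ exec_agrees f _ _
  have h₁ := h.of_agrees hA₁ (by simp [Prog.Keeps, nextLevelInit, Prog.WritesReg, Prog.WritesArr])
    (by simp [nextLevelInit, Prog.WritesReg]) (by simp [nextLevelInit, Prog.WritesArr])
  have key := exec_loop_invariant f (r := 10) (s := s₁) (P := newNodes o a b a' b')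
    (fun u s' => s'.reg 11 = u ∧ s'.reg 12 = (L + 1) * u ∧ s'.reg 13 = u * N ∧
      s'.reg 15 = (L + 2) * (u * N) ∧
      s'.Lists a' ((L + 2) * (u * N)) (flatCoord N (L + 1)) ∧
      s'.Lists b' (u * N) (nodeWeight N J (L + 1))) ?_ ?_
  · obtain ⟨s₂, hs₂⟩ : ∃ s₂, s₂ = (Prog.loop 10 (newNodes o a b a' b')).exec f s₁ := ⟨_, rfl⟩
    have hA₂ : (Prog.loop 10 (newNodes o a b a' b')).Agrees s₁ s₂ := hs₂ ▸ exec_agrees f _ _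
    have e2 : s₂.reg 2 = 0 := by
      rw [hA₂.1 2 (by simp [newNodes, newNode, newNodeInit, copyCoord, Prog.WritesReg]),
        h₁.config.zero]
    rw [← hs₂, h₁.level.count] at key
    rw [nextLevel, exec_seq, exec_seq, ← hs₁, ← hs₂]
    exact ⟨by simp [key.2.2.1, e2, nodeCount], key.2.2.2.2.1.congr rfl,
      key.2.2.2.2.2.congr rfl⟩
  · refine ⟨?_, ?_, ?_, ?_, ?_, ?_⟩ <;> simp [hs₁, nextLevelInit, State.lists_zero]
  · rintro u s' hu hA ⟨i1, i2, i3, i4, i5, i6⟩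
    rw [h₁.level.count] at hu
    exact exec_newNodes f hS (h₁.of_agrees hA
      (by simp [Prog.Keeps, newNodes, newNode, newNodeInit, copyCoord, Prog.WritesReg,
        Prog.WritesArr, eq_comm, hda, hdb])
      (by simp [newNodes, newNode, newNodeInit, copyCoord, Prog.WritesReg])
      (by simp [newNodes, newNode, newNodeInit, copyCoord, Prog.WritesArr, Ne.symm hda.2.2.1,
        Ne.symm hda.2.2.2, Ne.symm hdb.2.2.1, Ne.symm hdb.2.2.2, hoa, haa, hba, hob, hab, hbb]))
      hu i1 i2 i3 i4
      (by
        rw [hA.1 16 (by simp [newNodes, newNode, newNodeInit, copyCoord, Prog.WritesReg])]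
        simp [hs₁, nextLevelInit])
      i5 i6


/-! ### Iteration over the dimension. -/

def nextAngleWeights (a b : ℕ) : Prog :=
  .natConst 8 0 ⨾ .loop 4
    (.realOp .mul ⟨16, 2⟩ ⟨a, 8⟩ ⟨11, 8⟩ ⨾ .realOp .mul ⟨b, 8⟩ ⟨16, 2⟩ ⟨11, 8⟩ ⨾ .natAdd 8 8 3)

theorem exec_nextAngleWeights {n : ℕ} (f : C(Sph n, ℝ)) {N d J L a b : ℕ} {s : State}
    (h : Config N d J s) (hT : Tables N s) (ha : s.Lists a N (angleWeight N J L))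
    (hab : a ≠ b) (ha' : a ≠ 16) (hb' : b ≠ 16) (hb : b ∉ [5, 6, 10, 11]) :
    ((nextAngleWeights a b).exec f s).Lists b N (angleWeight N J (L + 2)) := by
  simp only [List.mem_cons, List.not_mem_nil, or_false, not_or] at hb
  obtain ⟨s₁, hs₁⟩ : ∃ s₁, s₁ = (Prog.natConst 8 0).exec f s := ⟨_, rfl⟩
  have hA₁ : (Prog.natConst 8 0).Agrees s s₁ := hs₁ ▸ exec_agrees f _ _
  have h₁ := h.of_agrees hA₁ (by simp [Prog.Keeps, Prog.WritesReg, Prog.WritesArr])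
  have hT₁ := hT.of_agrees hA₁ (by simp [Prog.WritesArr]) (by simp [Prog.WritesArr])
  have ha₁ := ha.congr (s' := s₁) (hA₁.2 a (by simp [Prog.WritesArr]))
  have key := exec_loop_invariant f (r := 4) (s := s₁)
    (P := .realOp .mul ⟨16, 2⟩ ⟨a, 8⟩ ⟨11, 8⟩ ⨾ .realOp .mul ⟨b, 8⟩ ⟨16, 2⟩ ⟨11, 8⟩ ⨾
      .natAdd 8 8 3)
    (fun k s' => s'.reg 8 = k ∧ s'.Lists b k (angleWeight N J (L + 2))) ?_ ?_
  · rw [nextAngleWeights, exec_seq, ← hs₁]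
    rw [h₁.size] at key
    exact key.2
  · exact ⟨by simp [hs₁], State.lists_zero _ _ _⟩
  · rintro k s' hk hA ⟨i1, i2⟩
    rw [h₁.size] at hk
    have hc := h₁.of_agrees hA
      (by simp [Prog.Keeps, Prog.WritesReg, Prog.WritesArr, eq_comm, hb])
    have e11 : s'.arr 11 k = Real.sin (nodeAngle N k) := by
      rw [hA.2 11 (by simp [Prog.WritesArr, Ne.symm hb.2.2.2])]
      exact hT₁.sin k hk
    have ea : s'.arr a k = angleWeight N J L k := by
      rw [hA.2 a (by simp [Prog.WritesArr, ha', hab])]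
      exact ha₁ k hk
    refine ⟨by simp [i1, hc.one], i2.snoc fun q => ?_⟩
    simp [i1, hc.zero, e11, ea, hb', angleWeight]

/-- Computation of the product rule in dimension `L + 1`. -/
def levels : ℕ → Prog
  | 0 => levelZero
  | L + 1 => levels L ⨾
    nextLevel L (3 * L + 20) (3 * L + 21) (3 * L + 22) (3 * L + 24) (3 * L + 25) ⨾
    nextAngleWeights (3 * L + 20) (3 * L + 26)

theorem keeps_nextLevel {L o a b a' b' : ℕ} (ha : a' ∉ [5, 6, 10, 11])
    (hb : b' ∉ [5, 6, 10, 11]) : (nextLevel L o a b a' b').Keeps := by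
  simp only [List.mem_cons, List.not_mem_nil, or_false, not_or] at ha hb
  simp [Prog.Keeps, nextLevel, nextLevelInit, newNodes, newNode, newNodeInit, copyCoord,
    Prog.WritesReg, Prog.WritesArr, eq_comm, ha, hb]

theorem nextLevel_not_writesArr {L o a b a' b' x : ℕ} (ha : x ≠ a') (hb : x ≠ b') :
    ¬(nextLevel L o a b a' b').WritesArr x := by
  simp [nextLevel, nextLevelInit, newNodes, newNode, newNodeInit, copyCoord, Prog.WritesArr, ha, hb]

/-- The recursion for the angular weights advances the exponent by two, so the tables for L and L +
1 are kept together. Raising L by one shifts the array names by three, which makes the array 3L + 23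
the current table of the next level. -/
theorem exec_levels {n : ℕ} (f : C(Sph n, ℝ)) {N d J : ℕ} {s : State}
    (h : Config N d J s) (hT : Tables N s) (h20 : s.Lists 20 N (angleWeight N J 0))
    (h23 : s.Lists 23 N (angleWeight N J 1)) (L : ℕ) :
    LevelData N d J L (3 * L + 20) (3 * L + 21) (3 * L + 22) ((levels L).exec f s) ∧
      ((levels L).exec f s).Lists (3 * L + 23) N (angleWeight N J (L + 1)) := by
  induction L with
  | zero =>
    have hA := exec_agrees f levelZero s
    exact ⟨⟨h.of_agrees hA (by simp [Prog.Keeps, levelZero, Prog.WritesReg, Prog.WritesArr]),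
      hT.of_agrees hA (by simp [levelZero, Prog.WritesArr]) (by simp [levelZero, Prog.WritesArr]),
      h20.congr (hA.2 20 (by simp [levelZero, Prog.WritesArr])), exec_levelZero f h⟩,
      h23.congr (hA.2 23 (by simp [levelZero, Prog.WritesArr]))⟩
  | succ L ih =>
    obtain ⟨hD, h1⟩ := ih
    rw [levels, exec_seq, exec_seq]
    obtain ⟨s₀, hs₀⟩ : ∃ s₀, s₀ = (levels L).exec f s := ⟨_, rfl⟩
    rw [← hs₀] at hD h1 ⊢
    have hL := exec_nextLevel f (a' := 3 * L + 24) (b' := 3 * L + 25)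
      ⟨by omega, by omega, by omega, by omega, by omega, by omega, by omega, by simp, by simp⟩ hD
    obtain ⟨s₁, hs₁⟩ : ∃ s₁, s₁ = (nextLevel L (3 * L + 20) (3 * L + 21) (3 * L + 22)
      (3 * L + 24) (3 * L + 25)).exec f s₀ := ⟨_, rfl⟩
    have hA₁ : (nextLevel L (3 * L + 20) (3 * L + 21) (3 * L + 22)
      (3 * L + 24) (3 * L + 25)).Agrees s₀ s₁ := hs₁ ▸ exec_agrees f _ _
    rw [← hs₁] at hL ⊢
    have hc₁ := hD.config.of_agrees hA₁ (keeps_nextLevel (by simp) (by simp))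
    have hT₁ := hD.tables.of_agrees hA₁ (nextLevel_not_writesArr (by omega) (by omega))
      (nextLevel_not_writesArr (by omega) (by omega))
    have ho := hD.angles.congr (hA₁.2 _ (nextLevel_not_writesArr (by omega) (by omega)))
    have ho' := h1.congr (hA₁.2 _ (nextLevel_not_writesArr (by omega) (by omega)))
    have hA₂ := exec_agrees f (nextAngleWeights (3 * L + 20) (3 * L + 26)) s₁
    have hw : ∀ x, x ≠ 16 → x ≠ 3 * L + 26 →
        ¬(nextAngleWeights (3 * L + 20) (3 * L + 26)).WritesArr x := fun x h h' => by
      simp [nextAngleWeights, Prog.WritesArr, h, h']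
    refine ⟨⟨hc₁.of_agrees hA₂ ?_, hT₁.of_agrees hA₂ (hw _ (by omega) (by omega))
      (hw _ (by omega) (by omega)), ?_, ⟨?_, ?_, ?_⟩⟩, ?_⟩
    · simp [Prog.Keeps, nextAngleWeights, Prog.WritesReg, Prog.WritesArr]
    · exact ho'.congr (hA₂.2 _ (hw _ (by omega) (by omega)))
    · rw [hA₂.1 10 (by simp [nextAngleWeights, Prog.WritesReg])]
      exact hL.count
    · exact hL.coords.congr (hA₂.2 _ (hw _ (by omega) (by omega)))
    · exact hL.weights.congr (hA₂.2 _ (hw _ (by omega) (by omega)))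
    · exact exec_nextAngleWeights f hc₁ hT₁ ho (by omega) (by omega) (by omega) (by simp)

/-! ### Evaluation at the nodes -/

theorem blackBox_coe {n : ℕ} (f : C(Sph n, ℝ)) (z : Sph n) : blackBox f z.1 = f z :=
  dif_pos z.2

def evalNode : Prog :=
  .query ⟨16, 2⟩ ⟨0, 12⟩ ⨾ .realOp .mul ⟨2, 11⟩ ⟨1, 11⟩ ⟨16, 2⟩ ⨾
  .realOp .add ⟨17, 2⟩ ⟨17, 2⟩ ⟨1, 11⟩ ⨾ .natAdd 11 11 3 ⨾ .natAdd 12 12 14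

def evalNodesInit (n : ℕ) : Prog :=
  .natConst 14 n ⨾ .natConst 11 0 ⨾ .natConst 12 0 ⨾ .realOp .sub ⟨17, 2⟩ ⟨5, 2⟩ ⟨5, 2⟩

/-- Evaluation of `f` at the nodes, and computation of the measure of the sphere as the sum of the
weights. -/
def evalNodes (n : ℕ) : Prog := evalNodesInit n ⨾ .loop 10 evalNode

theorem exec_evalNodes {N d J L : ℕ} (f : C(Sph (L + 1), ℝ)) {s : State} (h : Config N d J s)
    (hL : HoldsLevel N J L 0 1 s) (hN : 2 * J < N) (hJ : L ≤ 2 * J) :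
    Config N d J ((evalNodes (L + 1)).exec f s) ∧
      HoldsLevel N J L 0 1 ((evalNodes (L + 1)).exec f s) ∧
      ((evalNodes (L + 1)).exec f s).Lists 2 (nodeCount N L)
        (fun v => nodeWeight N J L v * f (nodePoint N L v)) ∧
      ((evalNodes (L + 1)).exec f s).arr 17 0 = (sphMeasure (L + 1)).real Set.univ ∧
      ((evalNodes (L + 1)).exec f s).reg 14 = L + 1 := by
  have hA := exec_agrees f (evalNodes (L + 1)) s
  refine ⟨h.of_agrees hA (by simp [Prog.Keeps, evalNodes, evalNodesInit, evalNode, Prog.WritesReg,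
    Prog.WritesArr]), ⟨?_, ?_, ?_⟩, ?_⟩
  · rw [hA.1 10 (by simp [evalNodes, evalNodesInit, evalNode, Prog.WritesReg]), hL.count]
  · exact hL.coords.congr (hA.2 0 (by simp [evalNodes, evalNodesInit, evalNode, Prog.WritesArr]))
  · exact hL.weights.congr (hA.2 1 (by simp [evalNodes, evalNodesInit, evalNode, Prog.WritesArr]))
  obtain ⟨s₁, hs₁⟩ : ∃ s₁, s₁ = (evalNodesInit (L + 1)).exec f s := ⟨_, rfl⟩
  have hA₁ : (evalNodesInit (L + 1)).Agrees s s₁ := hs₁ ▸ exec_agrees f _ _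
  have h₁ := h.of_agrees hA₁ (by simp [Prog.Keeps, evalNodesInit, Prog.WritesReg, Prog.WritesArr])
  have hr : s₁.reg 10 = nodeCount N L := by
    rw [hA₁.1 10 (by simp [evalNodesInit, Prog.WritesReg]), hL.count]
  have key := exec_loop_invariant f (r := 10) (s := s₁) (P := evalNode)
    (fun v s' => s'.reg 11 = v ∧ s'.reg 12 = (L + 1) * v ∧
      s'.Lists 2 v (fun v => nodeWeight N J L v * f (nodePoint N L v)) ∧
      s'.arr 17 0 = ∑ w ∈ Finset.range v, nodeWeight N J L w) ?_ ?_
  · rw [evalNodes, exec_seq, ← hs₁]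
    have e14 := (exec_agrees f (Prog.loop 10 evalNode) s₁).1 14 (by simp [evalNode, Prog.WritesReg])
    rw [hr] at key
    refine ⟨key.2.2.1, ?_, ?_⟩
    · rw [key.2.2.2, sum_nodeWeight hN hJ]
    · rw [e14, hs₁]
      simp [evalNodesInit]
  · refine ⟨?_, ?_, State.lists_zero _ _ _, ?_⟩ <;> simp [hs₁, evalNodesInit, h.zero]
  · rintro v s' hv hA ⟨i1, i2, i3, i4⟩
    rw [hr] at hv
    have hc := h₁.of_agrees hA (by simp [Prog.Keeps, evalNode, Prog.WritesReg, Prog.WritesArr])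
    have e14 : s'.reg 14 = L + 1 := by
      rw [hA.1 14 (by simp [evalNode, Prog.WritesReg]), hs₁]
      simp [evalNodesInit]
    have e0 : s'.arr 0 = s.arr 0 := by
      rw [hA.2 0 (by simp [evalNode, Prog.WritesArr]),
        hA₁.2 0 (by simp [evalNodesInit, Prog.WritesArr])]
    have e1 : s'.arr 1 v = nodeWeight N J L v := by
      rw [hA.2 1 (by simp [evalNode, Prog.WritesArr]),
        hA₁.2 1 (by simp [evalNodesInit, Prog.WritesArr]), hL.weights v hv]
    -- Register `12` is the address (L + 1) v of the node, so the black box receives a point on the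
    -- sphere and never its default value.
    have hp : s'.point (L + 1) ⟨0, 12⟩ = (nodePoint N L v).1 := by
      ext j
      change s'.arr 0 (s'.reg 12 + j) = _
      have hlt : (L + 1) * v + j < (L + 1) * nodeCount N L := by
        have := Nat.mul_le_mul_left (L + 1) (Nat.succ_le_of_lt hv)
        rw [Nat.mul_succ] at this
        have := j.2
        omega
      rw [i2, e0, hL.coords _ hlt, flatCoord_mul_add _ _ _ (by omega), nodePoint_apply]
    refine ⟨by simp [evalNode, i1, hc.one], by simp [evalNode, i2, e14]; ring,
      i3.snoc fun q => ?_, ?_⟩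
    · simp [evalNode, i1, hc.zero, e1, hp, blackBox_coe]
    · simp [evalNode, i1, hc.zero, e1, i4, Finset.sum_range_succ]

/-! ### Coefficients of the zonal polynomial -/

theorem coeff_legendre_add_two (n j k : ℕ) : (legendre n (j + 2)).coeff k =
    ((2 * (j : ℝ) + n) * (Polynomial.X * legendre n (j + 1)).coeff k -
      ((j : ℝ) + 1) * (legendre n j).coeff k) / ((j : ℝ) + n - 1) := by
  rw [legendre, Polynomial.coeff_C_mul, Polynomial.coeff_sub, mul_assoc, Polynomial.coeff_C_mul,
    Polynomial.coeff_C_mul]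
  ring

/-- Variable `4` becomes n / μ(S), the density in degree 1. Register `9` holds the number d + 1 of
coefficients, and register `12` the number d - 1 of recursion steps from degree 1 to degree d. -/
def zonalInit : Prog :=
  .realOfNat ⟨14, 2⟩ 14 ⨾ .realOp .div ⟨4, 2⟩ ⟨14, 2⟩ ⟨17, 2⟩ ⨾
  .natAdd 9 5 3 ⨾ .natSub 12 5 3 ⨾ .natConst 8 0

def clearStep : Prog :=
  .realOp .sub ⟨3, 8⟩ ⟨5, 2⟩ ⟨5, 2⟩ ⨾ .realOp .sub ⟨19, 8⟩ ⟨5, 2⟩ ⟨5, 2⟩ ⨾ .natAdd 8 8 3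

def legendreInit : Prog :=
  .realOp .mul ⟨3, 3⟩ ⟨5, 2⟩ ⟨5, 2⟩ ⨾ .realOp .mul ⟨19, 2⟩ ⟨5, 2⟩ ⟨5, 2⟩ ⨾ .natConst 11 0

/-- Variables `15`, `16`, `18` become j + n - 1, 2j + n and j + 1, and variable `4` is multiplied by
the ratio of consecutive densities. Variable `12` is zero, the coefficient of index -1 needed for
multiplication by X. -/
def legendreStepInit : Prog :=
  .realOfNat ⟨13, 2⟩ 11 ⨾
  .realOp .add ⟨15, 2⟩ ⟨13, 2⟩ ⟨14, 2⟩ ⨾ .realOp .sub ⟨15, 2⟩ ⟨15, 2⟩ ⟨5, 2⟩ ⨾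
  .realOp .add ⟨16, 2⟩ ⟨13, 2⟩ ⟨13, 2⟩ ⨾ .realOp .add ⟨16, 2⟩ ⟨16, 2⟩ ⟨14, 2⟩ ⨾
  .realOp .add ⟨17, 2⟩ ⟨16, 2⟩ ⟨6, 2⟩ ⨾ .realOp .add ⟨18, 2⟩ ⟨13, 2⟩ ⟨6, 2⟩ ⨾
  .realOp .mul ⟨17, 2⟩ ⟨17, 2⟩ ⟨15, 2⟩ ⨾ .realOp .mul ⟨18, 2⟩ ⟨16, 2⟩ ⟨18, 2⟩ ⨾
  .realOp .div ⟨17, 2⟩ ⟨17, 2⟩ ⟨18, 2⟩ ⨾ .realOp .mul ⟨4, 2⟩ ⟨4, 2⟩ ⟨17, 2⟩ ⨾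
  .realOp .add ⟨18, 2⟩ ⟨13, 2⟩ ⟨5, 2⟩ ⨾ .realOp .sub ⟨12, 2⟩ ⟨5, 2⟩ ⟨5, 2⟩ ⨾ .natConst 8 0

/-- The update is in place: variable `12` carries the old coefficient of index k - 1 of the current
polynomial, which array `3` has already lost, and array `19` takes over the old coefficient of index
k. -/
def coeffStep : Prog :=
  .realOp .mul ⟨7, 2⟩ ⟨16, 2⟩ ⟨12, 2⟩ ⨾ .realOp .mul ⟨8, 2⟩ ⟨18, 2⟩ ⟨19, 8⟩ ⨾
  .realOp .mul ⟨12, 2⟩ ⟨3, 8⟩ ⟨5, 2⟩ ⨾ .realOp .mul ⟨19, 8⟩ ⟨12, 2⟩ ⟨5, 2⟩ ⨾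
  .realOp .sub ⟨7, 2⟩ ⟨7, 2⟩ ⟨8, 2⟩ ⨾ .realOp .div ⟨3, 8⟩ ⟨7, 2⟩ ⟨15, 2⟩ ⨾ .natAdd 8 8 3

def legendreStep : Prog := legendreStepInit ⨾ .loop 9 coeffStep ⨾ .natAdd 11 11 3

def scaleStep : Prog := .realOp .mul ⟨3, 8⟩ ⟨3, 8⟩ ⟨4, 2⟩ ⨾ .natAdd 8 8 3

/-- The state during the recursion for the coefficients of the zonal polynomials. -/
structure LegendreData (N d J n j : ℕ) (s : State) : Prop where
  config : Config N d J s
  dim : s.arr 14 0 = n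
  length : s.reg 9 = d + 1
  counter : s.reg 11 = j
  density : s.arr 4 0 = dimDensity n (j + 1)
  cur : s.Lists 3 (d + 1) (legendre n (j + 1)).coeff
  prev : s.Lists 19 (d + 1) (legendre n j).coeff

theorem exec_legendreStep {n : ℕ} (f : C(Sph n, ℝ)) {N d J j : ℕ} {s : State}
    (h : LegendreData N d J n j s) : LegendreData N d J n (j + 1) (legendreStep.exec f s) := by
  obtain ⟨hc, h14, h9, h11, h4, h3, h19⟩ := h
  obtain ⟨s₁, hs₁⟩ : ∃ s₁, s₁ = legendreStepInit.exec f s := ⟨_, rfl⟩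
  have hA₁ : legendreStepInit.Agrees s s₁ := hs₁ ▸ exec_agrees f _ _
  have hc₁ := hc.of_agrees hA₁
    (by simp [Prog.Keeps, legendreStepInit, Prog.WritesReg, Prog.WritesArr])
  have e15 : s₁.arr 15 0 = (j : ℝ) + n - 1 := by
    simp [hs₁, legendreStepInit, hc.zero, hc.unit, h11, h14]
  have e16 : s₁.arr 16 0 = 2 * (j : ℝ) + n := by
    simp [hs₁, legendreStepInit, hc.zero, h11, h14]
    ring
  have e18 : s₁.arr 18 0 = (j : ℝ) + 1 := by
    simp [hs₁, legendreStepInit, hc.zero, hc.unit, h11]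
  have e4 : s₁.arr 4 0 = dimDensity n (j + 2) := by
    simp [hs₁, legendreStepInit, hc.zero, hc.unit, hc.two, h11, h14, h4]
    rw [dimDensity]
    ring
  have r9 : s₁.reg 9 = d + 1 := by
    rw [hA₁.1 9 (by simp [legendreStepInit, Prog.WritesReg]), h9]
  have a3 : s₁.arr 3 = s.arr 3 := hA₁.2 3 (by simp [legendreStepInit, Prog.WritesArr])
  have a19 : s₁.arr 19 = s.arr 19 := hA₁.2 19 (by simp [legendreStepInit, Prog.WritesArr])
  -- During the pass, both arrays hold the new polynomials below the index i and the old ones from i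
  -- on.
  have key := exec_loop_invariant f (r := 9) (s := s₁) (P := coeffStep)
    (fun i s' => s'.reg 8 = i ∧ s'.arr 12 0 = (Polynomial.X * legendre n (j + 1)).coeff i ∧
      s'.Lists 3 (d + 1)
        (fun k => if k < i then (legendre n (j + 2)).coeff k else (legendre n (j + 1)).coeff k) ∧
      s'.Lists 19 (d + 1)
        (fun k => if k < i then (legendre n (j + 1)).coeff k else (legendre n j).coeff k)) ?_ ?_
  · obtain ⟨s₂, hs₂⟩ : ∃ s₂, s₂ = (Prog.loop 9 coeffStep).exec f s₁ := ⟨_, rfl⟩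
    have hA₂ : (Prog.loop 9 coeffStep).Agrees s₁ s₂ := hs₂ ▸ exec_agrees f _ _
    have hc₂ := hc₁.of_agrees hA₂
      (by simp [Prog.Keeps, coeffStep, Prog.WritesReg, Prog.WritesArr])
    rw [legendreStep, exec_seq, exec_seq, ← hs₁, ← hs₂]
    rw [← hs₂, r9] at key
    refine ⟨hc₂.of_agrees (exec_agrees f _ _)
      (by simp [Prog.Keeps, Prog.WritesReg, Prog.WritesArr]), ?_, ?_, ?_, ?_, ?_, ?_⟩
    · simp only [exec_natAdd, State.setReg_arr, State.tick_arr]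
      rw [hA₂.2 14 (by simp [coeffStep, Prog.WritesArr]),
        hA₁.2 14 (by simp [legendreStepInit, Prog.WritesArr]), h14]
    · simp [hA₂.1 9 (by simp [coeffStep, Prog.WritesReg]), r9]
    · simp [hA₂.1 11 (by simp [coeffStep, Prog.WritesReg]), hc₂.one,
        hA₁.1 11 (by simp [legendreStepInit, Prog.WritesReg]), h11]
    · simp [hA₂.2 4 (by simp [coeffStep, Prog.WritesArr]), e4]
    · intro k hk
      simpa [hk] using key.2.2.1 k hk
    · intro k hk
      simpa [hk] using key.2.2.2 k hk
  · refine ⟨by simp [hs₁, legendreStepInit], ?_, ?_, ?_⟩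
    · simp [hs₁, legendreStepInit, hc.zero, hc.unit]
    · intro k hk
      simpa [a3] using h3 k hk
    · intro k hk
      simpa [a19] using h19 k hk
  · rintro i s' hi hA ⟨i1, i2, i3, i4⟩
    rw [r9] at hi
    have hc' := hc₁.of_agrees hA (by simp [Prog.Keeps, coeffStep, Prog.WritesReg, Prog.WritesArr])
    have f15 : s'.arr 15 0 = (j : ℝ) + n - 1 := by
      rw [hA.2 15 (by simp [coeffStep, Prog.WritesArr]), e15]
    have f16 : s'.arr 16 0 = 2 * (j : ℝ) + n := by
      rw [hA.2 16 (by simp [coeffStep, Prog.WritesArr]), e16]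
    have f18 : s'.arr 18 0 = (j : ℝ) + 1 := by
      rw [hA.2 18 (by simp [coeffStep, Prog.WritesArr]), e18]
    have c3 : s'.arr 3 i = (legendre n (j + 1)).coeff i := by simpa using i3 i hi
    have c19 : s'.arr 19 i = (legendre n j).coeff i := by simpa using i4 i hi
    have hif : ∀ (k : ℕ) (x y : ℝ), k ≠ i → (if k < i + 1 then x else y) = if k < i then x else y :=
      fun k x y hk => if_congr (by omega) rfl rfl
    refine ⟨by simp [coeffStep, i1, hc'.one], ?_, fun k hk => ?_, fun k hk => ?_⟩
    · simp [coeffStep, i1, hc'.zero, hc'.unit, c3, Polynomial.coeff_X_mul]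
    · by_cases hki : k = i
      · subst hki
        simp [coeffStep, i1, hc'.zero, i2, c19, f15, f16, f18, coeff_legendre_add_two]
      · beta_reduce
        rw [hif k _ _ hki]
        simpa [coeffStep, i1, hki] using i3 k hk
    · by_cases hki : k = i
      · subst hki
        simp [coeffStep, i1, hc'.zero, hc'.unit, c3]
      · beta_reduce
        rw [hif k _ _ hki]
        simpa [coeffStep, i1, hki] using i4 k hk

/-- Computation of the coefficients of the zonal polynomial. -/
def zonalCoeffs : Prog :=
  zonalInit ⨾ .loop 9 clearStep ⨾ legendreInit ⨾ .loop 12 legendreStep ⨾ .natConst 8 0 ⨾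
  .loop 9 scaleStep

theorem exec_legendreInit {n : ℕ} (f : C(Sph n, ℝ)) {N d J : ℕ} {s : State}
    (h : Config N d J s) (h17 : s.arr 17 0 = (sphMeasure n).real Set.univ) (h14 : s.reg 14 = n) :
    LegendreData N d J n 0
      (legendreInit.exec f ((Prog.loop 9 clearStep).exec f (zonalInit.exec f s))) := by
  obtain ⟨s₁, hs₁⟩ : ∃ s₁, s₁ = zonalInit.exec f s := ⟨_, rfl⟩
  have hA₁ : zonalInit.Agrees s s₁ := hs₁ ▸ exec_agrees f _ _
  have hc₁ := h.of_agrees hA₁ (by simp [Prog.Keeps, zonalInit, Prog.WritesReg, Prog.WritesArr])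
  have e14 : s₁.arr 14 0 = n := by simp [hs₁, zonalInit, h.zero, h14]
  have e4 : s₁.arr 4 0 = dimDensity n 1 := by
    simp [hs₁, zonalInit, h.zero, h14, h17, dimDensity]
  have r9 : s₁.reg 9 = d + 1 := by simp [hs₁, zonalInit, h.degree, h.one]
  have key := exec_loop_invariant f (r := 9) (s := s₁) (P := clearStep)
    (fun i s' => s'.reg 8 = i ∧ s'.Lists 3 i (fun _ => 0) ∧ s'.Lists 19 i (fun _ => 0)) ?_ ?_
  · rw [← hs₁]
    obtain ⟨s₂, hs₂⟩ : ∃ s₂, s₂ = (Prog.loop 9 clearStep).exec f s₁ := ⟨_, rfl⟩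
    have hA₂ : (Prog.loop 9 clearStep).Agrees s₁ s₂ := hs₂ ▸ exec_agrees f _ _
    have hc₂ := hc₁.of_agrees hA₂
      (by simp [Prog.Keeps, clearStep, Prog.WritesReg, Prog.WritesArr])
    rw [← hs₂, r9] at key
    rw [← hs₂]
    refine ⟨hc₂.of_agrees (exec_agrees f _ _)
      (by simp [Prog.Keeps, legendreInit, Prog.WritesReg, Prog.WritesArr]), ?_, ?_, ?_, ?_, ?_, ?_⟩
    · simp [legendreInit, hA₂.2 14 (by simp [clearStep, Prog.WritesArr]), e14]
    · simp [legendreInit, hA₂.1 9 (by simp [clearStep, Prog.WritesReg]), r9]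
    · simp [legendreInit]
    · simp [legendreInit, hA₂.2 4 (by simp [clearStep, Prog.WritesArr]), e4]
    · intro k hk
      simp [legendreInit, hc₂.one, hc₂.zero, hc₂.unit, legendre, Polynomial.coeff_X,
        key.2.1 k hk, eq_comm]
    · intro k hk
      simp [legendreInit, hc₂.one, hc₂.zero, hc₂.unit, legendre, Polynomial.coeff_one,
        key.2.2 k hk]
  · exact ⟨by simp [hs₁, zonalInit], State.lists_zero _ _ _, State.lists_zero _ _ _⟩
  · rintro i s' hi hA ⟨i1, i2, i3⟩
    have hc' := hc₁.of_agrees hA (by simp [Prog.Keeps, clearStep, Prog.WritesReg, Prog.WritesArr])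
    exact ⟨by simp [clearStep, i1, hc'.one], i2.snoc fun q => by simp [clearStep, i1],
      i3.snoc fun q => by simp [clearStep, i1, hc'.zero]⟩

theorem exec_scale {n : ℕ} (f : C(Sph n, ℝ)) {N d J : ℕ} {s : State} {c : ℝ} {g : ℕ → ℝ}
    (h : Config N d J s) (h4 : s.arr 4 0 = c) (h9 : s.reg 9 = d + 1) (h3 : s.Lists 3 (d + 1) g) :
    ((Prog.natConst 8 0 ⨾ Prog.loop 9 scaleStep).exec f s).Lists 3 (d + 1)
      (fun k => c * g k) := by
  rw [exec_seq]
  obtain ⟨s₁, hs₁⟩ : ∃ s₁, s₁ = (Prog.natConst 8 0).exec f s := ⟨_, rfl⟩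
  have hA₁ : (Prog.natConst 8 0).Agrees s s₁ := hs₁ ▸ exec_agrees f _ _
  have hc₁ := h.of_agrees hA₁ (by simp [Prog.Keeps, Prog.WritesReg, Prog.WritesArr])
  have r9 : s₁.reg 9 = d + 1 := by rw [hA₁.1 9 (by simp [Prog.WritesReg]), h9]
  rw [← hs₁]
  have key := exec_loop_invariant f (r := 9) (s := s₁) (P := scaleStep)
    (fun i s' => s'.reg 8 = i ∧
      s'.Lists 3 (d + 1) (fun k => if k < i then c * g k else g k)) ?_ ?_
  · rw [r9] at key
    intro k hk
    simpa [hk] using key.2 k hk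
  · refine ⟨by simp [hs₁], fun k hk => ?_⟩
    simpa [hs₁] using h3 k hk
  · rintro i s' hi hA ⟨i1, i2⟩
    rw [r9] at hi
    have hc' := hc₁.of_agrees hA (by simp [Prog.Keeps, scaleStep, Prog.WritesReg, Prog.WritesArr])
    have e4 : s'.arr 4 0 = c := by
      rw [hA.2 4 (by simp [scaleStep, Prog.WritesArr]), hA₁.2 4 (by simp [Prog.WritesArr]), h4]
    refine ⟨by simp [scaleStep, i1, hc'.one], fun k hk => ?_⟩
    have := i2 k hk
    by_cases hki : k = i
    · subst hki
      simp only [lt_self_iff_false, if_false] at this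
      simp [scaleStep, i1, hc'.zero, e4, this, mul_comm]
    · beta_reduce
      rw [if_congr (show k < i + 1 ↔ k < i by omega) rfl rfl]
      simpa [scaleStep, i1, hki] using this

theorem exec_zonalCoeffs {n : ℕ} (hn : 2 ≤ n) (f : C(Sph n, ℝ)) {N d J : ℕ} {s : State}
    (hd : 0 < d) (h : Config N d J s) (h17 : s.arr 17 0 = (sphMeasure n).real Set.univ)
    (h14 : s.reg 14 = n) :
    (zonalCoeffs.exec f s).Lists 3 (d + 1) (zonal n d).coeff := by
  have h₁ := exec_legendreInit f h h17 h14
  have r12 : (legendreInit.exec f ((Prog.loop 9 clearStep).exec f (zonalInit.exec f s))).reg 12 =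
      d - 1 := by
    rw [exec_reg_of_not_writes f (by simp [legendreInit, Prog.WritesReg]),
      exec_reg_of_not_writes f (by simp [clearStep, Prog.WritesReg])]
    simp [zonalInit, h.degree, h.one]
  obtain ⟨s₁, hs₁⟩ : ∃ s₁, s₁ =
    legendreInit.exec f ((Prog.loop 9 clearStep).exec f (zonalInit.exec f s)) := ⟨_, rfl⟩
  rw [← hs₁] at h₁ r12
  have key := exec_loop_invariant f (r := 12) (s := s₁) (P := legendreStep)
    (fun j s' => LegendreData N d J n j s') ?_ ?_
  · rw [r12] at key
    -- The recursion starts with the pair of degrees 0 and 1, so d - 1 steps reach degree d; this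
    -- uses d > 0.
    have hd' : d - 1 + 1 = d := by omega
    have h4 := key.density
    have h3 := key.cur
    rw [hd'] at h4 h3
    have := exec_scale f key.config h4 key.length h3
    rw [zonalCoeffs, exec_seq, exec_seq, exec_seq, exec_seq, ← hs₁]
    intro k hk
    rw [this k hk, zonal_eq_dimDensity hn, Polynomial.coeff_C_mul]
  -- Entering the loop changes only the clock, on which none of these facts depends.
  · obtain ⟨⟨c1, c2, c3, c4, c5, c6, c7⟩, h2, h3, h4, h5, h6, h7⟩ := h₁
    exact ⟨⟨c1, c2, c3, c4, c5, c6, c7⟩, h2, h3, h4, h5, h6, h7⟩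
  · exact fun j s' _ _ hI => exec_legendreStep f hI


/-! ### The program -/

/-- The initialisation sets register `16`, which controls the innermost loop, and register `10` is
reassigned only after the loops. Splitting at these two points leaves a piece whose loop registers
are constant. -/
theorem timeLE_nextLevel {n : ℕ} (f : C(Sph n, ℝ)) {B N d J L o a b a' b' : ℕ} {s : State}
    (h : Config N d J s) (hN : N ≤ B) (h10 : s.reg 10 ≤ B) (hL : L + 1 ≤ B) :
    (nextLevel L o a b a' b').TimeLE f B s := by
  refine Prog.TimeLE.seq (timeLE_of_loopsOn f (by simp [nextLevelInit, Prog.LoopsOn]))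
    (Prog.TimeLE.seq (timeLE_of_loopsOn f fun q hq => ?_)
      (timeLE_of_loopsOn f (by simp [Prog.LoopsOn])))
  simp only [newNodes, newNode, newNodeInit, copyCoord, Prog.LoopsOn, or_false, false_or] at hq
  rcases hq with rfl | rfl | rfl
  · exact ⟨by simp [newNodes, newNode, newNodeInit, copyCoord, Prog.WritesReg],
      by simpa [nextLevelInit] using h10⟩
  · exact ⟨by simp [newNodes, newNode, newNodeInit, copyCoord, Prog.WritesReg],
      by simpa [nextLevelInit, h.size] using hN⟩
  · exact ⟨by simp [newNodes, newNode, newNodeInit, copyCoord, Prog.WritesReg],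
      by simpa [nextLevelInit] using hL⟩

theorem nodeCount_eq (N L : ℕ) : nodeCount N L = 2 * N ^ L := by
  induction L with
  | zero => rfl
  | succ L ih => rw [nodeCount, ih, pow_succ, mul_assoc]

theorem timeLE_levels {n : ℕ} (f : C(Sph n, ℝ)) {B N d J : ℕ} {s : State}
    (h : Config N d J s) (hT : Tables N s) (h20 : s.Lists 20 N (angleWeight N J 0))
    (h23 : s.Lists 23 N (angleWeight N J 1)) (hN : N ≤ B) (L : ℕ)
    (hB : ∀ l ≤ L, nodeCount N l ≤ B) (hL : L ≤ B) : (levels L).TimeLE f B s := by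
  induction L with
  | zero => exact timeLE_of_loopsOn f (by simp [levels, levelZero, Prog.LoopsOn])
  | succ L ih =>
    have hD := (exec_levels f h hT h20 h23 L).1
    refine Prog.TimeLE.seq (ih (fun l hl => hB l (by omega)) (by omega)) (Prog.TimeLE.seq
      (timeLE_nextLevel f hD.config hN (hD.level.count.trans_le (hB L (by omega))) hL) ?_)
    have hc := hD.config.of_agrees (exec_agrees f (nextLevel L (3 * L + 20) (3 * L + 21)
      (3 * L + 22) (3 * L + 24) (3 * L + 25)) _) (keeps_nextLevel (by simp) (by simp))
    refine timeLE_of_loopsOn f fun q hq => ?_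
    simp only [nextAngleWeights, Prog.LoopsOn, or_false, false_or] at hq
    subst hq
    exact ⟨by simp [nextAngleWeights, Prog.WritesReg], hc.size.trans_le hN⟩

theorem timeLE_evalNodes {n k : ℕ} (f : C(Sph n, ℝ)) {B : ℕ} {s : State} (h10 : s.reg 10 ≤ B) :
    (evalNodes k).TimeLE f B s := by
  refine timeLE_of_loopsOn f fun q hq => ?_
  simp only [evalNodes, evalNodesInit, evalNode, Prog.LoopsOn, or_false, false_or] at hq
  subst hq
  exact ⟨by simp [evalNodes, evalNodesInit, evalNode, Prog.WritesReg], h10⟩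

/-- Both loop registers `9` and `12` are set by `zonalInit` and left alone afterwards, so their
values are passed from piece to piece. -/
theorem timeLE_zonalCoeffs {n : ℕ} (f : C(Sph n, ℝ)) {B N d J : ℕ} {s : State}
    (h : Config N d J s) (hB : d + 1 ≤ B) : zonalCoeffs.TimeLE f B s := by
  have hr : ∀ P : Prog, ¬P.WritesReg 9 → ¬P.WritesReg 12 → ∀ t : State, t.reg 9 = d + 1 →
      t.reg 12 = d - 1 → (P.exec f t).reg 9 = d + 1 ∧ (P.exec f t).reg 12 = d - 1 :=
    fun P h9 h12 t t9 t12 => ⟨(exec_reg_of_not_writes f h9 t).trans t9,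
      (exec_reg_of_not_writes f h12 t).trans t12⟩
  have h₁ : (zonalInit.exec f s).reg 9 = d + 1 ∧ (zonalInit.exec f s).reg 12 = d - 1 := by
    simp [zonalInit, h.degree, h.one]
  have h₂ := hr (.loop 9 clearStep) (by simp [clearStep, Prog.WritesReg])
    (by simp [clearStep, Prog.WritesReg]) _ h₁.1 h₁.2
  have h₃ := hr legendreInit (by simp [legendreInit, Prog.WritesReg])
    (by simp [legendreInit, Prog.WritesReg]) _ h₂.1 h₂.2
  have h₄ := hr (.loop 12 legendreStep)
    (by simp [legendreStep, legendreStepInit, coeffStep, Prog.WritesReg])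
    (by simp [legendreStep, legendreStepInit, coeffStep, Prog.WritesReg]) _ h₃.1 h₃.2
  have h₅ := hr (.natConst 8 0) (by simp [Prog.WritesReg]) (by simp [Prog.WritesReg]) _ h₄.1 h₄.2
  refine Prog.TimeLE.seq (timeLE_of_loopsOn f (by simp [zonalInit, Prog.LoopsOn]))
    (Prog.TimeLE.seq (timeLE_of_loopsOn f fun q hq => ?_)
      (Prog.TimeLE.seq (timeLE_of_loopsOn f (by simp [legendreInit, Prog.LoopsOn]))
        (Prog.TimeLE.seq (timeLE_of_loopsOn f fun q hq => ?_)
          (Prog.TimeLE.seq (timeLE_of_loopsOn f (by simp [Prog.LoopsOn]))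
            (timeLE_of_loopsOn f fun q hq => ?_)))))
  · simp only [clearStep, Prog.LoopsOn, or_false] at hq
    subst hq
    exact ⟨by simp [clearStep, Prog.WritesReg], h₁.1.trans_le hB⟩
  · simp only [legendreStep, legendreStepInit, coeffStep, Prog.LoopsOn, or_false, false_or] at hq
    rcases hq with rfl | rfl
    · exact ⟨by simp [legendreStep, legendreStepInit, coeffStep, Prog.WritesReg],
        h₃.2.trans_le (by omega)⟩
    · exact ⟨by simp [legendreStep, legendreStepInit, coeffStep, Prog.WritesReg],
        h₃.1.trans_le hB⟩
  · simp only [scaleStep, Prog.LoopsOn, or_false] at hq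
    subst hq
    exact ⟨by simp [scaleStep, Prog.WritesReg], h₅.1.trans_le hB⟩

/-- The program for the sphere in dimension `L + 2`. -/
def approxProgram (L : ℕ) : Prog :=
  setup (L + 2) ⨾ findSize ⨾ fillTables ⨾ baseWeights ⨾ levels L ⨾
  nextLevel L (3 * L + 20) (3 * L + 21) (3 * L + 22) 0 1 ⨾ evalNodes (L + 2) ⨾ zonalCoeffs ⨾
  .natAdd 0 10 2

/-- A bound for the number of repetitions of the loops of the program. -/
def loopBound (n x : ℕ) : ℕ := 2 * (4 * (x + n)) ^ n

/-- Correctness and time are proved along the same chain of intermediate states, since the loop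
bounds depend on register values that the correctness lemmas supply. The last level is written into
the arrays `0` and `1` required for the output. -/
theorem final_approxProgram (L d m : ℕ) (hd : 0 < d) (f : C(Sph (L + 2), ℝ))
    (hN : 0 < tableSize (d + m + (L + 2) + (d + m + (L + 2)))) :
    ((approxProgram L).final f d m).Holds (productRule (d + m + (L + 2)) hN (L + 1)) d f ∧
      (approxProgram L).runTime f d m ≤ (approxProgram L).cost (loopBound (L + 2) (d + m)) := by
  obtain ⟨J, hJ⟩ : ∃ J, J = d + m + (L + 2) := ⟨_, rfl⟩
  obtain ⟨N, hNe⟩ : ∃ N, N = tableSize (J + J) := ⟨_, rfl⟩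
  obtain ⟨B, hB⟩ : ∃ B, B = loopBound (L + 2) (d + m) := ⟨_, rfl⟩
  have hN' : 0 < N := by rw [hNe, hJ]; exact hN
  have hspec := tableSize_spec (D := J + J) (by omega)
  rw [← hNe] at hspec
  -- There are 2 N^l nodes, and N ≤ 2 (J + J) = 4J by `tableSize_spec`.
  have hcount : ∀ l ≤ L + 1, nodeCount N l ≤ B := by
    intro l hl
    rw [nodeCount_eq, hB, loopBound, ← hJ]
    exact Nat.mul_le_mul_left _ ((Nat.pow_le_pow_left (by omega) l).trans
      (Nat.pow_le_pow_right (by omega) (by omega)))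
  have hBJ : 4 * J ≤ B := by
    rw [hB, loopBound, ← hJ]
    have := Nat.le_self_pow (show L + 2 ≠ 0 by omega) (4 * J)
    omega
  obtain ⟨s₁, hs₁⟩ : ∃ s, s = (setup (L + 2)).exec f (initState d m) := ⟨_, rfl⟩
  obtain ⟨s₂, hs₂⟩ : ∃ s, s = findSize.exec f s₁ := ⟨_, rfl⟩
  obtain ⟨s₃, hs₃⟩ : ∃ s, s = fillTables.exec f s₂ := ⟨_, rfl⟩
  obtain ⟨s₄, hs₄⟩ : ∃ s, s = baseWeights.exec f s₃ := ⟨_, rfl⟩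
  obtain ⟨s₅, hs₅⟩ : ∃ s, s = (levels L).exec f s₄ := ⟨_, rfl⟩
  obtain ⟨s₆, hs₆⟩ : ∃ s, s =
    (nextLevel L (3 * L + 20) (3 * L + 21) (3 * L + 22) 0 1).exec f s₅ := ⟨_, rfl⟩
  obtain ⟨s₇, hs₇⟩ : ∃ s, s = (evalNodes (L + 2)).exec f s₆ := ⟨_, rfl⟩
  obtain ⟨s₈, hs₈⟩ : ∃ s, s = zonalCoeffs.exec f s₇ := ⟨_, rfl⟩
  obtain ⟨c₁, r₁, a₁⟩ := exec_setup f d m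
  rw [← hs₁, ← hJ] at c₁ r₁
  rw [← hs₁] at a₁
  obtain ⟨c₂, a₂⟩ := exec_findSize f c₁ r₁ a₁
  rw [← hs₂, ← hNe] at c₂ a₂
  obtain ⟨c₃, t₃⟩ := exec_fillTables f c₂ a₂
  rw [← hs₃] at c₃ t₃
  obtain ⟨c₄, t₄, u₄, v₄⟩ := exec_baseWeights f c₃ t₃
  rw [← hs₄] at c₄ t₄ u₄ v₄
  obtain ⟨D₅, -⟩ := exec_levels f c₄ t₄ u₄ v₄ L
  rw [← hs₅] at D₅
  have L₆ := exec_nextLevel f (a' := 0) (b' := 1) ⟨by omega, by omega, by omega, by omega,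
    by omega, by omega, by omega, by simp, by simp⟩ D₅
  rw [← hs₆] at L₆
  have c₆ := D₅.config.of_agrees (hs₆ ▸ exec_agrees f _ s₅) (keeps_nextLevel (by simp) (by simp))
  obtain ⟨c₇, L₇, v₇, m₇, r₇⟩ := exec_evalNodes f c₆ L₆ (by omega) (by omega)
  rw [← hs₇] at c₇ L₇ v₇ m₇ r₇
  have z₈ := exec_zonalCoeffs (by omega) f hd c₇ m₇ r₇
  rw [← hs₈] at z₈
  have A₈ : zonalCoeffs.Agrees s₇ s₈ := hs₈ ▸ exec_agrees f _ s₇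
  have hw : ∀ x ∈ [0, 1, 2], ¬zonalCoeffs.WritesArr x := by
    simp [zonalCoeffs, zonalInit, clearStep, legendreInit, legendreStep, legendreStepInit,
      coeffStep, scaleStep, Prog.WritesArr]
  have hw' : ∀ q ∈ [2, 10], ¬zonalCoeffs.WritesReg q := by
    simp [zonalCoeffs, zonalInit, clearStep, legendreInit, legendreStep, legendreStepInit,
      coeffStep, scaleStep, Prog.WritesReg]
  have hfin : (approxProgram L).final f d m = (Prog.natAdd 0 10 2).exec f s₈ := by
    simp only [Prog.final, approxProgram, exec_seq, hs₈, hs₇, hs₆, hs₅, hs₄, hs₃, hs₂, hs₁]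
  constructor
  · subst hJ
    subst hNe
    rw [hfin]
    refine holds_productRule hN ?_ ?_ ?_ ?_ ?_
    · simp [A₈.1 10 (hw' 10 (by simp)), A₈.1 2 (hw' 2 (by simp)), c₇.zero, L₇.count]
    · intro v hv j hj
      have hlt : (L + 1 + 1) * v + j < (L + 1 + 1) *
          nodeCount (tableSize (d + m + (L + 2) + (d + m + (L + 2)))) (L + 1) := by
        have := Nat.mul_le_mul_left (L + 1 + 1) (Nat.succ_le_of_lt hv)
        rw [Nat.mul_succ] at this
        omega
      simp only [exec_natAdd, State.setReg_arr, State.tick_arr]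
      rw [A₈.2 0 (hw 0 (by simp)), L₇.coords _ hlt, flatCoord_mul_add _ _ _ hj]
    · intro v hv
      simp only [exec_natAdd, State.setReg_arr, State.tick_arr]
      rw [A₈.2 1 (hw 1 (by simp)), L₇.weights v hv]
    · intro v hv
      simp only [exec_natAdd, State.setReg_arr, State.tick_arr]
      rw [A₈.2 2 (hw 2 (by simp)), v₇ v hv]
    · intro k hk
      exact z₈ k (by omega)
  · have hNB : N ≤ B := by omega
    have key : (approxProgram L).TimeLE f B (initState d m) := by
      refine Prog.TimeLE.seq (timeLE_of_loopsOn f (by simp [setup, Prog.LoopsOn])) ?_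
      rw [← hs₁]
      refine Prog.TimeLE.seq (timeLE_of_loopsOn f fun q hq => ?_) ?_
      · simp only [findSize, Prog.LoopsOn, or_false] at hq
        subst hq
        exact ⟨by simp [findSize, Prog.WritesReg], by omega⟩
      rw [← hs₂]
      refine Prog.TimeLE.seq (timeLE_of_loopsOn f fun q hq => ?_) ?_
      · simp only [fillTables, fillTablesInit, fillTablesStep, Prog.LoopsOn, or_false,
          false_or] at hq
        subst hq
        exact ⟨by simp [fillTables, fillTablesInit, fillTablesStep, Prog.WritesReg],
          c₂.size.trans_le hNB⟩
      rw [← hs₃]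
      refine Prog.TimeLE.seq (timeLE_of_loopsOn f fun q hq => ?_) ?_
      · simp only [baseWeights, baseWeightsInit, baseWeightsStep, baseWeightsStepInit,
          sinePolyStep, Prog.LoopsOn, or_false, false_or] at hq
        rcases hq with rfl | rfl
        · exact ⟨by simp [baseWeights, baseWeightsInit, baseWeightsStep, baseWeightsStepInit,
            sinePolyStep, Prog.WritesReg], c₃.size.trans_le hNB⟩
        · exact ⟨by simp [baseWeights, baseWeightsInit, baseWeightsStep, baseWeightsStepInit,
            sinePolyStep, Prog.WritesReg], c₃.half.trans_le (by omega)⟩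
      rw [← hs₄]
      refine Prog.TimeLE.seq (timeLE_levels f c₄ t₄ u₄ v₄ hNB L
        (fun l hl => hcount l (by omega)) (by omega)) ?_
      rw [← hs₅]
      refine Prog.TimeLE.seq (timeLE_nextLevel f D₅.config hNB
        (D₅.level.count.trans_le (hcount L (by omega))) (by omega)) ?_
      rw [← hs₆]
      refine Prog.TimeLE.seq (timeLE_evalNodes f (L₆.count.trans_le (hcount _ le_rfl))) ?_
      rw [← hs₇]
      exact Prog.TimeLE.seq (timeLE_zonalCoeffs f c₇ (by omega))
        (timeLE_of_loopsOn f (by simp [Prog.LoopsOn]))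
    rw [Prog.TimeLE] at key
    rw [← hB]
    simpa [initState, Prog.runTime, Prog.final] using key

theorem exists_loopBound_cost_le (n : ℕ) (P : Prog) :
    ∃ K a : ℕ, ∀ x, 0 < x → P.cost (loopBound n x) ≤ K * x ^ a := by
  obtain ⟨c, e, h⟩ := exists_cost_le P
  refine ⟨c * (2 * (4 * (n + 1)) ^ n) ^ e, n * e, fun x hx => ?_⟩
  have h1 : 1 ≤ loopBound n x := Nat.mul_pos two_pos (Nat.pow_pos (by omega))
  have h2 : loopBound n x ≤ 2 * (4 * (n + 1)) ^ n * x ^ n := by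
    rw [loopBound, mul_assoc, ← mul_pow]
    refine Nat.mul_le_mul_left _ (Nat.pow_le_pow_left ?_ _)
    have := Nat.le_mul_of_pos_right n hx
    linarith
  calc P.cost (loopBound n x) ≤ c * loopBound n x ^ e := h _ h1
    _ ≤ c * (2 * (4 * (n + 1)) ^ n * x ^ n) ^ e :=
      Nat.mul_le_mul_left _ (Nat.pow_le_pow_left h2 _)
    _ = c * (2 * (4 * (n + 1)) ^ n) ^ e * x ^ (n * e) := by rw [mul_pow, ← pow_mul]; ring

/-- As n d^n ≥ 1, the square root of the dimension is crudely at most n d^n. So d + m is bounded by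
multiples of d^n and (κ/ε) d^n, and both are at most ((1 + κ/ε) d)^n. -/
theorem degree_add_parameter_le {n : ℕ} (hn : 2 ≤ n) {d : ℕ} (hd : 0 < d) {κ ε : ℝ} (hκ : 0 ≤ κ)
    (hε : 0 < ε) {C : ℕ} : ((d + max 1 ⌈(C : ℝ) * κ * √(dimHarm n d) / ε⌉₊ : ℕ) : ℝ) ≤
      ((2 + C * n : ℕ) : ℝ) * ((1 + κ / ε) * d) ^ n := by
  obtain ⟨x, hx⟩ : ∃ x, x = (C : ℝ) * κ * √(dimHarm n d) / ε := ⟨_, rfl⟩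
  have hd1 : (1 : ℝ) ≤ d := by exact_mod_cast hd
  have hn1 : (1 : ℝ) ≤ n := by exact_mod_cast (by omega : 1 ≤ n)
  have hr : 0 ≤ κ / ε := div_nonneg hκ hε.le
  have hdn : (1 : ℝ) ≤ (d : ℝ) ^ n := one_le_pow₀ hd1
  have hdim : (dimHarm n d : ℝ) ≤ n * (d : ℝ) ^ n := by
    obtain ⟨e, rfl⟩ : ∃ e, d = e + 1 := ⟨d - 1, by omega⟩
    have := dimHarm_le hn e
    push_cast
    exact this
  have hsq : √(dimHarm n d) ≤ n * (d : ℝ) ^ n := by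
    rw [Real.sqrt_le_left (by positivity)]
    nlinarith [mul_le_mul hn1 hdn zero_le_one (by positivity)]
  have hx0 : 0 ≤ x := by rw [hx]; positivity
  have hxle : x ≤ C * (κ / ε) * (n * (d : ℝ) ^ n) := by
    rw [hx, show (C : ℝ) * κ * √(dimHarm n d) / ε = C * (κ / ε) * √(dimHarm n d) by ring]
    exact mul_le_mul_of_nonneg_left hsq (by positivity)
  have hmax : ((max 1 ⌈x⌉₊ : ℕ) : ℝ) ≤ x + 1 := by
    rw [Nat.cast_max]
    exact max_le (by simpa using hx0) (Nat.ceil_lt_add_one hx0).le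
  have hdle : (d : ℝ) ≤ (d : ℝ) ^ n := le_self_pow₀ hd1 (by omega)
  have h1 : (1 : ℝ) ≤ 1 + κ / ε := by linarith
  have hpow : 1 + κ / ε ≤ (1 + κ / ε) ^ n := le_self_pow₀ h1 (by omega)
  rw [← hx]
  push_cast at hmax ⊢
  have h2 : (1 + κ / ε) * (d : ℝ) ^ n ≤ ((1 + κ / ε) * d) ^ n := by
    rw [mul_pow]
    exact mul_le_mul_of_nonneg_right hpow (by positivity)
  calc (d : ℝ) + max 1 (⌈x⌉₊ : ℝ) ≤ 2 * (d : ℝ) ^ n + C * (κ / ε) * (n * (d : ℝ) ^ n) := by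
        linarith
    _ ≤ (2 + C * n) * ((1 + κ / ε) * (d : ℝ) ^ n) := by
        have : 0 ≤ (C : ℝ) * n * (d : ℝ) ^ n := by positivity
        have : 0 ≤ κ / ε * (d : ℝ) ^ n := by positivity
        linarith
    _ ≤ (2 + C * n) * ((1 + κ / ε) * d) ^ n := mul_le_mul_of_nonneg_left h2 (by positivity)

end SphereApprox

end


/-! ### The theorem. -/

theorem theorem4p4 (n : ℕ) (hn : 2 ≤ n) :
    ∃ (C : ℝ) (P : Prog) (K a : ℕ), 0 < C ∧
      -- the program `P` carries out the algorithm, in time polynomial in `d` and `m`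
      (∀ d m : ℕ, 0 < d → 0 < m →
        ∃ Q : QuadratureRule n, Q.IsExact (d + m) ∧ Q.IsExact (2 * d) ∧
          ∀ f : C(Sph n, ℝ),
            (P.final f d m).Holds Q d f ∧ P.runTime f d m ≤ K * (d + m) ^ a) ∧
      -- whichever exact rule is used, the output is a polynomial `ε`-approximation of `f_d`
      (∀ d m : ℕ, 0 < d → 0 < m →
        ∀ Q : QuadratureRule n, Q.IsExact (d + m) → Q.IsExact (2 * d) →
          ∀ (f : C(Sph n, ℝ)) (κ ε : ℝ), 0 ≤ κ → 0 < ε → IsGeodesicLipschitz κ f →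
            C * κ * Real.sqrt (dimHarm n d) / ε ≤ m →
              (harmonicApprox Q d f).totalDegree ≤ d ∧
              ‖restrict n (harmonicApprox Q d f) - harmonicComponent n d f‖ < ε) ∧
      -- with this choice of `m` the running time is polynomial in `d`
      (∀ d : ℕ, 0 < d → ∀ κ ε : ℝ, 0 ≤ κ → 0 < ε → ∀ f : C(Sph n, ℝ),
        (P.runTime f d (max 1 ⌈C * κ * Real.sqrt (dimHarm n d) / ε⌉₊) : ℝ) ≤
          K * ((1 + κ / ε) * d) ^ a) := by
  obtain ⟨L, rfl⟩ : ∃ L, n = L + 2 := ⟨n - 2, by omega⟩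
  obtain ⟨K, a, hK⟩ := exists_loopBound_cost_le (L + 2) (approxProgram L)
  obtain ⟨C, hC⟩ : ∃ C : ℕ, C = 24 * (L + 2 + 1) := ⟨_, rfl⟩
  obtain ⟨M, hM⟩ : ∃ M : ℕ, M = 2 + C * (L + 2) := ⟨_, rfl⟩
  have htable : ∀ d m : ℕ, d + m + (L + 2) + (d + m + (L + 2)) <
      tableSize (d + m + (L + 2) + (d + m + (L + 2))) := fun d m =>
    (tableSize_spec (by omega)).1
  have htime : ∀ (f : C(Sph (L + 2), ℝ)) (d m : ℕ), 0 < d →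
      (approxProgram L).runTime f d m ≤ K * (d + m) ^ a := fun f d m hd =>
    (final_approxProgram L d m hd f ((Nat.zero_le _).trans_lt (htable d m))).2.trans
      (hK _ (by omega))
  -- The bound K (d + m)^a combined with d + m ≤ M ((1 + κ/ε) d)^n gives the third claim with K M^a
  -- and n a. The first claim holds with these larger values as well, so one pair serves both.
  refine ⟨C, approxProgram L, K * M ^ a, (L + 2) * a, ?_, fun d m hd hm => ?_, ?_, ?_⟩
  · rw [hC]
    positivity
  -- With J = d + m + n, twice J exceeds both d + m and 2d by more than n - 1, the reserve that the
  -- product rule requires.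
  · refine ⟨productRule (d + m + (L + 2)) ((Nat.zero_le _).trans_lt (htable d m)) (L + 1),
      isExact_productRule _ ?_ ?_, isExact_productRule _ ?_ ?_, fun f =>
        ⟨(final_approxProgram L d m hd f _).1, (htime f d m hd).trans ?_⟩⟩
    · have := htable d m
      omega
    · omega
    · have := htable d m
      omega
    · omega
    · refine Nat.mul_le_mul (Nat.le_mul_of_pos_right _ (Nat.pow_pos (by omega)))
        (Nat.pow_le_pow_right (by omega) (Nat.le_mul_of_pos_left _ (by omega)))
  · intro d m _ hm Q hQ1 hQ2 f κ ε hκ hε hf h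
    refine ⟨totalDegree_harmonicApprox_le hn Q d f,
      norm_harmonicApprox_sub_lt hn hm hQ1 hQ2 hκ hε hf ?_⟩
    rw [hC] at h
    push_cast at h ⊢
    exact h
  · intro d hd κ ε hκ hε f
    have h1 : ((approxProgram L).runTime f d (max 1 ⌈(C : ℝ) * κ * √(dimHarm (L + 2) d) / ε⌉₊) : ℝ)
        ≤ K * ((d + max 1 ⌈(C : ℝ) * κ * √(dimHarm (L + 2) d) / ε⌉₊ : ℕ) : ℝ) ^ a := by
      exact_mod_cast htime f d _ hd
    refine h1.trans ?_
    have h2 := degree_add_parameter_le hn hd hκ hε (C := C)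
    rw [← hM] at h2
    calc _ ≤ (K : ℝ) * (M * ((1 + κ / ε) * d) ^ (L + 2)) ^ a :=
          mul_le_mul_of_nonneg_left (pow_le_pow_left₀ (Nat.cast_nonneg _) h2 _) (Nat.cast_nonneg _)
      _ = _ := by
          push_cast
          rw [mul_pow, pow_mul, mul_assoc]
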